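/- **Theorem 2.** An instance of *Unique Label Cover* consists of a finite simple undirected graph $G$, a finite alphabet $\Sigma$, an integer $k\ge 0$, a list $\phi_v\subseteq\Sigma$ for each vertex $v$, and, for each edge $e=uv$, partial permutations $\psi_{e,u}$ and $\psi_{e,v}=\psi_{e,u}^{-1}$ of $\Sigma$, i.e. relations $\psi\subseteq\Sigma\times\Sigma$ in which every label has at most one image and at most one preimage. All of this is given explicitly. * *Edge Unique Label Cover* asks whether there are a set $F\subseteq E(G)$ with $|F|\le k$ and a labeling $\Psi:V(G)\to\Sigma$ such that $\Psi(v)\in\phi_v$ for all $v\in V(G)$ and $(\Psi(u),\Psi(v))\in\psi_{uv,u}$ for all $uv\in E(G)\setminus F$. * *Node Unique Label Cover* asks whether there are a set $X\subseteq V(G)$ with $|X|\le k$ and a labeling $\Psi:V(G)\setminus X\to\Sigma$ such that $\Psi(v)\in\phi_v$ for all $v\in V(G)\setminus X$ and $(\Psi(u),\Psi(v))\in\psi_{uv,u}$ for all $uv\in E(G\setminus X)$. Then Edge Unique Label Cover and Node Unique Label Cover, both parameterized by $k$ alone, are $W[1]$-hard: every parameterized problem in $W[1]$ has a parameterized reduction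 to each of them, that is, a map $(x,k)\mapsto(x',k')$ that preserves yes- and no-instances, is computable in time $f(k)\cdot|x|^{O(1)}$, and satisfies $k'\le g(k)$, for some computable functions $f,g$. Both problems remain $W[1]$-hard when restricted to instances in which $\phi_v=\Sigma$ for every vertex $v$ and every edge constraint is a permutation of $\Sigma$. Here $W[1]$ is the class of all parameterized problems that have a parameterized reduction to the weighted definability problem of some formula $\varphi(X)=\forall x_1\cdots\forall x_r\,\theta$, with $\theta$ a quantifier-free first-order formula over a finite relational vocabulary and a relation variable $X$ of some arity $s$: given a finite structure $A$ and the parameter $k$, is there a relation $S\subseteq A^s$ with $|S|=k$ such that $A\models\varphi(S)$? -/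

import Mathlib

/-! ### Random access machines with a step count

Programs are in structured form. A program has natural-number registers and finitely many
unbounded memory arrays with indirect addressing; addition and truncated subtraction are the only
arithmetic, and the cost measure is uniform (one unit per executed instruction or test). As there
is no multiplication, this is polynomially equivalent to Turing machines. -/

namespace RAM

inductive Expr : Type
  | lit (c : ℕ)
  | reg (x : ℕ)
  | read (a : ℕ) (addr : Expr)
  | add (e₁ e₂ : Expr)
  | sub (e₁ e₂ : Expr)

inductive Prog : Type
  | skip
  | assign (x : ℕ) (e : Expr)
  | write (a : ℕ) (addr e : Expr)
  | seq (p q : Prog)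
  | ite (e : Expr) (p q : Prog)
  | loop (e : Expr) (p : Prog)

structure State : Type where
  reg : ℕ → ℕ
  arr : ℕ → ℕ → ℕ

def Expr.eval (σ : State) : Expr → ℕ
  | .lit c => c
  | .reg x => σ.reg x
  | .read a e => σ.arr a (e.eval σ)
  | .add e₁ e₂ => e₁.eval σ + e₂.eval σ
  | .sub e₁ e₂ => e₁.eval σ - e₂.eval σ

/-- `Run p σ σ' t`: started in state `σ`, the program `p` halts in state `σ'` after exactly `t`
steps. The tests of `ite` and `loop` mean "the value is nonzero". -/
inductive Run : Prog → State → State → ℕ → Prop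
  | skip (σ : State) : Run .skip σ σ 1
  | assign (σ : State) (x : ℕ) (e : Expr) :
      Run (.assign x e) σ ⟨Function.update σ.reg x (e.eval σ), σ.arr⟩ 1
  | write (σ : State) (a : ℕ) (i e : Expr) :
      Run (.write a i e) σ
        ⟨σ.reg, Function.update σ.arr a (Function.update (σ.arr a) (i.eval σ) (e.eval σ))⟩ 1
  | seq {p q : Prog} {σ₁ σ₂ σ₃ : State} {t₁ t₂ : ℕ} :
      Run p σ₁ σ₂ t₁ → Run q σ₂ σ₃ t₂ → Run (.seq p q) σ₁ σ₃ (t₁ + t₂)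
  | ite_true {e : Expr} {p q : Prog} {σ σ' : State} {t : ℕ} :
      e.eval σ ≠ 0 → Run p σ σ' t → Run (.ite e p q) σ σ' (t + 1)
  | ite_false {e : Expr} {p q : Prog} {σ σ' : State} {t : ℕ} :
      e.eval σ = 0 → Run q σ σ' t → Run (.ite e p q) σ σ' (t + 1)
  | loop_done {e : Expr} {p : Prog} {σ : State} :
      e.eval σ = 0 → Run (.loop e p) σ σ 1
  | loop_step {e : Expr} {p : Prog} {σ₁ σ₂ σ₃ : State} {t₁ t₂ : ℕ} :
      e.eval σ₁ ≠ 0 → Run p σ₁ σ₂ t₁ → Run (.loop e p) σ₂ σ₃ t₂ →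
        Run (.loop e p) σ₁ σ₃ (t₁ + t₂ + 1)

/-- Initial state on input `(x, k)`: the bits of `x` are in array `0`, its length in register `0`,
the parameter `k` in register `1`, and everything else is `0`. -/
def State.init (x : List Bool) (k : ℕ) : State where
  reg v := if v = 0 then x.length else if v = 1 then k else 0
  arr a i := if a = 0 then (x.getD i false).toNat else 0

/-- The state shows the output `(x, k)`, in the format of the input; the rest of the memory is
arbitrary. -/
def State.Outputs (σ : State) (x : List Bool) (k : ℕ) : Prop :=
  σ.reg 0 = x.length ∧ σ.reg 1 = k ∧ ∀ i < x.length, σ.arr 0 i = (x.getD i false).toNat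

end RAM

/-! ### Parameterized problems and the class W[1] -/

/-- A parameterized problem: the set of its yes-instances `(x, k)`, with parameter `k`. -/
abbrev ParamProblem : Type := Set (List Bool × ℕ)

/-- Parameterized (many-one fpt-) reductions, computable in time `f(k) * |x|^O(1)`. -/
def FPTReducible (P Q : ParamProblem) : Prop :=
  ∃ (red : List Bool × ℕ → List Bool × ℕ) (p : RAM.Prog) (f g : ℕ → ℕ) (c : ℕ),
    Computable f ∧ Computable g ∧
    (∀ x k, (x, k) ∈ P ↔ red (x, k) ∈ Q) ∧
    (∀ x k, (red (x, k)).2 ≤ g k) ∧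
    ∀ x k, ∃ (σ : RAM.State) (t : ℕ),
      RAM.Run p (RAM.State.init x k) σ t ∧ t ≤ f k * (x.length + 1) ^ c ∧
      σ.Outputs (red (x, k)).1 (red (x, k)).2

namespace WeightedDef

/-- The relational vocabulary with symbols `i : ι` of arity `ar i`. -/
def vocab {ι : Type} (ar : ι → ℕ) : FirstOrder.Language.{0, 0} where
  Functions _ := Empty
  Relations l := {i : ι // ar i = l}

/-- The structure with universe `A` that interprets the symbol `i` by the relation `R i`. -/
@[reducible]
def vocabStructure {ι : Type} (ar : ι → ℕ) {A : Type} (R : ∀ i, Set (Fin (ar i) → A)) :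
    (vocab ar).Structure A where
  funMap f _ := f.elim
  RelMap r x := (fun j => x (Fin.cast r.2 j)) ∈ R r.1

/-- Arities of the vocabulary `ar` extended by one relation variable `X = none` of arity `s`. -/
def extArity {m : ℕ} (ar : Fin m → ℕ) (s : ℕ) : Option (Fin m) → ℕ
  | none => s
  | some i => ar i

/-- The expansion of the structure `R` in which `X` is interpreted by `S`. -/
def extRel {m n s : ℕ} {ar : Fin m → ℕ} (R : ∀ i, Set (Fin (ar i) → Fin n))
    (S : Set (Fin s → Fin n)) : ∀ i, Set (Fin (extArity ar s i) → Fin n)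
  | none => S
  | some i => R i

/-- `A ⊨ φ(S)` for the structure `A = (Fin n, R)`. -/
def Models {m n s : ℕ} {ar : Fin m → ℕ} (R : ∀ i, Set (Fin (ar i) → Fin n))
    (S : Set (Fin s → Fin n)) (φ : (vocab (extArity ar s)).Sentence) : Prop :=
  letI := vocabStructure (extArity ar s) (extRel R S)
  FirstOrder.Language.Sentence.Realize (Fin n) φ

open Classical in
/-- A finite structure as a word: the size of the universe in unary, then the characteristic bit
table of each relation. -/
noncomputable def encode {m n : ℕ} {ar : Fin m → ℕ} (R : ∀ i, Set (Fin (ar i) → Fin n)) :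
    List Bool :=
  List.replicate n true ++ false ::
    (List.finRange m).flatMap fun i =>
      List.ofFn fun j : Fin (n ^ ar i) => decide (finFunctionFinEquiv.symm j ∈ R i)

/-- The weighted definability problem of `φ(X)`: given a finite structure `A` and the parameter
`k`, is there a relation `S ⊆ A^s` with exactly `k` tuples such that `A ⊨ φ(S)`? -/
def problem {m : ℕ} (ar : Fin m → ℕ) (s : ℕ) (φ : (vocab (extArity ar s)).Sentence) :
    ParamProblem :=
  {I | ∃ (n : ℕ) (R : ∀ i, Set (Fin (ar i) → Fin n)), 0 < n ∧ I.1 = encode R ∧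
    ∃ S : Finset (Fin s → Fin n), S.card = I.2 ∧ Models R (S : Set (Fin s → Fin n)) φ}

end WeightedDef

/-- `W[1]`: the closure under fpt-reductions of the weighted definability problems of `Π₁`-formulas
`φ(X)` (universally quantified, with a quantifier-free matrix). -/
def InW1 (P : ParamProblem) : Prop :=
  ∃ (m s : ℕ) (ar : Fin m → ℕ)
    (φ : (WeightedDef.vocab (WeightedDef.extArity ar s)).Sentence),
    FirstOrder.Language.BoundedFormula.IsUniversal φ ∧ FPTReducible P (WeightedDef.problem ar s φ)

def W1Hard (P : ParamProblem) : Prop :=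
  ∀ Q : ParamProblem, InW1 Q → FPTReducible Q P

/-! ### Unique Label Cover -/

/-- Partial permutations: every label has at most one image and at most one preimage. -/
def IsPartialPerm {α : Type} (ψ : Set (α × α)) : Prop :=
  (∀ a b b', (a, b) ∈ ψ → (a, b') ∈ ψ → b = b') ∧ (∀ a a' b, (a, b) ∈ ψ → (a', b) ∈ ψ → a = a')

/-- (The graph of) a permutation. -/
def IsPerm {α : Type} (ψ : Set (α × α)) : Prop :=
  ∃ π : Equiv.Perm α, ψ = {q | π q.1 = q.2}

/-- An instance of Unique Label Cover without the budget `k`, on the vertex set `Fin n` and with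
the alphabet `Fin s`. For an edge `e = uv`, `ψ u v` is the constraint `ψ_{e,u}`; the value of `ψ` on
nonadjacent pairs has no meaning. -/
structure ULC where
  n : ℕ
  s : ℕ
  G : SimpleGraph (Fin n)
  φ : Fin n → Set (Fin s)
  ψ : Fin n → Fin n → Set (Fin s × Fin s)
  partialPerm : ∀ u v, G.Adj u v → IsPartialPerm (ψ u v)
  reverse : ∀ u v, G.Adj u v → ∀ a b, (a, b) ∈ ψ u v ↔ (b, a) ∈ ψ v u

namespace ULC

/-- At most `k` edges can be deleted so that the remaining constraints are satisfiable. -/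
def EdgeSolvable (I : ULC) (k : ℕ) : Prop :=
  ∃ (F : Finset (Sym2 (Fin I.n))) (lab : Fin I.n → Fin I.s),
    (F : Set (Sym2 (Fin I.n))) ⊆ I.G.edgeSet ∧ F.card ≤ k ∧ (∀ v, lab v ∈ I.φ v) ∧
    ∀ u v, I.G.Adj u v → s(u, v) ∉ F → (lab u, lab v) ∈ I.ψ u v

/-- At most `k` vertices can be deleted so that the remaining constraints are satisfiable. -/
def NodeSolvable (I : ULC) (k : ℕ) : Prop :=
  ∃ (X : Finset (Fin I.n)) (lab : {v : Fin I.n // v ∉ X} → Fin I.s),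
    X.card ≤ k ∧ (∀ v : {v : Fin I.n // v ∉ X}, lab v ∈ I.φ v) ∧
    ∀ u v : {v : Fin I.n // v ∉ X}, I.G.Adj u v → (lab u, lab v) ∈ I.ψ u v

/-- All vertex lists are the full alphabet and all edge constraints are permutations. -/
def Full (I : ULC) : Prop :=
  (∀ v, I.φ v = Set.univ) ∧ ∀ u v, I.G.Adj u v → IsPerm (I.ψ u v)

open Classical in
/-- An instance as a word: the numbers of vertices and of labels in unary, then the adjacency
matrix, the vertex lists and the edge constraints (empty for nonadjacent pairs) as bit tables. -/
noncomputable def encode (I : ULC) : List Bool :=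
  List.replicate I.n true ++ false :: (List.replicate I.s true ++ false ::
    (((List.finRange I.n).flatMap fun u => (List.finRange I.n).map fun v => decide (I.G.Adj u v)) ++
    ((List.finRange I.n).flatMap fun v => (List.finRange I.s).map fun a => decide (a ∈ I.φ v)) ++
    ((List.finRange I.n).flatMap fun u => (List.finRange I.n).flatMap fun v =>
      (List.finRange I.s).flatMap fun a => (List.finRange I.s).map fun b =>
        decide (I.G.Adj u v ∧ (a, b) ∈ I.ψ u v))))

end ULC

/-- Edge Unique Label Cover, parameterized by `k` only. -/
def EdgeULC : ParamProblem :=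
  {J | ∃ I : ULC, J.1 = I.encode ∧ I.EdgeSolvable J.2}

/-- Node Unique Label Cover, parameterized by `k` only. -/
def NodeULC : ParamProblem :=
  {J | ∃ I : ULC, J.1 = I.encode ∧ I.NodeSolvable J.2}

/-- Edge Unique Label Cover with full lists and permutation constraints. -/
def EdgeULCFull : ParamProblem :=
  {J | ∃ I : ULC, I.Full ∧ J.1 = I.encode ∧ I.EdgeSolvable J.2}

/-- Node Unique Label Cover with full lists and permutation constraints. -/
def NodeULCFull : ParamProblem :=
  {J | ∃ I : ULC, I.Full ∧ J.1 = I.encode ∧ I.NodeSolvable J.2}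

/-! All four problems lie between `EdgeULCFull` and `NodeULC`, since deleting one end of an edge can
replace deleting the edge. So a single reduction suffices: yes-instances must become full instances
solvable by edge deletions, and an output solvable by vertex deletions must come from a yes-instance
(`mem_problem_iff_reduction_mem`, `w1Hard_of_subset`).

A universal sentence becomes a quantifier-free formula `θ` tested under all assignments; its truth
depends only on which tuples of its boundedly many atoms lie in the set `S` (`QF.eval_congr_set`).
Let `t 0, …, t (k - 1)` be the unknown tuples of `S`. There is a right variable for each index `j`,
labeled by `t j`, and a left variable for each choice `c` of `q` indices, where `q` exceeds the
number of atoms. The label of `c` lists the chosen tuples, which form a set `P ⊆ S`, and certifies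
that each assignment violating `θ` for `P` has an atom in `S \ P`. The certificate comes from a
bounded search tree: take the first assignment not yet hit and branch over its atoms. Each level
yields a new element of `S`, so `k` levels suffice (`SatInstance.exists_branch`). Listing the tuples
found would need too many labels; storing only the branching decisions and the indices of the tuples
gives a number of labels of the form `f(k) * n ^ O(1)`.

Conversely, suppose that `x` violates `θ` for `S`, and let `c` contain the indices of all atoms of
`x` in `S`. Then `P` and `S` agree on the atoms of `x`, so `x` violates `θ` for `P`, and the
certificate produces an atom in `S \ P`, a contradiction (`SatInstance.sat_of_nodeSolvable`).

Tuples are compared by paths that must be cut once (`PathSystem`). A left label is admitted on an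
initial part that is longer for a larger tuple, a right label on a final part that begins later for
a larger tuple, so one cut enforces an inequality; a second path with reversed order gives equality.
The number of paths is the budget and depends on `k` only. Lists are simulated by permutations:
labels have two copies, and a triangle at each position swaps the copies of forbidden labels.

The programs run in time polynomial in `n`, `k` and `Z ^ k` (`RAM.Cmp`). In the composition with a
given reduction, the intermediate word may be longer than the time spent on it, but its leading
unary block is not much longer than that time and the input (`RAM.Run.exists_arr_eq_zero`). -/

/-! ### Total correctness of programs with a time bound -/

namespace RAM

/-- Started in `σ`, the program `p` halts within `T` steps in a state that satisfies `Q`. -/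
def Halts (p : Prog) (σ : State) (Q : State → Prop) (T : ℕ) : Prop :=
  ∃ σ' t, Run p σ σ' t ∧ Q σ' ∧ t ≤ T

lemma Halts.mono {p : Prog} {σ : State} {Q Q' : State → Prop} {T T' : ℕ} (h : Halts p σ Q T)
    (hQ : ∀ σ', Q σ' → Q' σ') (hT : T ≤ T') : Halts p σ Q' T' := by
  obtain ⟨σ', t, hr, hq, ht⟩ := h
  exact ⟨σ', t, hr, hQ _ hq, ht.trans hT⟩

lemma Halts.seq {p q : Prog} {σ : State} {Q R : State → Prop} {T₁ T₂ : ℕ}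
    (h₁ : Halts p σ Q T₁) (h₂ : ∀ σ', Q σ' → Halts q σ' R T₂) :
    Halts (.seq p q) σ R (T₁ + T₂) := by
  obtain ⟨σ₁, t₁, hr₁, hq₁, ht₁⟩ := h₁
  obtain ⟨σ₂, t₂, hr₂, hq₂, ht₂⟩ := h₂ _ hq₁
  exact ⟨σ₂, _, hr₁.seq hr₂, hq₂, by omega⟩

lemma Halts.assign {x : ℕ} {e : Expr} {σ : State} {Q : State → Prop}
    (h : Q ⟨Function.update σ.reg x (e.eval σ), σ.arr⟩) : Halts (.assign x e) σ Q 1 :=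
  ⟨_, _, Run.assign σ x e, h, le_rfl⟩

lemma Halts.write {a : ℕ} {i e : Expr} {σ : State} {Q : State → Prop}
    (h : Q ⟨σ.reg, Function.update σ.arr a
      (Function.update (σ.arr a) (i.eval σ) (e.eval σ))⟩) : Halts (.write a i e) σ Q 1 :=
  ⟨_, _, Run.write σ a i e, h, le_rfl⟩

lemma Halts.ite {e : Expr} {p q : Prog} {σ : State} {Q : State → Prop} {T : ℕ}
    (hp : e.eval σ ≠ 0 → Halts p σ Q T) (hq : e.eval σ = 0 → Halts q σ Q T) :
    Halts (.ite e p q) σ Q (T + 1) := by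
  by_cases h : e.eval σ = 0
  · obtain ⟨σ', t, hr, hQ, ht⟩ := hq h
    exact ⟨σ', _, Run.ite_false h hr, hQ, by omega⟩
  · obtain ⟨σ', t, hr, hQ, ht⟩ := hp h
    exact ⟨σ', _, Run.ite_true h hr, hQ, by omega⟩

/-- Indexing the invariant by the iteration makes the number of rounds part of the correctness
proof, which yields the time bound. -/
lemma Halts.loop {e : Expr} {p : Prog} (Inv : ℕ → State → Prop) (N T : ℕ)
    (hbody : ∀ i < N, ∀ σ, Inv i σ → e.eval σ ≠ 0 ∧ Halts p σ (Inv (i + 1)) T)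
    (hdone : ∀ σ, Inv N σ → e.eval σ = 0) {σ : State} (h₀ : Inv 0 σ) :
    Halts (.loop e p) σ (Inv N) (N * (T + 1) + 1) := by
  have key : ∀ m i, i + m = N → ∀ σ, Inv i σ → Halts (.loop e p) σ (Inv N) (m * (T + 1) + 1) := by
    intro m
    induction m with
    | zero =>
      intro i hi σ hσ
      obtain rfl : i = N := by omega
      exact ⟨σ, 1, Run.loop_done (hdone _ hσ), hσ, by omega⟩
    | succ m ih =>
      intro i hi σ hσ
      obtain ⟨he, σ₁, t₁, hr₁, hq₁, ht₁⟩ := hbody i (by omega) σ hσ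
      obtain ⟨σ₂, t₂, hr₂, hq₂, ht₂⟩ := ih (i + 1) (by omega) σ₁ hq₁
      refine ⟨σ₂, _, Run.loop_step he hr₁ hr₂, hq₂, ?_⟩
      rw [add_mul]
      omega
  exact key N 0 (by omega) σ h₀

/-! ### Polynomially bounded functions -/

/-- `f` is bounded by a polynomial in `B`. -/
def PolyBdd {α : Type} (B f : α → ℕ) : Prop := ∃ C c, ∀ a, f a ≤ C * (B a + 1) ^ c

namespace PolyBdd

variable {α β : Type} {B B' f g : α → ℕ}

lemma const (B : α → ℕ) (n : ℕ) : PolyBdd B fun _ => n := ⟨n, 0, fun a => by simp⟩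

lemma self (B : α → ℕ) : PolyBdd B B := ⟨1, 1, fun a => by simp⟩

lemma mono (hg : PolyBdd B g) (h : ∀ a, f a ≤ g a) : PolyBdd B f := by
  obtain ⟨C, c, hC⟩ := hg
  exact ⟨C, c, fun a => (h a).trans (hC a)⟩

lemma mul (hf : PolyBdd B f) (hg : PolyBdd B g) : PolyBdd B fun a => f a * g a := by
  obtain ⟨C, c, hC⟩ := hf
  obtain ⟨D, d, hD⟩ := hg
  refine ⟨C * D, c + d, fun a => (Nat.mul_le_mul (hC a) (hD a)).trans_eq ?_⟩
  rw [pow_add]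
  ring

lemma add (hf : PolyBdd B f) (hg : PolyBdd B g) : PolyBdd B fun a => f a + g a := by
  obtain ⟨C, c, hC⟩ := hf
  obtain ⟨D, d, hD⟩ := hg
  refine ⟨C + D, c + d, fun a => (Nat.add_le_add (hC a) (hD a)).trans ?_⟩
  rw [add_mul]
  gcongr <;> omega

lemma pow (hf : PolyBdd B f) (m : ℕ) : PolyBdd B fun a => f a ^ m := by
  induction m with
  | zero => simpa using const B 1
  | succ m ih => simpa only [pow_succ] using ih.mul hf

lemma trans (hB : PolyBdd B B') (hf : PolyBdd B' f) : PolyBdd B f := by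
  obtain ⟨C, c, hC⟩ := hf
  exact ((const B C).mul ((hB.add (const B 1)).pow c)).mono hC

lemma comp (hf : PolyBdd B f) (g : β → α) : PolyBdd (fun b => B (g b)) fun b => f (g b) := by
  obtain ⟨C, c, hC⟩ := hf
  exact ⟨C, c, fun b => hC _⟩

lemma of_le (h : ∀ a, f a ≤ B a) : PolyBdd B f := (self B).mono h

/-- Bounds that also depend on a number `i` may be evaluated at a polynomially bounded `i`. -/
lemma exists_le_of_le {T : α × ℕ → ℕ} (hT : PolyBdd (fun p : α × ℕ => B p.1 + p.2) T)
    (hf : PolyBdd B f) : ∃ H, PolyBdd B H ∧ ∀ a, ∀ i ≤ f a, T (a, i) ≤ H a := by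
  obtain ⟨C, c, hC⟩ := hT
  refine ⟨_, (const B C).mul ((((self B).add hf).add (const B 1)).pow c), fun a i hi => ?_⟩
  refine (hC (a, i)).trans ?_
  simp only
  gcongr

end PolyBdd

/-! ### Functions computable in polynomial time from the contents of registers and arrays -/

/-- A context: states that hold the data `a : α` in the registers below `size` and in the arrays,
together with the quantity `bound a` in which running times are measured. -/
structure Ctx (α : Type) where
  rel : α → State → Prop
  size : ℕ
  bound : α → ℕ
  inv : ∀ a σ σ', rel a σ → (∀ i < size, σ'.reg i = σ.reg i) → σ'.arr = σ.arr → rel a σ'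

/-- The context with one more number, in register `d`. -/
def Ctx.ext {α : Type} (Γ : Ctx α) (d : ℕ) (hd : Γ.size ≤ d) : Ctx (α × ℕ) where
  rel p σ := Γ.rel p.1 σ ∧ σ.reg d = p.2
  size := d + 1
  bound p := Γ.bound p.1 + p.2
  inv a σ σ' h hr ha :=
    ⟨Γ.inv _ σ σ' h.1 (fun i hi => hr i (by omega)) ha, (hr d (by omega)).trans h.2⟩

/-- `f` is polynomially bounded and computable in polynomial time in the context `Γ`: for all `d`
beyond the registers of `Γ` there is a program that puts the value of `f` into register `d`, and
changes neither the registers below `d` nor the arrays. -/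
def Cmp {α : Type} (Γ : Ctx α) (f : α → ℕ) : Prop :=
  PolyBdd Γ.bound f ∧ ∀ d ≥ Γ.size, ∃ (p : Prog) (T : α → ℕ), PolyBdd Γ.bound T ∧
    ∀ a σ, Γ.rel a σ → Halts p σ
      (fun σ' => σ'.arr = σ.arr ∧ (∀ i < d, σ'.reg i = σ.reg i) ∧ σ'.reg d = f a) (T a)

namespace Cmp

variable {α : Type} {Γ : Ctx α} {f g b : α → ℕ}

lemma var (x : ℕ) (hf : PolyBdd Γ.bound f) (h : ∀ a σ, Γ.rel a σ → σ.reg x = f a) : Cmp Γ f := by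
  refine ⟨hf, fun d _ => ⟨.assign d (.reg x), fun _ => 1, .const _ _, fun a σ hσ => ?_⟩⟩
  refine Halts.assign ⟨rfl, fun i hi => ?_, ?_⟩
  · simp [Function.update_of_ne hi.ne]
  · simp [Expr.eval, h a σ hσ]

lemma const (c : ℕ) : Cmp Γ fun _ => c := by
  refine ⟨.const _ _, fun d _ => ⟨.assign d (.lit c), fun _ => 1, .const _ _, fun a σ hσ => ?_⟩⟩
  refine Halts.assign ⟨rfl, fun i hi => ?_, ?_⟩
  · simp [Function.update_of_ne hi.ne]
  · simp [Expr.eval]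

/-- Register `d` serves for the argument and the result. The expression may read arrays, so `hE`
also receives the context. -/
lemma map₁ (hf : Cmp Γ f) {v : α → ℕ} (hv : PolyBdd Γ.bound v) (E : ℕ → Expr)
    (hE : ∀ d a σ, Γ.rel a σ → σ.reg d = f a → (E d).eval σ = v a) : Cmp Γ v := by
  refine ⟨hv, fun d hd => ?_⟩
  obtain ⟨p, T, hT, hp⟩ := hf.2 d hd
  refine ⟨.seq p (.assign d (E d)), fun a => T a + 1, hT.add (.const _ _), fun a σ hσ => ?_⟩
  refine (hp a σ hσ).seq fun σ₁ ⟨ha, hr, hv₁⟩ => Halts.assign ⟨ha, fun i hi => ?_, ?_⟩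
  · simp [Function.update_of_ne hi.ne, hr i hi]
  · simpa using hE d a σ₁ (Γ.inv a σ σ₁ hσ (fun i hi => hr i (by omega)) ha) hv₁

/-- The second program works above `d`, so the first value survives in register `d`. -/
lemma map₂ (hf : Cmp Γ f) (hg : Cmp Γ g) {v : α → ℕ} (hv : PolyBdd Γ.bound v) (E : ℕ → Expr)
    (hE : ∀ d a σ, σ.reg d = f a → σ.reg (d + 1) = g a → (E d).eval σ = v a) : Cmp Γ v := by
  refine ⟨hv, fun d hd => ?_⟩
  obtain ⟨p, T, hT, hp⟩ := hf.2 d hd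
  obtain ⟨p', T', hT', hp'⟩ := hg.2 (d + 1) (by omega)
  refine ⟨.seq p (.seq p' (.assign d (E d))), fun a => T a + (T' a + 1),
    hT.add (hT'.add (.const _ _)), fun a σ hσ => ?_⟩
  refine (hp a σ hσ).seq fun σ₁ ⟨ha, hr, hv₁⟩ => ?_
  refine (hp' a σ₁ (Γ.inv a σ σ₁ hσ (fun i hi => hr i (by omega)) ha)).seq
    fun σ₂ ⟨ha', hr', hv₂⟩ => Halts.assign ⟨ha'.trans ha, fun i hi => ?_, ?_⟩
  · simp [Function.update_of_ne hi.ne, hr i hi, hr' i (by omega)]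
  · simpa using hE d a σ₂ ((hr' d (by omega)).trans hv₁) hv₂

lemma add (hf : Cmp Γ f) (hg : Cmp Γ g) : Cmp Γ fun a => f a + g a :=
  hf.map₂ hg (hf.1.add hg.1) (fun d => .add (.reg d) (.reg (d + 1)))
    fun d a σ h₁ h₂ => by simp [Expr.eval, h₁, h₂]

lemma sub (hf : Cmp Γ f) (hg : Cmp Γ g) : Cmp Γ fun a => f a - g a :=
  hf.map₂ hg (hf.1.mono fun a => Nat.sub_le _ _) (fun d => .sub (.reg d) (.reg (d + 1)))
    fun d a σ h₁ h₂ => by simp [Expr.eval, h₁, h₂]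

lemma read (A : ℕ) (hg : Cmp Γ g) (hf : PolyBdd Γ.bound f)
    (h : ∀ a σ, Γ.rel a σ → σ.arr A (g a) = f a) : Cmp Γ f :=
  hg.map₁ hf (fun d => .read A (.reg d)) fun d a σ hσ hd => by simp [Expr.eval, hd, h a σ hσ]

lemma weaken (hf : Cmp Γ f) (d : ℕ) (hd : Γ.size ≤ d) :
    Cmp (Γ.ext d hd) fun p => f p.1 := by
  have hB : PolyBdd (Γ.ext d hd).bound fun p => Γ.bound p.1 :=
    .of_le fun _ => Nat.le_add_right _ _
  refine ⟨hB.trans (hf.1.comp Prod.fst), fun d' hd' => ?_⟩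
  change d + 1 ≤ d' at hd'
  obtain ⟨p, T, hT, hp⟩ := hf.2 d' (by omega)
  exact ⟨p, fun a => T a.1, hB.trans (hT.comp Prod.fst), fun a σ hσ => hp a.1 σ hσ.1⟩

lemma last (d : ℕ) (hd : Γ.size ≤ d) : Cmp (Γ.ext d hd) Prod.snd :=
  var d (.of_le fun _ => Nat.le_add_left _ _) fun _ _ hσ => hσ.2

/-- Bounded recursion. -/
lemma natRec {init : α → ℕ} {step : α → ℕ → ℕ → ℕ} (hi : Cmp Γ init) (hb : Cmp Γ b)
    (hs : ∀ d hd d' hd', Cmp ((Γ.ext d hd).ext d' hd') fun p => step p.1.1 p.1.2 p.2)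
    {H : α → ℕ} (hH : PolyBdd Γ.bound H)
    (hle : ∀ a, ∀ i ≤ b a, Nat.rec (motive := fun _ => ℕ) (init a) (step a) i ≤ H a) :
    Cmp Γ fun a => Nat.rec (motive := fun _ => ℕ) (init a) (step a) (b a) := by
  refine ⟨hH.mono fun a => hle a _ le_rfl, fun d hd => ?_⟩
  obtain ⟨pi, Ti, hTi, hpi⟩ := hi.2 (d + 1) (by omega)
  obtain ⟨pb, Tb, hTb, hpb⟩ := hb.2 (d + 2) (by omega)
  obtain ⟨ps, Ts, hTs, hps⟩ := (hs d hd (d + 1) (le_refl (d + 1))).2 (d + 3)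
    (by change d + 1 + 1 ≤ d + 3; omega)
  -- The time of one round is measured with the counter and the current value as additional data.
  -- Both are bounded in terms of `a`, by `b` and `H`, and are eliminated in turn.
  obtain ⟨T₁, hT₁, hT₁le⟩ := PolyBdd.exists_le_of_le (B := fun p : α × ℕ => Γ.bound p.1 + p.2)
    (f := fun p => H p.1) hTs ((PolyBdd.of_le fun p => Nat.le_add_right _ _).trans
      (hH.comp Prod.fst))
  obtain ⟨T₂, hT₂, hT₂le⟩ := PolyBdd.exists_le_of_le hT₁ hb.1
  -- Register `d` holds the counter, `d + 1` the current value, `d + 2` the number of rounds and `d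
  -- + 3` the next value.
  refine ⟨.seq pi (.seq pb (.seq (.assign d (.lit 0)) (.seq
    (.loop (.sub (.reg (d + 2)) (.reg d)) (.seq ps (.seq (.assign (d + 1) (.reg (d + 3)))
      (.assign d (.add (.reg d) (.lit 1))))))
    (.assign d (.reg (d + 1)))))), fun a => Ti a + (Tb a + (1 + ((b a * (T₂ a + 2 + 1) + 1) + 1))),
    ?_, fun a σ hσ => ?_⟩
  · exact hTi.add (hTb.add ((PolyBdd.const _ _).add (((hb.1.mul ((hT₂.add (.const _ _)).add
      (.const _ _))).add (.const _ _)).add (.const _ _))))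
  set h : ℕ → ℕ := fun i => Nat.rec (motive := fun _ => ℕ) (init a) (step a) i with hh
  refine (hpi a σ hσ).seq fun σ₁ ⟨ha₁, hr₁, hv₁⟩ => ?_
  refine (hpb a σ₁ (Γ.inv a σ σ₁ hσ (fun i hi => hr₁ i (by omega)) ha₁)).seq
    fun σ₂ ⟨ha₂, hr₂, hv₂⟩ => ?_
  let Inv : ℕ → State → Prop := fun i τ => τ.arr = σ.arr ∧ (∀ x < d, τ.reg x = σ.reg x) ∧
    τ.reg d = i ∧ τ.reg (d + 1) = h i ∧ τ.reg (d + 2) = b a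
  refine Halts.seq (Q := Inv 0) (Halts.assign ⟨ha₂.trans ha₁, fun x hx => ?_, ?_, ?_, ?_⟩) ?_
  · simp [Function.update_of_ne hx.ne, hr₂ x (by omega), hr₁ x (by omega)]
  · simp [Expr.eval]
  · simp [hr₂ (d + 1) (by omega), hv₁, h]
  · simp [hv₂]
  intro σ₃ hσ₃
  refine Halts.seq (Q := Inv (b a)) (Halts.loop Inv (b a) (T₂ a + 2) ?_ ?_ hσ₃) ?_
  · rintro i hib τ ⟨ta, tr, td, tv, tb⟩
    refine ⟨by simp [Expr.eval, td, tb]; omega, ?_⟩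
    have hrel : ((Γ.ext d hd).ext (d + 1) (le_refl (d + 1))).rel ((a, i), h i) τ :=
      ⟨⟨Γ.inv a σ τ hσ (fun x hx => tr x (by omega)) ta, td⟩, tv⟩
    refine ((hps _ τ hrel).seq (Q := fun τ' => τ'.arr = τ.arr ∧ (∀ x < d + 3, τ'.reg x = τ.reg x) ∧
      τ'.reg (d + 3) = step a i (h i)) (R := Inv (i + 1)) (T₂ := 2) ?_).mono (fun _ h => h) ?_
    · rintro τ₁ ⟨ua, ur, uv⟩
      refine Halts.seq (T₁ := 1) (T₂ := 1) (Q := fun τ' => τ'.arr = σ.arr ∧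
        (∀ x < d, τ'.reg x = σ.reg x) ∧ τ'.reg d = i ∧ τ'.reg (d + 1) = h (i + 1) ∧
        τ'.reg (d + 2) = b a) (Halts.assign ⟨ua.trans ta, fun x hx => ?_, ?_, ?_, ?_⟩) ?_
      · rw [← tr x hx, ← ur x (by omega)]
        exact Function.update_of_ne (by omega) _ _
      · rw [← td, ← ur d (by omega)]
        exact Function.update_of_ne (by omega) _ _
      · simp [Expr.eval, uv, h]
      · rw [← tb, ← ur (d + 2) (by omega)]
        exact Function.update_of_ne (by omega) _ _
      · rintro τ₂ ⟨wa, wr, wd, wv, wb⟩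
        refine Halts.assign ⟨wa, fun x hx => ?_, ?_, ?_, ?_⟩
        · rw [← wr x hx]
          exact Function.update_of_ne (by omega) _ _
        · simp [Expr.eval, wd]
        · rw [← wv]
          exact Function.update_of_ne (by omega) _ _
        · rw [← wb]
          exact Function.update_of_ne (by omega) _ _
    · have h1 := hT₁le (a, i) (h i) (hle a i hib.le)
      have h2 := hT₂le a i hib.le
      omega
  · rintro τ ⟨ta, tr, td, tv, tb⟩
    simp [Expr.eval, td, tb]
  · rintro τ ⟨ta, tr, td, tv, tb⟩
    refine Halts.assign ⟨ta, fun x hx => ?_, ?_⟩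
    · rw [← tr x hx]
      exact Function.update_of_ne (by omega) _ _
    · simp [Expr.eval, tv, h]

lemma congr (hf : Cmp Γ f) (h : ∀ a, g a = f a) : Cmp Γ g := by
  rwa [show g = f from funext h]

lemma sum {g : α → ℕ → ℕ} (hb : Cmp Γ b) (hg : ∀ d hd, Cmp (Γ.ext d hd) fun p => g p.1 p.2) :
    Cmp Γ fun a => ∑ i ∈ Finset.range (b a), g a i := by
  have key : ∀ a i, Nat.rec (motive := fun _ => ℕ) 0 (fun i v => v + g a i) i =
      ∑ j ∈ Finset.range i, g a j := by
    intro a i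
    induction i with
    | zero => simp
    | succ i ih => rw [Finset.sum_range_succ, ← ih]
  obtain ⟨H, hH, hle⟩ := PolyBdd.exists_le_of_le (hg Γ.size le_rfl).1 hb.1
  refine (natRec (step := fun a i v => v + g a i) (const 0) hb
    (fun d hd d' hd' => (last _ _).add ((hg d hd).weaken d' hd')) (H := fun a => b a * H a)
    (hb.1.mul hH) fun a i hi => ?_).congr fun a => (key a _).symm
  rw [key]
  calc ∑ j ∈ Finset.range i, g a j ≤ ∑ j ∈ Finset.range i, H a :=
        Finset.sum_le_sum fun j hj => hle a j (by have := Finset.mem_range.1 hj; omega)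
    _ = i * H a := by simp
    _ ≤ b a * H a := Nat.mul_le_mul_right _ hi

lemma mul (hf : Cmp Γ f) (hg : Cmp Γ g) : Cmp Γ fun a => f a * g a :=
  (sum (g := fun a _ => g a) hf fun d hd => hg.weaken d hd).congr fun a => by simp

/-- Powers are not polynomially bounded in general, hence the separate hypothesis `h`. -/
lemma pow (hf : Cmp Γ f) (hg : Cmp Γ g) (h : PolyBdd Γ.bound fun a => f a ^ g a) :
    Cmp Γ fun a => f a ^ g a := by
  have key : ∀ a i, Nat.rec (motive := fun _ => ℕ) 1 (fun _ v => v * f a) i = f a ^ i := by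
    intro a i
    induction i with
    | zero => simp
    | succ i ih => rw [pow_succ, ← ih]
  refine (natRec (step := fun a _ v => v * f a) (const 1) hg
    (fun d hd d' hd' => (last _ _).mul ((hf.weaken d hd).weaken d' hd'))
    -- The summand `1` covers `f a = 0`, where `0 ^ 0` exceeds the later powers.
    (H := fun a => f a ^ g a + 1) (h.add (.const _ _)) fun a i hi => ?_).congr
    fun a => (key a _).symm
  rw [key]
  rcases Nat.eq_zero_or_pos (f a) with h0 | h0
  · rw [h0]
    exact le_trans (pow_le_one₀ le_rfl zero_le_one) (Nat.le_add_left _ _)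
  · exact (Nat.pow_le_pow_right h0 hi).trans (by omega)

lemma pow_const (hf : Cmp Γ f) (m : ℕ) : Cmp Γ fun a => f a ^ m :=
  hf.pow (const m) (hf.1.pow m)

end Cmp

/-! ### Decidable predicates and bounded quantifiers -/

open Classical in
/-- The predicate `P` is decidable in polynomial time in the context `Γ`. -/
def CmpP {α : Type} (Γ : Ctx α) (P : α → Prop) : Prop := Cmp Γ fun a => if P a then 1 else 0

namespace CmpP

variable {α : Type} {Γ : Ctx α} {P Q : α → Prop} {f g b : α → ℕ}

lemma congr (hP : CmpP Γ P) (h : ∀ a, Q a ↔ P a) : CmpP Γ Q := by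
  rwa [show Q = P from funext fun a => propext (h a)]

lemma weaken (hP : CmpP Γ P) (d : ℕ) (hd : Γ.size ≤ d) : CmpP (Γ.ext d hd) fun p => P p.1 :=
  Cmp.weaken hP d hd

lemma const (p : Prop) : CmpP Γ fun _ => p := by
  classical
  exact (Cmp.const (if p then 1 else 0)).congr fun a => by congr

lemma not (hP : CmpP Γ P) : CmpP Γ fun a => ¬ P a :=
  ((Cmp.const 1).sub hP).congr fun a => by by_cases h : P a <;> simp [h]

lemma and (hP : CmpP Γ P) (hQ : CmpP Γ Q) : CmpP Γ fun a => P a ∧ Q a :=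
  (Cmp.mul hP hQ).congr fun a => by by_cases h : P a <;> by_cases h' : Q a <;> simp [h, h']

lemma or (hP : CmpP Γ P) (hQ : CmpP Γ Q) : CmpP Γ fun a => P a ∨ Q a :=
  (hP.not.and hQ.not).not.congr fun a => by tauto

lemma imp (hP : CmpP Γ P) (hQ : CmpP Γ Q) : CmpP Γ fun a => P a → Q a :=
  (hP.not.or hQ).congr fun a => by tauto

lemma lt (hf : Cmp Γ f) (hg : Cmp Γ g) : CmpP Γ fun a => f a < g a :=
  -- Truncated subtraction gives the sign: `1 - (1 - x)` is `1` for `x > 0` and `0` otherwise.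
  ((Cmp.const 1).sub ((Cmp.const 1).sub (hg.sub hf))).congr fun a => by split_ifs <;> omega

lemma le (hf : Cmp Γ f) (hg : Cmp Γ g) : CmpP Γ fun a => f a ≤ g a :=
  (lt hg hf).not.congr fun a => by omega

lemma eq (hf : Cmp Γ f) (hg : Cmp Γ g) : CmpP Γ fun a => f a = g a :=
  ((le hf hg).and (le hg hf)).congr fun a => by omega

lemma ne (hf : Cmp Γ f) (hg : Cmp Γ g) : CmpP Γ fun a => f a ≠ g a := (eq hf hg).not

/-- The test of an array cell for zero is a bounded quantity, whatever the cell holds. -/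
lemma read_ne_zero (A : ℕ) {T : α → ℕ → ℕ} (hg : Cmp Γ g)
    (h : ∀ a σ, Γ.rel a σ → σ.arr A (g a) = T a (g a)) : CmpP Γ fun a => T a (g a) ≠ 0 := by
  refine Cmp.map₁ hg ((PolyBdd.const _ 1).mono fun a => by split_ifs <;> simp)
    (fun d => .sub (.lit 1) (.sub (.lit 1) (.read A (.reg d)))) fun d a σ hσ hd => ?_
  simp only [Expr.eval, hd, h a σ hσ]
  split_ifs <;> omega

lemma ball {P : α → ℕ → Prop} (hb : Cmp Γ b) (hP : ∀ d hd, CmpP (Γ.ext d hd) fun p => P p.1 p.2) :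
    CmpP Γ fun a => ∀ i < b a, P a i := by
  classical
  refine (eq (Cmp.sum (g := fun a i => if ¬ P a i then 1 else 0) hb
    fun d hd => Cmp.congr (hP d hd).not fun a => by congr) (Cmp.const 0)).congr fun a => ?_
  simp

lemma bex {P : α → ℕ → Prop} (hb : Cmp Γ b) (hP : ∀ d hd, CmpP (Γ.ext d hd) fun p => P p.1 p.2) :
    CmpP Γ fun a => ∃ i < b a, P a i :=
  (ball (P := fun a i => ¬ P a i) hb fun d hd => (hP d hd).not).not.congr fun a => by
    push Not; rfl

end CmpP

namespace Cmp

variable {α : Type} {Γ : Ctx α} {f g b : α → ℕ}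

lemma ite {P : α → Prop} [∀ a, Decidable (P a)] (hP : CmpP Γ P) (hf : Cmp Γ f) (hg : Cmp Γ g) :
    Cmp Γ fun a => if P a then f a else g a :=
  ((Cmp.mul hP hf).add (Cmp.mul hP.not hg)).congr fun a => by by_cases h : P a <;> simp [h]

end Cmp

/-! ### Bounded search, quotients and remainders -/

open Classical in
/-- The least `i < b` with `P i`, or `b` if there is none. -/
noncomputable def first (b : ℕ) (P : ℕ → Prop) : ℕ :=
  Nat.rec (motive := fun _ => ℕ) 0 (fun i v => if v = i ∧ ¬ P i then v + 1 else v) b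

lemma first_spec (b : ℕ) (P : ℕ → Prop) :
    first b P ≤ b ∧ (∀ i < first b P, ¬ P i) ∧ (first b P < b → P (first b P)) := by
  classical
  induction b with
  | zero => simp [first]
  | succ b ih =>
    obtain ⟨h₁, h₂, h₃⟩ := ih
    -- The stored value equals the counter exactly while all earlier tests have failed; afterwards
    -- it lags behind and stays.
    have hstep : first (b + 1) P =
      if first b P = b ∧ ¬ P b then first b P + 1 else first b P := by
      unfold first
      congr
    by_cases h : first b P = b ∧ ¬ P b
    · rw [hstep, if_pos h, h.1]
      refine ⟨le_rfl, fun i hi => ?_, fun hi => by omega⟩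
      rcases Nat.lt_succ_iff_lt_or_eq.1 hi with h' | rfl
      · exact h₂ i (by omega)
      · exact h.2
    · rw [hstep, if_neg h]
      refine ⟨by omega, h₂, fun _ => ?_⟩
      rcases h₁.lt_or_eq with h' | h'
      · exact h₃ h'
      · rw [h']
        by_contra hP
        exact h ⟨h', hP⟩

namespace Cmp

variable {α : Type} {Γ : Ctx α} {f g b : α → ℕ}

lemma first {P : α → ℕ → Prop} (hb : Cmp Γ b) (hP : ∀ d hd, CmpP (Γ.ext d hd) fun p => P p.1 p.2) :
    Cmp Γ fun a => first (b a) (P a) := by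
  classical
  refine natRec (step := fun a i v => if v = i ∧ ¬ P a i then v + 1 else v) (const 0) hb
    (fun d hd d' hd' => ?_) hb.1 fun a i hi => ?_
  · exact ite ((CmpP.eq (last _ _) ((last d hd).weaken d' hd')).and
      ((hP d hd).weaken d' hd').not) ((last _ _).add (const 1)) (last _ _)
  · refine le_trans ?_ ((first_spec i (P a)).1.trans hi)
    exact le_of_eq (by simp only [RAM.first])

lemma div (hf : Cmp Γ f) (hg : Cmp Γ g) : Cmp Γ fun a => f a / g a := by
  refine (ite (CmpP.eq hg (const 0)) (const 0) (first (b := fun a => f a + 1)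
    (P := fun a i => f a < (i + 1) * g a) (hf.add (const 1)) fun d hd =>
    CmpP.lt (hf.weaken d hd) (((last d hd).add (const 1)).mul (hg.weaken d hd)))).congr fun a => ?_
  split_ifs with h
  · simp [h]
  · obtain ⟨h₁, h₂, h₃⟩ := first_spec (f a + 1) fun i => f a < (i + 1) * g a
    set x := RAM.first (f a + 1) fun i => f a < (i + 1) * g a
    have hpos : 0 < g a := Nat.pos_of_ne_zero h
    refine (Nat.div_eq_of_lt_le ?_ ?_)
    · rcases Nat.eq_zero_or_pos x with h0 | h0
      · simp [h0]
      · have := h₂ (x - 1) (by omega)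
        rwa [Nat.sub_add_cancel h0, not_lt] at this
    · rcases h₁.lt_or_eq with h' | h'
      · exact h₃ h'
      · rw [h']
        calc f a < f a + 1 + 1 := by omega
          _ ≤ (f a + 1 + 1) * g a := Nat.le_mul_of_pos_right _ hpos

lemma mod (hf : Cmp Γ f) (hg : Cmp Γ g) : Cmp Γ fun a => f a % g a :=
  (hf.sub (hg.mul (hf.div hg))).congr fun _ => Nat.mod_eq_sub_mul_div

end Cmp

end RAM

/-! ### Unique Label Cover instances made of paths that have to be cut -/

/-- Swap the two copies `2 * a` and `2 * a + 1` of a label `a`. -/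
def flipBit (b : ℕ) : ℕ := if b % 2 = 0 then b + 1 else b - 1

lemma flipBit_div (b : ℕ) : flipBit b / 2 = b / 2 := by
  unfold flipBit; split_ifs <;> omega

lemma flipBit_flipBit (b : ℕ) : flipBit (flipBit b) = b := by
  unfold flipBit; split_ifs <;> omega

lemma flipBit_ne (b : ℕ) : flipBit b ≠ b := by
  unfold flipBit; split_ifs <;> omega

lemma flipBit_lt {b L : ℕ} (h : b < 2 * L) : flipBit b < 2 * L := by
  unfold flipBit; split_ifs <;> omega

/-- A system of `M` paths with `W` positions each. The position `i` of the path `e` admits the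
labels `a < L` with `Al e i a`. Paths with equal `lv` are joined at their left ends and paths with
equal `rv` at their right ends. -/
structure PathSystem where
  M : ℕ
  W : ℕ
  L : ℕ
  lv : ℕ → ℕ
  rv : ℕ → ℕ
  Al : ℕ → ℕ → ℕ → Prop

namespace PathSystem

variable (P : PathSystem)

/-- Adjacency of positions; the position `i` of the path `e` has the number `e * W + i`. -/
def link (x y : ℕ) : Prop :=
  (x / P.W = y / P.W ∧ (x + 1 = y ∨ y + 1 = x)) ∨
  (x ≠ y ∧ x % P.W = 0 ∧ y % P.W = 0 ∧ P.lv (x / P.W) = P.lv (y / P.W)) ∨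
  (x ≠ y ∧ x % P.W + 1 = P.W ∧ y % P.W + 1 = P.W ∧ P.rv (x / P.W) = P.rv (y / P.W))

/-- Each position `x` carries a triangle with the vertices `3 * x`, `3 * x + 1`, `3 * x + 2`, whose
first vertex is joined to the adjacent positions. -/
def adj (u v : ℕ) : Prop :=
  (u / 3 = v / 3 ∧ u ≠ v) ∨ (u % 3 = 0 ∧ v % 3 = 0 ∧ P.link (u / 3) (v / 3))

/-- The edge between `3 * x` and `3 * x + 2` flips the copy of the labels that `x` forbids. -/
def flips (u v b : ℕ) : Prop :=
  u / 3 = v / 3 ∧ u % 3 + v % 3 = 2 ∧ ¬ P.Al (u / 3 / P.W) (u / 3 % P.W) (b / 2)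

open Classical in
/-- The permutation of the labels on the edge `uv`. -/
noncomputable def next (u v b : ℕ) : ℕ := if P.flips u v b then flipBit b else b

lemma link_symm {x y : ℕ} (h : P.link x y) : P.link y x := by
  unfold link at *
  rcases h with ⟨h, h'⟩ | ⟨h, h1, h2, h3⟩ | ⟨h, h1, h2, h3⟩
  · exact .inl ⟨h.symm, h'.symm⟩
  · exact .inr (.inl ⟨h.symm, h2, h1, h3.symm⟩)
  · exact .inr (.inr ⟨h.symm, h2, h1, h3.symm⟩)

lemma adj_symm {u v : ℕ} (h : P.adj u v) : P.adj v u := by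
  rcases h with ⟨h, h'⟩ | ⟨h, h', h''⟩
  · exact .inl ⟨h.symm, h'.symm⟩
  · exact .inr ⟨h', h, P.link_symm h''⟩

lemma not_adj_self (u : ℕ) : ¬ P.adj u u := by
  rintro (⟨-, h⟩ | ⟨-, -, h | h | h⟩)
  · exact h rfl
  · omega
  · exact h.1 rfl
  · exact h.1 rfl

lemma next_lt {u v b : ℕ} (h : b < 2 * P.L) : P.next u v b < 2 * P.L := by
  unfold next; split_ifs
  · exact flipBit_lt h
  · exact h

lemma next_div (u v b : ℕ) : P.next u v b / 2 = b / 2 := by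
  unfold next; split_ifs
  · exact flipBit_div b
  · rfl

lemma flips_comm (u v b : ℕ) : P.flips u v b ↔ P.flips v u b := by
  unfold flips
  constructor <;> rintro ⟨h, h', h''⟩ <;> refine ⟨h.symm, by omega, ?_⟩
  · rwa [← h]
  · rwa [← h]

/-- Whether an edge flips depends symmetrically on its ends and otherwise only on `b / 2`, which a
flip preserves. So both directions flip together and cancel. -/
lemma next_next (u v b : ℕ) : P.next v u (P.next u v b) = b := by
  have h : P.flips v u (P.next u v b) ↔ P.flips u v b := by
    rw [P.flips_comm]; unfold flips; rw [next_div]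
  by_cases hf : P.flips u v b
  · rw [next, if_pos (h.2 hf), next, if_pos hf, flipBit_flipBit]
  · rw [next, if_neg (mt h.1 hf), next, if_neg hf]

/-- The instance of Unique Label Cover. -/
noncomputable def ulc : ULC where
  n := P.M * P.W * 3
  s := 2 * P.L
  G :=
    { Adj u v := P.adj u v
      symm := ⟨fun _ _ h => P.adj_symm h⟩
      loopless := ⟨fun u => P.not_adj_self u⟩ }
  φ _ := Set.univ
  ψ u v := {q | P.next u v q.1 = q.2}
  partialPerm u v _ := by
    refine ⟨fun a b b' h h' => Fin.ext (h.symm.trans h'), fun a a' b h h' => Fin.ext ?_⟩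
    rw [← P.next_next u v a, ← P.next_next u v a']
    exact congrArg _ (h.trans h'.symm)
  reverse u v _ a b := by
    constructor
    · intro h
      change P.next v u b = a
      rw [← h]
      exact P.next_next u v a
    · intro h
      change P.next u v a = b
      rw [← h]
      exact P.next_next v u b

lemma ulc_full : P.ulc.Full := by
  refine ⟨fun v => rfl, fun u v _ => ?_⟩
  let f (w w' : Fin P.ulc.n) (b : Fin P.ulc.s) : Fin P.ulc.s := ⟨P.next w w' b, P.next_lt b.2⟩
  refine ⟨⟨f u v, f v u, fun b => Fin.ext (P.next_next u v b),
    fun b => Fin.ext (P.next_next v u b)⟩, ?_⟩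
  ext q
  change P.next u v q.1 = q.2 ↔ f u v q.1 = q.2
  exact (Fin.ext_iff (a := f u v q.1) (b := q.2)).symm

variable {P}

/-- If the left part of each path can be labeled by the label of its left end and the right part by
the label of its right end, then cutting one edge of each path suffices. -/
lemma ulc_edgeSolvable (y z cut : ℕ → ℕ) (hy : ∀ e < P.M, y (P.lv e) < P.L)
    (hz : ∀ e < P.M, z (P.rv e) < P.L) (hcut : ∀ e < P.M, cut e + 1 < P.W)
    (hAly : ∀ e < P.M, ∀ i ≤ cut e, P.Al e i (y (P.lv e)))
    (hAlz : ∀ e < P.M, ∀ i < P.W, cut e < i → P.Al e i (z (P.rv e))) :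
    P.ulc.EdgeSolvable P.M := by
  classical
  rcases Nat.eq_zero_or_pos P.W with hW | hW
  · have hn : P.ulc.n = 0 := by simp [ulc, hW]
    have : IsEmpty (Fin P.ulc.n) := by rw [hn]; infer_instance
    exact ⟨∅, isEmptyElim, by simp, by simp, isEmptyElim, isEmptyElim⟩
  have hlt : ∀ {v}, v < P.M * P.W * 3 → v / 3 / P.W < P.M := fun {v} hv => by
    rw [Nat.div_lt_iff_lt_mul hW]
    omega
  have hvtx : ∀ {e i}, e < P.M → i < P.W → (e * P.W + i) * 3 < P.M * P.W * 3 := by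
    intro e i he hi
    have : (e + 1) * P.W ≤ P.M * P.W := Nat.mul_le_mul_right _ he
    rw [add_mul] at this
    omega
  have hdiv : ∀ {e i}, i < P.W → (e * P.W + i) / P.W = e := fun {e i} hi => by
    rw [add_comm, Nat.add_mul_div_right _ _ hW, Nat.div_eq_of_lt hi, zero_add]
  -- All vertices of a position get the label of the left end up to the cut and that of the right
  -- end behind it.
  let lab₀ (v : ℕ) : ℕ := if v / 3 % P.W ≤ cut (v / 3 / P.W) then y (P.lv (v / 3 / P.W)) else
    z (P.rv (v / 3 / P.W))
  have hAl : ∀ v < P.M * P.W * 3, P.Al (v / 3 / P.W) (v / 3 % P.W) (lab₀ v) := by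
    intro v hv
    by_cases h : v / 3 % P.W ≤ cut (v / 3 / P.W)
    · simp only [lab₀, if_pos h]
      exact hAly _ (hlt hv) _ h
    · simp only [lab₀, if_neg h]
      exact hAlz _ (hlt hv) _ (Nat.mod_lt _ hW) (not_le.1 h)
  have hlab : ∀ v < P.M * P.W * 3, 2 * lab₀ v < 2 * P.L := by
    intro v hv
    simp only [lab₀]
    split_ifs
    · have := hy _ (hlt hv); omega
    · have := hz _ (hlt hv); omega
  let edge (e : Fin P.M) : Sym2 (Fin P.ulc.n) :=
    s(⟨(e * P.W + cut e) * 3, hvtx e.2 (by have := hcut e e.2; omega)⟩,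
      ⟨(e * P.W + (cut e + 1)) * 3, hvtx e.2 (hcut e e.2)⟩)
  -- Even copies everywhere: no edge flips them, since each position admits its label.
  refine ⟨Finset.univ.image edge, fun v => ⟨2 * lab₀ v, hlab v v.2⟩, ?_, ?_, fun v => trivial, ?_⟩
  · intro x hx
    obtain ⟨e, -, rfl⟩ := Finset.mem_image.1 (Finset.mem_coe.1 hx)
    change P.adj _ _
    have h1 := hdiv (e := e) (hcut e e.2)
    have h2 := hdiv (e := e) (i := cut e) (by have := hcut e e.2; omega)
    refine .inr ⟨by simp, by simp, .inl ⟨?_, .inl ?_⟩⟩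
    · simp [h1, h2]
    · simp [add_assoc]
  · exact Finset.card_image_le.trans (by simp)
  · intro u v huv huF
    change P.next u v (2 * lab₀ u) = 2 * lab₀ v
    have hnf : ¬ P.flips u v (2 * lab₀ u) := by
      rintro ⟨-, -, h⟩
      apply h
      rw [Nat.mul_div_cancel_left _ two_pos]
      exact hAl u u.2
    rw [next, if_neg hnf]
    -- Along a path `lab₀` changes only between `cut e` and `cut e + 1`, and that edge is deleted.
    have key : ∀ u v : Fin P.ulc.n, (u : ℕ) % 3 = 0 → (v : ℕ) % 3 = 0 →
        (u : ℕ) / 3 / P.W = v / 3 / P.W → (u : ℕ) / 3 + 1 = v / 3 →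
        s(u, v) ∉ Finset.univ.image edge → lab₀ u = lab₀ v := by
      intro u v hu hv h1 h2 hF
      have hmod : (u : ℕ) / 3 % P.W + 1 = v / 3 % P.W := by
        have h3 := Nat.div_add_mod ((u : ℕ) / 3) P.W
        have h4 := Nat.div_add_mod ((v : ℕ) / 3) P.W
        rw [h1] at h3
        omega
      have hne : (u : ℕ) / 3 % P.W ≠ cut (u / 3 / P.W) := by
        intro h
        refine hF (Finset.mem_image.2 ⟨⟨u / 3 / P.W, hlt u.2⟩, Finset.mem_univ _, ?_⟩)
        have h3 := Nat.div_add_mod' ((u : ℕ) / 3) P.W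
        have h4 := Nat.div_add_mod' ((v : ℕ) / 3) P.W
        have e1 : (⟨((u : ℕ) / 3 / P.W * P.W + cut (u / 3 / P.W)) * 3, by
            rw [← h, h3]; have := u.2; change _ < P.ulc.n; omega⟩ : Fin P.ulc.n) = u := by
          apply Fin.ext
          simp only
          rw [← h, h3]
          omega
        have e2 : (⟨((u : ℕ) / 3 / P.W * P.W + (cut (u / 3 / P.W) + 1)) * 3, by
            rw [← h, hmod, h1, h4]; have := v.2; change _ < P.ulc.n; omega⟩ : Fin P.ulc.n) = v := by
          apply Fin.ext
          simp only
          rw [← h, hmod, h1, h4]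
          omega
        simp only [edge]
        rw [e1, e2]
      simp only [lab₀]
      rw [← hmod, ← h1]
      congr 1
      rw [eq_iff_iff]
      omega
    rcases huv with ⟨h, -⟩ | ⟨hu, hv, ⟨h, h' | h'⟩ | ⟨-, h1, h2, h3⟩ | ⟨-, h1, h2, h3⟩⟩
    · simp only [lab₀, h]
    · rw [key u v hu hv h h' huF]
    · rw [key v u hv hu h.symm h' (by rwa [Sym2.eq_swap])]
    · simp only [lab₀, h1, h2, Nat.zero_le, if_true, h3]
    · have n1 : ¬ (u : ℕ) / 3 % P.W ≤ cut (u / 3 / P.W) := by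
        have := hcut _ (hlt u.2); omega
      have n2 : ¬ (v : ℕ) / 3 % P.W ≤ cut (v / 3 / P.W) := by
        have := hcut _ (hlt v.2); omega
      simp only [lab₀, if_neg n1, if_neg n2, h3]

end PathSystem

/-- Instead of an edge, one of its ends can be deleted. -/
lemma ULC.EdgeSolvable.nodeSolvable {I : ULC} {k : ℕ} (h : I.EdgeSolvable k) :
    I.NodeSolvable k := by
  classical
  obtain ⟨F, lab, -, hF, hφ, hψ⟩ := h
  refine ⟨F.image fun e => (Quot.out e).1, fun v => lab v, Finset.card_image_le.trans hF,
    fun v => hφ v, fun u v huv => hψ u v huv fun hmem => ?_⟩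
  have hout : s((Quot.out s(u.1, v.1)).1, (Quot.out s(u.1, v.1)).2) = s(u.1, v.1) :=
    Quot.out_eq _
  rcases Sym2.eq_iff.1 hout with h | h
  · exact u.2 (Finset.mem_image.2 ⟨_, hmem, h.1⟩)
  · exact v.2 (Finset.mem_image.2 ⟨_, hmem, h.1⟩)

/-! ### Path systems under vertex deletions -/

namespace PathSystem

variable {P : PathSystem}

/-- Solutions with vertex deletions: if the labels below `D` are not admitted at the last two
positions of a path and the others not at the first two, then each path is cut exactly once. -/
lemma exists_of_ulc_nodeSolvable {D : ℕ} (hW : 4 ≤ P.W)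
    (hleft : ∀ e i a, P.Al e i a → a < D → i + 3 ≤ P.W)
    (hright : ∀ e i a, P.Al e i a → D ≤ a → 2 ≤ i) (h : P.ulc.NodeSolvable P.M) :
    ∃ y z : ℕ → ℕ, ∀ e < P.M, y (P.lv e) < D ∧ P.Al e 0 (y (P.lv e)) ∧ D ≤ z (P.rv e) ∧
      z (P.rv e) < P.L ∧ ∃ p, 1 ≤ p ∧ p + 1 < P.W ∧ P.Al e (p - 1) (y (P.lv e)) ∧
        P.Al e (p + 1) (z (P.rv e)) := by
  classical
  obtain ⟨X₀, lab₀, hcard, -, hψ⟩ := h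
  have hW0 : 0 < P.W := by omega
  let X (v : ℕ) : Prop := ∃ h : v < P.M * P.W * 3, (⟨v, h⟩ : Fin P.ulc.n) ∈ X₀
  let lab (v : ℕ) : ℕ := if h : ∃ h : v < P.M * P.W * 3, (⟨v, h⟩ : Fin P.ulc.n) ∉ X₀ then
    lab₀ ⟨⟨v, h.1⟩, h.2⟩ else 0
  have hlab_lt : ∀ v, v < P.M * P.W * 3 → ¬ X v → lab v < 2 * P.L := by
    intro v hv hX
    have h : ∃ h : v < P.M * P.W * 3, (⟨v, h⟩ : Fin P.ulc.n) ∉ X₀ := ⟨hv, fun h => hX ⟨hv, h⟩⟩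
    simp only [lab, dif_pos h]
    exact (lab₀ _).2
  have hnext : ∀ u v, u < P.M * P.W * 3 → v < P.M * P.W * 3 → ¬ X u → ¬ X v → P.adj u v →
      P.next u v (lab u) = lab v := by
    intro u v hu hv hXu hXv huv
    have h1 : ∃ h : u < P.M * P.W * 3, (⟨u, h⟩ : Fin P.ulc.n) ∉ X₀ := ⟨hu, fun h => hXu ⟨hu, h⟩⟩
    have h2 : ∃ h : v < P.M * P.W * 3, (⟨v, h⟩ : Fin P.ulc.n) ∉ X₀ := ⟨hv, fun h => hXv ⟨hv, h⟩⟩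
    simp only [lab, dif_pos h1, dif_pos h2]
    exact hψ ⟨⟨u, hu⟩, h1.2⟩ ⟨⟨v, hv⟩, h2.2⟩ huv
  have hpos : ∀ {e i}, e < P.M → i < P.W → e * P.W + i < P.M * P.W := by
    intro e i he hi
    have : (e + 1) * P.W ≤ P.M * P.W := Nat.mul_le_mul_right _ he
    rw [add_mul] at this
    omega
  have hdiv : ∀ {e i}, i < P.W → (e * P.W + i) / P.W = e := fun {e i} hi => by
    rw [add_comm, Nat.add_mul_div_right _ _ hW0, Nat.div_eq_of_lt hi, zero_add]
  have hmod : ∀ {e i}, i < P.W → (e * P.W + i) % P.W = i := fun {e i} hi => by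
    rw [add_comm, Nat.add_mul_mod_self_right, Nat.mod_eq_of_lt hi]
  -- a position with an intact triangle admits its label
  have hgadget : ∀ x < P.M * P.W, ¬ X (3 * x) → ¬ X (3 * x + 1) → ¬ X (3 * x + 2) →
      P.Al (x / P.W) (x % P.W) (lab (3 * x) / 2) := by
    intro x hx h0 h1 h2
    have e01 := hnext (3 * x) (3 * x + 1) (by omega) (by omega) h0 h1 (.inl ⟨by omega, by omega⟩)
    have e12 := hnext (3 * x + 1) (3 * x + 2) (by omega) (by omega) h1 h2
      (.inl ⟨by omega, by omega⟩)
    have e02 := hnext (3 * x) (3 * x + 2) (by omega) (by omega) h0 h2 (.inl ⟨by omega, by omega⟩)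
    rw [next, if_neg (by rintro ⟨-, h, -⟩; omega)] at e01 e12
    by_contra hAl
    rw [next, if_pos ⟨by omega, by omega, by rwa [Nat.mul_div_cancel_left _ three_pos]⟩, ← e12,
      ← e01] at e02
    exact flipBit_ne _ e02
  -- labels are constant along intact parts of a path
  have hconst : ∀ e < P.M, ∀ i m, i + m < P.W →
      (∀ j, i ≤ j → j ≤ i + m → ¬ X (3 * (e * P.W + j))) →
      lab (3 * (e * P.W + (i + m))) = lab (3 * (e * P.W + i)) := by
    intro e he i m
    induction m with
    | zero => intros; rfl
    | succ m ih =>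
      intro hlt hX
      rw [← ih (by omega) fun j h1 h2 => hX j h1 (by omega)]
      have hp1 := hpos he (i := i + m) (by omega)
      have hp2 := hpos he (i := i + (m + 1)) (by omega)
      have hd1 := hdiv (e := e) (i := i + m) (by omega)
      have hd2 := hdiv (e := e) (i := i + (m + 1)) (by omega)
      have := hnext (3 * (e * P.W + (i + m))) (3 * (e * P.W + (i + (m + 1)))) (by omega) (by omega)
        (hX _ (by omega) (by omega)) (hX _ (by omega) le_rfl) (.inr ⟨by omega, by omega, .inl ?_⟩)
      · rw [← this, next, if_neg]
        rintro ⟨h, -⟩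
        omega
      · rw [Nat.mul_div_cancel_left _ three_pos, Nat.mul_div_cancel_left _ three_pos, hd1, hd2]
        exact ⟨rfl, .inl (by omega)⟩
  -- the deleted vertices of a path
  let Xe (e : ℕ) : Finset (Fin P.ulc.n) := X₀.filter fun v => (v : ℕ) / 3 / P.W = e
  have hXe : ∀ {e i τ}, i < P.W → τ < 3 → X (3 * (e * P.W + i) + τ) →
      ∃ h, (⟨3 * (e * P.W + i) + τ, h⟩ : Fin P.ulc.n) ∈ Xe e := by
    rintro e i τ hi hτ ⟨h, hX⟩
    refine ⟨h, Finset.mem_filter.2 ⟨hX, ?_⟩⟩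
    rw [show (3 * (e * P.W + i) + τ) / 3 = e * P.W + i by omega]
    exact hdiv hi
  have huniq : ∀ {e i j τ τ'}, (Xe e).card ≤ 1 → i < P.W → j < P.W → τ < 3 → τ' < 3 →
      X (3 * (e * P.W + i) + τ) → X (3 * (e * P.W + j) + τ') → i = j ∧ τ = τ' := by
    intro e i j τ τ' hc hi hj hτ hτ' h1 h2
    obtain ⟨l1, m1⟩ := hXe hi hτ h1
    obtain ⟨l2, m2⟩ := hXe hj hτ' h2
    have := Fin.ext_iff.1 (Finset.card_le_one.1 hc _ m1 _ m2)
    simp only at this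
    omega
  have hAlat : ∀ {e i}, e < P.M → i < P.W → ¬ X (3 * (e * P.W + i)) →
      ¬ X (3 * (e * P.W + i) + 1) → ¬ X (3 * (e * P.W + i) + 2) →
      P.Al e i (lab (3 * (e * P.W + i)) / 2) := by
    intro e i he hi h0 h1 h2
    have := hgadget _ (hpos he hi) h0 h1 h2
    rwa [hdiv hi, hmod hi] at this
  -- If no first vertex of a position is deleted, one label runs along the whole path, and a single
  -- deletion spoils the triangle of only one position. One of the two outermost positions at each
  -- end is still checked, but no label is admitted at both ends.
  have hexists : ∀ e < P.M, (Xe e).card ≤ 1 → ∃ p < P.W, X (3 * (e * P.W + p)) := by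
    intro e he hc
    by_contra! hno
    have hcon : ∀ i < P.W, lab (3 * (e * P.W + i)) = lab (3 * (e * P.W + 0)) := fun i hi => by
      simpa using hconst e he 0 i (by omega) fun j _ hj => hno j (by omega)
    have hintact : ∀ i j, i ≠ j → i < P.W → j < P.W →
        P.Al e i (lab (3 * (e * P.W + 0)) / 2) ∨ P.Al e j (lab (3 * (e * P.W + 0)) / 2) := by
      intro i j hij hi hj
      by_contra! hcontra
      obtain ⟨c1, c2⟩ := hcontra
      have b : ∀ i, i < P.W → ¬ P.Al e i (lab (3 * (e * P.W + 0)) / 2) →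
          ∃ τ < 3, X (3 * (e * P.W + i) + τ) := by
        intro i hi hna
        by_contra! hn
        exact hna (hcon i hi ▸ hAlat he hi (hno i hi) (hn 1 (by omega)) (hn 2 (by omega)))
      obtain ⟨τ, hτ, h1⟩ := b i hi c1
      obtain ⟨τ', hτ', h2⟩ := b j hj c2
      exact hij (huniq hc hi hj hτ hτ' h1 h2).1
    have hlt : lab (3 * (e * P.W + 0)) / 2 < D := by
      by_contra! hge
      rcases hintact 0 1 (by omega) (by omega) (by omega) with h | h <;>
        have := hright _ _ _ h hge <;> omega
    rcases hintact (P.W - 1) (P.W - 2) (by omega) (by omega) (by omega) with h | h <;>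
      have := hleft _ _ _ h hlt <;> omega
  have hge : ∀ e < P.M, 1 ≤ (Xe e).card := by
    intro e he
    by_contra! hlt
    obtain ⟨p, hp, hX⟩ := hexists e he (by omega)
    obtain ⟨_, hm⟩ := hXe (τ := 0) hp (by omega) hX
    exact absurd hm (by rw [Finset.card_eq_zero.1 (by omega : (Xe e).card = 0)]; simp)
  -- Each of the `M` paths costs at least one deletion, so with the budget `M` none costs more.
  have hle : ∀ e < P.M, (Xe e).card ≤ 1 := by
    intro e he
    by_contra! hgt
    have hsum : X₀.card = ∑ e ∈ Finset.range P.M, (Xe e).card := by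
      refine Finset.card_eq_sum_card_fiberwise fun v _ => ?_
      rw [Finset.coe_range, Set.mem_Iio, Nat.div_lt_iff_lt_mul hW0]
      have : (v : ℕ) < P.M * P.W * 3 := v.2
      omega
    have : ∑ e ∈ Finset.range P.M, 1 < ∑ e ∈ Finset.range P.M, (Xe e).card :=
      Finset.sum_lt_sum (fun e he => hge e (Finset.mem_range.1 he)) ⟨e, Finset.mem_range.2 he, hgt⟩
    simp only [Finset.sum_const, Finset.card_range, smul_eq_mul, mul_one] at this
    omega
  have hcut : ∀ e < P.M, ∃ p, 1 ≤ p ∧ p + 1 < P.W ∧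
      ∀ i < P.W, ∀ τ < 3, i ≠ p ∨ τ ≠ 0 → ¬ X (3 * (e * P.W + i) + τ) := by
    intro e he
    obtain ⟨p, hp, hX⟩ := hexists e he (hle e he)
    have hothers : ∀ i < P.W, ∀ τ < 3, i ≠ p ∨ τ ≠ 0 → ¬ X (3 * (e * P.W + i) + τ) := by
      intro i hi τ hτ hne hX'
      have := huniq (τ' := 0) (hle e he) hi hp hτ (by omega) hX' hX
      omega
    have hAl : ∀ i < P.W, i ≠ p → P.Al e i (lab (3 * (e * P.W + i)) / 2) := fun i hi hne =>
      hAlat he hi (hothers i hi 0 (by omega) (.inl hne)) (hothers i hi 1 (by omega) (.inl hne))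
        (hothers i hi 2 (by omega) (.inl hne))
    refine ⟨p, ?_, ?_, hothers⟩
    -- Were position `0` cut, one label would run through the intact positions `1, …, W - 1` and be
    -- admitted at both ends of this stretch. This is why two positions are reserved at each end.
    · by_contra! h0
      have hc := hconst e he 1 (P.W - 1 - 1) (by omega)
        fun j h1 h2 => hothers j (by omega) 0 (by omega) (.inl (by omega))
      rw [show 1 + (P.W - 1 - 1) = P.W - 1 by omega] at hc
      have a1 := hAl 1 (by omega) (by omega)
      have a2 := hAl (P.W - 1) (by omega) (by omega)
      rw [hc] at a2
      rcases lt_or_ge (lab (3 * (e * P.W + 1)) / 2) D with h | h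
      · have := hleft _ _ _ a2 h; omega
      · have := hright _ _ _ a1 h; omega
    · by_contra! h0
      have hc := hconst e he 0 (P.W - 2) (by omega)
        fun j h1 h2 => hothers j (by omega) 0 (by omega) (.inl (by omega))
      rw [zero_add] at hc
      have a1 := hAl 0 (by omega) (by omega)
      have a2 := hAl (P.W - 2) (by omega) (by omega)
      rw [hc] at a2
      rcases lt_or_ge (lab (3 * (e * P.W + 0)) / 2) D with h | h
      · have := hleft _ _ _ a2 h; omega
      · have := hright _ _ _ a1 h; omega
  choose! p hp1 hp2 hothers using hcut
  have hAl : ∀ e < P.M, ∀ i < P.W, i ≠ p e → P.Al e i (lab (3 * (e * P.W + i)) / 2) :=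
    fun e he i hi hne => hAlat he hi (hothers e he i hi 0 (by omega) (.inl hne))
      (hothers e he i hi 1 (by omega) (.inl hne)) (hothers e he i hi 2 (by omega) (.inl hne))
  have hend : ∀ e e' i, e < P.M → e' < P.M → i < P.W → i ≠ p e → i ≠ p e' → e ≠ e' →
      P.link (e * P.W + i) (e' * P.W + i) →
      lab (3 * (e * P.W + i)) = lab (3 * (e' * P.W + i)) := by
    intro e e' i he he' hi hne hne' hee hlink
    have l1 := hpos he hi
    have l2 := hpos he' hi
    rw [← hnext (3 * (e * P.W + i)) (3 * (e' * P.W + i)) (by omega) (by omega)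
      (hothers e he i hi 0 (by omega) (.inl hne)) (hothers e' he' i hi 0 (by omega) (.inl hne'))
      (.inr ⟨by omega, by omega, by
        rwa [Nat.mul_div_cancel_left _ three_pos, Nat.mul_div_cancel_left _ three_pos]⟩),
      next, if_neg]
    rintro ⟨-, h, -⟩
    omega
  have hneq : ∀ {e e' i}, i < P.W → e ≠ e' → e * P.W + i ≠ e' * P.W + i := by
    intro e e' i hi hee h
    exact hee (by rw [← hdiv (e := e) hi, h, hdiv hi])
  have hy : ∀ e e', e < P.M → e' < P.M → P.lv e = P.lv e' →
      lab (3 * (e * P.W + 0)) = lab (3 * (e' * P.W + 0)) := by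
    intro e e' he he' hlv
    rcases eq_or_ne e e' with rfl | hee
    · rfl
    have h1 := hp1 e he
    have h2 := hp1 e' he'
    refine hend e e' 0 he he' hW0 (by omega) (by omega) hee (.inr (.inl ⟨hneq hW0 hee, ?_⟩))
    rw [hmod hW0, hmod hW0, hdiv hW0, hdiv hW0]
    exact ⟨rfl, rfl, hlv⟩
  have hz : ∀ e e', e < P.M → e' < P.M → P.rv e = P.rv e' →
      lab (3 * (e * P.W + (P.W - 1))) = lab (3 * (e' * P.W + (P.W - 1))) := by
    intro e e' he he' hrv
    rcases eq_or_ne e e' with rfl | hee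
    · rfl
    have h1 := hp2 e he
    have h2 := hp2 e' he'
    have hlt : P.W - 1 < P.W := by omega
    refine hend e e' _ he he' hlt (by omega) (by omega) hee (.inr (.inr ⟨hneq hlt hee, ?_⟩))
    rw [hmod hlt, hmod hlt, hdiv hlt, hdiv hlt]
    exact ⟨by omega, by omega, hrv⟩
  -- By `hy` and `hz` any path with the given end may represent it; ends without paths get the value
  -- `0`.
  refine ⟨fun c => if h : ∃ e < P.M, P.lv e = c then lab (3 * (h.choose * P.W + 0)) / 2 else 0,
    fun j => if h : ∃ e < P.M, P.rv e = j then lab (3 * (h.choose * P.W + (P.W - 1))) / 2 else 0,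
    fun e he => ?_⟩
  have hl : ∃ e' < P.M, P.lv e' = P.lv e := ⟨e, he, rfl⟩
  have hr : ∃ e' < P.M, P.rv e' = P.rv e := ⟨e, he, rfl⟩
  have h1 := hp1 e he
  have h2 := hp2 e he
  simp only [dif_pos hl, dif_pos hr]
  rw [hy _ e hl.choose_spec.1 he hl.choose_spec.2, hz _ e hr.choose_spec.1 he hr.choose_spec.2]
  have a1 := hAl e he 0 hW0 (by omega)
  have a2 := hAl e he (P.W - 1) (by omega) (by omega)
  refine ⟨?_, a1, ?_, ?_, p e, h1, h2, ?_, ?_⟩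
  · by_contra! h
    have := hright _ _ _ a1 h
    omega
  · by_contra! h
    have := hleft _ _ _ a2 h
    omega
  · have l := hpos he (i := P.W - 1) (by omega)
    have := hlab_lt (3 * (e * P.W + (P.W - 1))) (by omega)
      (hothers e he (P.W - 1) (by omega) 0 (by omega) (.inl (by omega)))
    omega
  · have hc := hconst e he 0 (p e - 1) (by omega)
      fun j _ hj => hothers e he j (by omega) 0 (by omega) (.inl (by omega))
    rw [← hc, zero_add]
    exact hAl e he _ (by omega) (by omega)
  · have hc := hconst e he (p e + 1) (P.W - 1 - (p e + 1)) (by omega)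
      fun j hj hj' => hothers e he j (by omega) 0 (by omega) (.inl (by omega))
    rw [show p e + 1 + (P.W - 1 - (p e + 1)) = P.W - 1 by omega] at hc
    rw [hc]
    exact hAl e he _ (by omega) (by omega)

end PathSystem

/-! ### Digits -/

/-- The `i`-th digit of `x` in base `b`. -/
def dig (b x i : ℕ) : ℕ := x / b ^ i % b

lemma dig_lt {b : ℕ} (hb : 0 < b) (x i : ℕ) : dig b x i < b := Nat.mod_lt _ hb

lemma dig_add_mul_succ {b d : ℕ} (hd : d < b) (x i : ℕ) : dig b (d + b * x) (i + 1) = dig b x i := by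
  unfold dig
  rw [pow_succ', ← Nat.div_div_eq_div_mul, Nat.add_mul_div_left _ _ (by omega),
    Nat.div_eq_of_lt hd, zero_add]

/-- Every sequence of digits has a code. Assignments, choices of indices and labels thereby become
bounded numbers. -/
lemma exists_dig_eq (b r : ℕ) (f : ℕ → ℕ) (hf : ∀ i < r, f i < b) :
    ∃ x < b ^ r, ∀ i < r, dig b x i = f i := by
  induction r generalizing f with
  | zero => exact ⟨0, by simp, by simp⟩
  | succ r ih =>
    obtain ⟨x, hx, hx'⟩ := ih (fun i => f (i + 1)) fun i hi => hf _ (by omega)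
    have h0 := hf 0 (by omega)
    refine ⟨f 0 + b * x, ?_, fun i hi => ?_⟩
    · have : b * (x + 1) ≤ b * b ^ r := Nat.mul_le_mul_left _ hx
      rw [pow_succ']
      rw [mul_add] at this
      omega
    · cases i with
      | zero => simp [dig, Nat.mod_eq_of_lt h0]
      | succ i => rw [dig_add_mul_succ h0, hx' i (by omega)]

/-! ### Quantifier-free formulas about finite structures given by bit tables -/

/-- The code of the tuple `(x v₀, x v₁, …)` in base `n`. -/
def tupleCode (n : ℕ) (x : ℕ → ℕ) : List ℕ → ℕ
  | [] => 0
  | v :: vs => x v + n * tupleCode n x vs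

lemma tupleCode_lt {n : ℕ} {x : ℕ → ℕ} (hx : ∀ v, x v < n) (vs : List ℕ) :
    tupleCode n x vs < n ^ vs.length := by
  induction vs with
  | nil => simp [tupleCode]
  | cons v vs ih =>
    have h : n * (tupleCode n x vs + 1) ≤ n * n ^ vs.length := Nat.mul_le_mul_left _ ih
    have := hx v
    rw [List.length_cons, pow_succ', tupleCode]
    rw [mul_add] at h
    omega

/-- The right-hand side is the formula for `finFunctionFinEquiv`, which orders the bits in `encode`.
-/
lemma tupleCode_ofFn {n l : ℕ} (x : ℕ → ℕ) (f : Fin l → ℕ) :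
    tupleCode n x (List.ofFn f) = ∑ i : Fin l, x (f i) * n ^ (i : ℕ) := by
  induction l with
  | zero => simp [tupleCode]
  | succ l ih =>
    rw [List.ofFn_succ, tupleCode, ih, Fin.sum_univ_succ, Finset.mul_sum]
    simp [pow_succ']
    refine Finset.sum_congr rfl fun i _ => ?_
    ring

/-- Quantifier-free formulas. In `rel o vs`, the list `o` consists of the arities of the relations
whose bit tables precede the one of the relation in question; `mem vs` is the relation variable. -/
inductive QF : Type
  | fls
  | eq (i j : ℕ)
  | rel (o vs : List ℕ)
  | mem (vs : List ℕ)
  | imp (a b : QF)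

namespace QF

/-- Truth in the structure with universe `{0, …, n - 1}` and bit table `tab`, under the assignment
`x` and with the relation variable interpreted by the set `X` of tuple codes. -/
def eval (n : ℕ) (tab : ℕ → Prop) (x : ℕ → ℕ) (X : ℕ → Prop) : QF → Prop
  | fls => False
  | eq i j => x i = x j
  | rel o vs => tab ((o.map (n ^ ·)).sum + tupleCode n x vs)
  | mem vs => X (tupleCode n x vs)
  | imp a b => a.eval n tab x X → b.eval n tab x X

/-- The argument lists of the relation variable. -/
def atoms : QF → List (List ℕ)
  | mem vs => [vs]
  | imp a b => a.atoms ++ b.atoms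
  | _ => []

/-- A strict upper bound on the variables. -/
def width : QF → ℕ
  | fls => 0
  | eq i j => i + j + 1
  | rel _ vs => vs.sum + 1
  | mem vs => vs.sum + 1
  | imp a b => a.width + b.width

/-- The sum of the list is a crude bound on its entries. -/
lemma tupleCode_congr {n : ℕ} {x x' : ℕ → ℕ} (vs : List ℕ)
    (h : ∀ v < vs.sum + 1, x v = x' v) : tupleCode n x vs = tupleCode n x' vs := by
  induction vs with
  | nil => rfl
  | cons v vs ih =>
    rw [List.sum_cons] at h
    rw [tupleCode, tupleCode, h v (by omega), ih fun w hw => h w (by omega)]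

lemma eval_congr {n : ℕ} {tab : ℕ → Prop} {x x' : ℕ → ℕ} {X : ℕ → Prop} (θ : QF)
    (h : ∀ v < θ.width, x v = x' v) : θ.eval n tab x X ↔ θ.eval n tab x' X := by
  induction θ with
  | fls => rfl
  | eq i j =>
    rw [width] at h
    rw [eval, eval, h i (by omega), h j (by omega)]
  | rel o vs => rw [eval, eval, tupleCode_congr vs h]
  | mem vs => rw [eval, eval, tupleCode_congr vs h]
  | imp a b iha ihb =>
    rw [width] at h
    exact imp_congr (iha fun v hv => h v (by omega)) (ihb fun v hv => h v (by omega))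

/-- A formula consults the set only at the tuples of its atoms. Both directions of the reduction
rest on this, since a label has a slot for each atom. -/
lemma eval_congr_set {n : ℕ} {tab : ℕ → Prop} {x : ℕ → ℕ} {X X' : ℕ → Prop} (θ : QF)
    (h : ∀ vs ∈ θ.atoms, X (tupleCode n x vs) ↔ X' (tupleCode n x vs)) :
    θ.eval n tab x X ↔ θ.eval n tab x X' := by
  induction θ with
  | fls => rfl
  | eq i j => rfl
  | rel o vs => rfl
  | mem vs => exact h vs (by simp [atoms])
  | imp a b iha ihb =>
    exact imp_congr (iha fun v hv => h v (by simp [atoms, hv]))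
      (ihb fun v hv => h v (by simp [atoms, hv]))

end QF

/-- There is a set `X` of `k` codes of `s`-tuples that satisfies `θ` under all assignments. -/
def QFSat (θ : QF) (s n : ℕ) (tab : ℕ → Prop) (k : ℕ) : Prop :=
  ∃ S : Finset ℕ, (∀ t ∈ S, t < n ^ s) ∧ S.card = k ∧
    ∀ x < n ^ θ.width, θ.eval n tab (dig n x) (· ∈ S)

/-! ### Universal sentences as `QF` formulas -/

namespace WeightedDef

open FirstOrder Language

/-- The bit of `f` lies behind `n` ones, a zero, the tables of the relations before `i` and the bits
of the tuples with smaller codes. -/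
lemma getD_encode {m n : ℕ} {ar : Fin m → ℕ} (R : ∀ i, Set (Fin (ar i) → Fin n)) (i : Fin m)
    (f : Fin (ar i) → Fin n) :
    (encode R).getD (n + 1 + ((((List.finRange m).take i).map ar).map (n ^ ·)).sum +
      (finFunctionFinEquiv f : ℕ)) false = true ↔ f ∈ R i := by
  classical
  set g : Fin m → List Bool := fun i =>
    List.ofFn fun j : Fin (n ^ ar i) => decide (finFunctionFinEquiv.symm j ∈ R i) with hg
  have henc : encode R = (List.replicate n true ++ [false]) ++ (List.finRange m).flatMap g := by
    simp [encode, hg]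
  have hsplit : List.finRange m =
      (List.finRange m).take i ++ i :: (List.finRange m).drop (i + 1) := by
    conv_lhs => rw [← List.take_append_drop i (List.finRange m)]
    rw [List.drop_eq_getElem_cons (by simp)]
    simp
  have hlen : (((List.finRange m).take i).flatMap g).length =
      ((((List.finRange m).take i).map ar).map (n ^ ·)).sum := by
    rw [List.length_flatMap, List.map_map]
    congr 1
    refine List.map_congr_left fun j _ => ?_
    simp [hg]
  obtain ⟨j, hj⟩ : ∃ j, finFunctionFinEquiv f = j := ⟨_, rfl⟩
  obtain rfl : f = finFunctionFinEquiv.symm j := by rw [← hj, Equiv.symm_apply_apply]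
  have hlt := j.2
  rw [hj, henc, List.getD_append_right _ _ _ _ (by simp; omega)]
  rw [hsplit, List.flatMap_append, List.flatMap_cons]
  rw [List.getD_append_right _ _ _ _ (by rw [hlen]; simp; omega)]
  rw [hlen, List.getD_append _ _ _ _ (by simp [hg]; omega)]
  have hidx : n + 1 + ((((List.finRange m).take i).map ar).map (n ^ ·)).sum +
      (j : ℕ) - (List.replicate n true ++ [false]).length -
      ((((List.finRange m).take i).map ar).map (n ^ ·)).sum = (j : ℕ) := by
    simp
    omega
  rw [← hsplit, hidx, List.getD_eq_getElem _ _ (by simp [hg])]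
  simp [hg]

/-- The bits of a word behind the unary part. -/
def tableBit (n : ℕ) (w : List Bool) (j : ℕ) : Prop := w.getD (n + 1 + j) false = true

/-- The codes of the tuples in `S`. -/
def codes {n s : ℕ} (S : Finset (Fin s → Fin n)) : Finset ℕ :=
  S.map ⟨fun f => (finFunctionFinEquiv f : ℕ), fun _ _ h =>
    finFunctionFinEquiv.injective (Fin.ext h)⟩

lemma mem_codes {n s : ℕ} {S : Finset (Fin s → Fin n)} (f : Fin s → Fin n) :
    (finFunctionFinEquiv f : ℕ) ∈ codes S ↔ f ∈ S := by
  constructor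
  · intro h
    obtain ⟨g, hg, hgf⟩ := Finset.mem_map.1 h
    rwa [← finFunctionFinEquiv.injective (Fin.ext hgf)]
  · exact fun h => Finset.mem_map.2 ⟨f, h, rfl⟩

variable {m s : ℕ} {ar : Fin m → ℕ}

lemma exists_term_eq_var {l : ℕ} (t : (vocab (extArity ar s)).Term (Empty ⊕ Fin l)) :
    ∃ i : Fin l, t = Term.var (Sum.inr i) := by
  cases t with
  | var a =>
    cases a with
    | inl e => exact e.elim
    | inr i => exact ⟨i, rfl⟩
  | func f _ => exact f.elim

/-- Quantifier-free formulas in the sense of Mathlib are expressed by `QF`. -/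
lemma exists_qf_of_isQF {l : ℕ} {φ : (vocab (extArity ar s)).BoundedFormula Empty l}
    (h : BoundedFormula.IsQF φ) :
    ∃ θ : QF, (∀ vs ∈ θ.atoms, vs.length = s) ∧ ∀ (n : ℕ) (R : ∀ i, Set (Fin (ar i) → Fin n))
      (S : Finset (Fin s → Fin n)) (xs : Fin l → Fin n) (x : ℕ → ℕ), (∀ i : Fin l, x i = xs i) →
      ((letI := vocabStructure (extArity ar s) (extRel R (S : Set (Fin s → Fin n)))
        φ.Realize default xs) ↔ θ.eval n (tableBit n (encode R)) x (· ∈ codes S)) := by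
  induction h with
  | falsum =>
    refine ⟨.fls, by simp [QF.atoms], fun n R S xs x hx => ?_⟩
    rfl
  | of_isAtomic h =>
    cases h with
    | equal t₁ t₂ =>
      obtain ⟨i, rfl⟩ := exists_term_eq_var t₁
      obtain ⟨j, rfl⟩ := exists_term_eq_var t₂
      refine ⟨.eq i j, by simp [QF.atoms], fun n R S xs x hx => ?_⟩
      simp [QF.eval, hx, Fin.ext_iff]
    | @rel l' r ts =>
      choose idx hidx using fun i => exists_term_eq_var (ts i)
      obtain rfl : ts = fun i => Term.var (Sum.inr (idx i)) := funext hidx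
      obtain ⟨o, ho⟩ := r
      subst ho
      cases o with
      | none =>
        refine ⟨.mem (List.ofFn fun i : Fin s => (idx i : ℕ)), by simp [QF.atoms],
          fun n R S xs x hx => ?_⟩
        rw [QF.eval, tupleCode_ofFn]
        have hc : ∑ i : Fin s, x (idx i) * n ^ (i : ℕ) =
            (finFunctionFinEquiv (fun i : Fin s => xs (idx i)) : ℕ) := by
          rw [finFunctionFinEquiv_apply]
          simp [hx]
        rw [hc, mem_codes]
        rfl
      | some j =>
        refine ⟨.rel (((List.finRange m).take j).map ar)
          (List.ofFn fun i : Fin (ar j) => (idx i : ℕ)), by simp [QF.atoms],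
          fun n R S xs x hx => ?_⟩
        rw [QF.eval, tupleCode_ofFn]
        have hc : ∑ i : Fin (ar j), x (idx i) * n ^ (i : ℕ) =
            (finFunctionFinEquiv (fun i : Fin (ar j) => xs (idx i)) : ℕ) := by
          rw [finFunctionFinEquiv_apply]
          simp [hx]
        rw [hc, tableBit, ← add_assoc, getD_encode]
        rfl
  | imp _ _ ih₁ ih₂ =>
    obtain ⟨θ₁, h₁, e₁⟩ := ih₁
    obtain ⟨θ₂, h₂, e₂⟩ := ih₂
    refine ⟨.imp θ₁ θ₂, fun vs hvs => ?_, fun n R S xs x hx => ?_⟩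
    · rcases List.mem_append.1 hvs with h | h
      · exact h₁ vs h
      · exact h₂ vs h
    · exact imp_congr (e₁ n R S xs x hx) (e₂ n R S xs x hx)

/-- The matrix stays the same under quantification: an assignment on all of `ℕ` that extends `xs`
already has a value for each quantified variable. -/
lemma exists_qf_of_isUniversal {l : ℕ} {φ : (vocab (extArity ar s)).BoundedFormula Empty l}
    (h : BoundedFormula.IsUniversal φ) :
    ∃ θ : QF, (∀ vs ∈ θ.atoms, vs.length = s) ∧ ∀ (n : ℕ) (R : ∀ i, Set (Fin (ar i) → Fin n))
      (S : Finset (Fin s → Fin n)) (xs : Fin l → Fin n), 0 < n →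
      ((letI := vocabStructure (extArity ar s) (extRel R (S : Set (Fin s → Fin n)))
        φ.Realize default xs) ↔ ∀ x : ℕ → ℕ, (∀ v, x v < n) → (∀ i : Fin l, x i = xs i) →
          θ.eval n (tableBit n (encode R)) x (· ∈ codes S)) := by
  induction h with
  | of_isQF h =>
    obtain ⟨θ, hθ, e⟩ := exists_qf_of_isQF h
    refine ⟨θ, hθ, fun n R S xs hn => ⟨fun hr x _ hx => (e n R S xs x hx).1 hr, fun hx => ?_⟩⟩
    -- Variables beyond those of `xs` get the value `0`, an element because `0 < n`.
    refine (e n R S xs (fun v => if h : v < _ then xs ⟨v, h⟩ else 0) fun i => by simp).2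
      (hx _ (fun v => ?_) fun i => by simp)
    split_ifs
    · exact (xs _).2
    · exact hn
  | @all l' φ' _ ih =>
    obtain ⟨θ, hθ, e⟩ := ih
    refine ⟨θ, hθ, fun n R S xs hn => ?_⟩
    let _ := vocabStructure (extArity ar s) (extRel R (S : Set (Fin s → Fin n)))
    refine BoundedFormula.realize_all.trans ?_
    constructor
    · intro hr x hlt hx
      refine (e n R S _ hn).1 (hr ⟨x l', hlt l'⟩) x hlt fun i => ?_
      refine Fin.lastCases ?_ (fun i => ?_) i
      · simp
      · simp [hx]
    · intro hx a
      refine (e n R S _ hn).2 fun x hlt hx' => hx x hlt fun i => ?_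
      simpa using hx' i.castSucc

/-- `θ` reads only variables below its width, so the assignments are enumerated by the numbers `x <
n ^ θ.width`, with their digits as values. -/
lemma exists_qf {φ : (vocab (extArity ar s)).Sentence} (h : BoundedFormula.IsUniversal φ) :
    ∃ θ : QF, (∀ vs ∈ θ.atoms, vs.length = s) ∧ ∀ (n : ℕ) (R : ∀ i, Set (Fin (ar i) → Fin n))
      (k : ℕ), 0 < n →
      ((∃ S : Finset (Fin s → Fin n), S.card = k ∧ Models R (S : Set (Fin s → Fin n)) φ) ↔
        QFSat θ s n (tableBit n (encode R)) k) := by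
  obtain ⟨θ, hθ, e⟩ := exists_qf_of_isUniversal h
  refine ⟨θ, hθ, fun n R k hn => ?_⟩
  have key : ∀ S : Finset (Fin s → Fin n), Models R (S : Set (Fin s → Fin n)) φ ↔
      ∀ x < n ^ θ.width, θ.eval n (tableBit n (encode R)) (dig n x) (· ∈ codes S) := by
    intro S
    refine (e n R S default hn).trans ⟨fun hx x _ => ?_, fun hx x hlt _ => ?_⟩
    · exact hx _ (dig_lt hn x) fun i => i.elim0
    · obtain ⟨y, hy, hy'⟩ := exists_dig_eq n θ.width x fun i _ => hlt i
      exact (θ.eval_congr hy').1 (hx y hy)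
  constructor
  · rintro ⟨S, rfl, hS⟩
    refine ⟨codes S, fun t ht => ?_, by simp [codes], (key S).1 hS⟩
    obtain ⟨f, -, rfl⟩ := Finset.mem_map.1 ht
    exact (finFunctionFinEquiv f).2
  · rintro ⟨S, hlt, rfl, hS⟩
    let T : Finset (Fin s → Fin n) := Finset.univ.filter fun f => (finFunctionFinEquiv f : ℕ) ∈ S
    have hT : codes T = S := by
      ext t
      constructor
      · intro ht
        obtain ⟨f, hf, rfl⟩ := Finset.mem_map.1 ht
        exact (Finset.mem_filter.1 hf).2
      · intro ht
        refine Finset.mem_map.2 ⟨finFunctionFinEquiv.symm ⟨t, hlt t ht⟩,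
          Finset.mem_filter.2 ⟨Finset.mem_univ _, by rwa [Equiv.apply_symm_apply]⟩, ?_⟩
        exact congrArg Fin.val (Equiv.apply_symm_apply finFunctionFinEquiv ⟨t, hlt t ht⟩)
    refine ⟨T, ?_, (key T).2 ?_⟩
    · rw [← hT]
      simp [codes]
    · rwa [hT]

end WeightedDef

/-! ### From weighted satisfiability of quantifier-free formulas to systems of paths -/

/-- The slots of a label are its low digits, which the data of the search tree above them do not
affect. -/
lemma dig_add_pow_mul {b q i : ℕ} (hb : 0 < b) (hi : i < q) (p u : ℕ) :
    dig b (p + b ^ q * u) i = dig b p i := by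
  unfold dig
  rw [show b ^ q * u = b ^ i * (b * (b ^ (q - i - 1) * u)) by
    rw [← mul_assoc, ← mul_assoc, ← pow_succ, ← pow_add]; congr 2; omega,
    Nat.add_mul_div_left _ _ (pow_pos hb i), Nat.add_mul_mod_self_left]

lemma tupleCode_lt_of_mem {θ : QF} {s n : ℕ} (hθ : ∀ vs ∈ θ.atoms, vs.length = s) (hn : 0 < n)
    (x : ℕ) {vs : List ℕ} (h : vs ∈ θ.atoms) : tupleCode n (dig n x) vs < n ^ s :=
  hθ vs h ▸ tupleCode_lt (dig_lt hn x) vs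

/-- The code of the `l`-th tuple in a list of argument lists, or `d` beyond the list. -/
def atomAt (n : ℕ) (x : ℕ → ℕ) (d : ℕ) : List (List ℕ) → ℕ → ℕ
  | [], _ => d
  | vs :: as, l => if l = 0 then tupleCode n x vs else atomAt n x d as (l - 1)

lemma atomAt_mem_or (n : ℕ) (x : ℕ → ℕ) (d : ℕ) (as : List (List ℕ)) (l : ℕ) :
    (∃ vs ∈ as, atomAt n x d as l = tupleCode n x vs) ∨ atomAt n x d as l = d := by
  induction as generalizing l with
  | nil => exact .inr rfl
  | cons vs as ih =>
    rw [atomAt]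
    split_ifs
    · exact .inl ⟨vs, by simp, rfl⟩
    · rcases ih (l - 1) with ⟨ws, h, h'⟩ | h
      · exact .inl ⟨ws, by simp [h], h'⟩
      · exact .inr h

lemma exists_mem_atomAt {n : ℕ} {x : ℕ → ℕ} {d : ℕ} {as : List (List ℕ)} {l : ℕ}
    (h : l < as.length) : ∃ vs ∈ as, atomAt n x d as l = tupleCode n x vs := by
  induction as generalizing l with
  | nil => simp at h
  | cons vs as ih =>
    rw [atomAt]
    split_ifs
    · exact ⟨vs, by simp, rfl⟩
    · obtain ⟨ws, h, h'⟩ := ih (l := l - 1) (by rw [List.length_cons] at h; omega)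
      exact ⟨ws, by simp [h], h'⟩

lemma exists_atomAt_eq {n : ℕ} {x : ℕ → ℕ} {d : ℕ} {as : List (List ℕ)} {vs : List ℕ}
    (h : vs ∈ as) : ∃ l < as.length, atomAt n x d as l = tupleCode n x vs := by
  induction as with
  | nil => simp at h
  | cons ws as ih =>
    rcases List.mem_cons.1 h with rfl | h
    · exact ⟨0, by simp, by simp [atomAt]⟩
    · obtain ⟨l, hl, h'⟩ := ih h
      exact ⟨l + 1, by simpa, by simpa [atomAt]⟩

/-! ### Labels, search trees and the comparing paths -/

/-- An instance of weighted satisfiability of the formula `θ` for sets of `s`-tuples. -/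
structure SatInstance where
  θ : QF
  s : ℕ
  n : ℕ
  k : ℕ
  tab : ℕ → Prop

namespace SatInstance

variable (I : SatInstance)

/-- The number of tuples; it also serves as the code of a missing tuple. -/
def N : ℕ := I.n ^ I.s

/-- The tuples of a solution have the indices below `k`; the index `k` stands for the missing tuple.
-/
def K : ℕ := I.k + 1

/-- One slot for each atom. The two extra slots let any two tuples of a solution occur together in
some label, and make `0` a legal selection even without atoms. -/
def q : ℕ := I.θ.atoms.length + 2

/-- A digit is a pair of a selected atom and an index of a tuple. -/
def Z : ℕ := I.q * I.K

/-- The number of labels that consist of `q` tuples and `k` digits below `Z`. -/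
def D : ℕ := (I.N + 1) ^ I.q * I.Z ^ I.k

/-- The number of assignments. -/
def A : ℕ := I.n ^ I.θ.width

def slot (a i : ℕ) : ℕ := dig (I.N + 1) a i

def digit (a m : ℕ) : ℕ := dig I.Z (a / (I.N + 1) ^ I.q) m

/-- For level `m` of the search tree, the label stores which atom is selected and, in `wit`, which
tuple of the solution this atom is claimed to be. -/
def choice (a m : ℕ) : ℕ := I.digit a m % I.q

def wit (a m : ℕ) : ℕ := I.digit a m / I.q

def atom (l x : ℕ) : ℕ := atomAt I.n (dig I.n x) I.N I.θ.atoms l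

/-- The set of the tuples in the slots of a label. -/
def slots (a t : ℕ) : Prop := ∃ i < I.q, I.slot a i = t

/-- The assignment `x` violates the formula for the set `P`, and none of the tuples
`h 0, …, h (m - 1)` changes the truth value of one of its atoms. -/
def unhit (P : ℕ → Prop) (h : ℕ → ℕ) (m x : ℕ) : Prop :=
  ¬ I.θ.eval I.n I.tab (dig I.n x) P ∧
    ∀ l < I.θ.atoms.length, ∀ m' < m, I.atom l x = h m' → P (I.atom l x)

/-- One step of the search tree: select an atom of the first assignment that is still unhit. -/
noncomputable def step (sel : ℕ → ℕ → ℕ) (P : ℕ → Prop) (h : ℕ → ℕ) (m : ℕ) : ℕ :=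
  if RAM.first I.A (I.unhit P h m) < I.A then
    I.atom (sel m (RAM.first I.A (I.unhit P h m))) (RAM.first I.A (I.unhit P h m))
  else I.N

noncomputable def history (sel : ℕ → ℕ → ℕ) (P : ℕ → Prop) : ℕ → ℕ → ℕ
  | 0 => fun _ => 0
  | m + 1 => Function.update (history sel P m) m (I.step sel P (history sel P m) m)

/-- The branch of the search tree for the set `P` that is given by the selections `sel`. -/
noncomputable def branch (sel : ℕ → ℕ → ℕ) (P : ℕ → Prop) (m : ℕ) : ℕ :=
  I.step sel P (I.history sel P m) m

/-- The tuples on the branch are recomputed from the stored selections. This keeps the exponent of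
`N` in the number of labels independent of `k`. -/
noncomputable def leaf (a m : ℕ) : ℕ := I.branch (fun m _ => I.choice a m) (I.slots a) m

def complete (P : ℕ → Prop) (h : ℕ → ℕ) : Prop := ∀ x < I.A, ¬ I.unhit P h I.k x

/-- Entry `m` of a label, a slot or a level of the search tree, claims that the tuple `val` has the
index `idx` in the solution. -/
def val (lf : ℕ → ℕ → ℕ) (a m : ℕ) : ℕ := if m < I.q then I.slot a m else lf a (m - I.q)

def idx (c a m : ℕ) : ℕ := if m < I.q then dig I.K c m else I.wit a (m - I.q)

/-- The first two conditions are internal to the label: its branch is complete, and slots with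
different indices hold different tuples. The third keeps left labels off the last two positions. The
last one limits the reach of the label by each entry that claims the index `j` of the path, in the
order given by the parity of `e`. -/
def leftOk (lf : ℕ → ℕ → ℕ) (e i a : ℕ) : Prop :=
  I.complete (I.slots a) (lf a) ∧
  (∀ m < I.q, ∀ m' < I.q, dig I.K (e / 2 / I.K) m ≠ dig I.K (e / 2 / I.K) m' →
    I.slot a m ≠ I.slot a m') ∧
  i ≤ 2 * I.N + 1 ∧
  ∀ m < I.q + I.k, I.idx (e / 2 / I.K) a m = e / 2 % I.K →
    i ≤ 2 * (if e % 2 = 0 then I.val lf a m else I.N - I.val lf a m) + 1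

/-- Consecutive values are spaced by `2`, so that deleting a vertex enforces the same comparison as
deleting an edge. All right labels are kept off the first two positions. -/
def rightOk (e i t : ℕ) : Prop :=
  (e / 2 % I.K < I.k → t < I.N) ∧ (e / 2 % I.K = I.k → t = I.N) ∧
  2 * (if e % 2 = 0 then t else I.N - t) + 2 ≤ i

/-- The system of paths. The path `(c * K + j) * 2 + d` compares a label for `c` with the `j`-th
tuple of the solution. -/
def paths (lf : ℕ → ℕ → ℕ) : PathSystem where
  M := I.K ^ I.q * I.K * 2
  W := 2 * I.N + 4
  L := I.D + I.N + 1
  lv e := e / 2 / I.K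
  rv e := e / 2 % I.K
  Al e i a := (a < I.D ∧ I.leftOk lf e i a) ∨ (I.D ≤ a ∧ I.rightOk e i (a - I.D))

variable {I}

lemma K_pos : 0 < I.K := Nat.succ_pos _

lemma q_pos : 0 < I.q := Nat.succ_pos _

lemma Z_pos : 0 < I.Z := Nat.mul_pos q_pos K_pos

lemma wit_lt (a m : ℕ) : I.wit a m < I.K :=
  Nat.div_lt_of_lt_mul (dig_lt Z_pos _ _)

lemma unhit_congr {P : ℕ → Prop} {h h' : ℕ → ℕ} {m : ℕ} (hh : ∀ m' < m, h m' = h' m') (x : ℕ) :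
    I.unhit P h m x ↔ I.unhit P h' m x := by
  unfold unhit
  refine and_congr_right fun _ => forall₂_congr fun l _ => forall₂_congr fun m' hm' => ?_
  rw [hh m' hm']

lemma step_congr {sel : ℕ → ℕ → ℕ} {P : ℕ → Prop} {h h' : ℕ → ℕ} {m : ℕ}
    (hh : ∀ m' < m, h m' = h' m') : I.step sel P h m = I.step sel P h' m := by
  unfold step
  rw [show I.unhit P h m = I.unhit P h' m from funext fun x => propext (unhit_congr hh x)]

lemma history_eq (sel : ℕ → ℕ → ℕ) (P : ℕ → Prop) {m m' : ℕ} (h : m' < m) :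
    I.history sel P m m' = I.branch sel P m' := by
  induction m with
  | zero => omega
  | succ m ih =>
    rw [history]
    rcases Nat.lt_succ_iff_lt_or_eq.1 h with h | rfl
    · rw [Function.update_of_ne h.ne, ih h]
    · rw [Function.update_self, branch]

/-- The recursion without the auxiliary history: each level is a step from the lower levels of the
branch itself. -/
lemma branch_eq (sel : ℕ → ℕ → ℕ) (P : ℕ → Prop) (m : ℕ) :
    I.branch sel P m = I.step sel P (I.branch sel P) m :=
  step_congr fun _ h => history_eq sel P h

lemma atom_lt (hθ : ∀ vs ∈ I.θ.atoms, vs.length = I.s) (hn : 0 < I.n) {l : ℕ}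
    (hl : l < I.θ.atoms.length) (x : ℕ) : I.atom l x < I.N := by
  obtain ⟨vs, hvs, h⟩ := exists_mem_atomAt (n := I.n) (x := dig I.n x) (d := I.N) hl
  rw [atom, h]
  exact tupleCode_lt_of_mem hθ hn x hvs

lemma atom_le (hθ : ∀ vs ∈ I.θ.atoms, vs.length = I.s) (hn : 0 < I.n) (l x : ℕ) :
    I.atom l x ≤ I.N := by
  rcases atomAt_mem_or I.n (dig I.n x) I.N I.θ.atoms l with ⟨vs, hvs, h⟩ | h
  · rw [atom, h]
    exact (tupleCode_lt_of_mem hθ hn x hvs).le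
  · exact h.le

lemma leaf_le (hθ : ∀ vs ∈ I.θ.atoms, vs.length = I.s) (hn : 0 < I.n) (a m : ℕ) :
    I.leaf a m ≤ I.N := by
  rw [leaf, branch, step]
  split_ifs
  · exact atom_le hθ hn _ _
  · exact le_rfl

/-- An assignment that violates the formula for a subset `P` of a solution `S` has an atom in
`S \ P`. -/
lemma exists_atom_mem (hθ : ∀ vs ∈ I.θ.atoms, vs.length = I.s) (hn : 0 < I.n) {S : Finset ℕ}
    (hS : ∀ x < I.A, I.θ.eval I.n I.tab (dig I.n x) (· ∈ S)) {P : ℕ → Prop}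
    (hP : ∀ t < I.N, P t → t ∈ S) {x : ℕ} (hx : x < I.A)
    (hbad : ¬ I.θ.eval I.n I.tab (dig I.n x) P) :
    ∃ l < I.θ.atoms.length, I.atom l x ∈ S ∧ ¬ P (I.atom l x) := by
  by_contra! hcon
  refine hbad ((I.θ.eval_congr_set fun vs hvs => ?_).1 (hS x hx))
  obtain ⟨l, hl, h⟩ := exists_atomAt_eq (n := I.n) (x := dig I.n x) (d := I.N) hvs
  rw [← h]
  exact ⟨fun h => hcon l hl h, fun h => hP _ (atom_lt hθ hn hl x) h⟩

/-- In the search tree for a subset `P` of a solution `S`, some branch stays in `S` and is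
complete. -/
lemma exists_branch (hθ : ∀ vs ∈ I.θ.atoms, vs.length = I.s) (hn : 0 < I.n) {S : Finset ℕ}
    (hcard : S.card = I.k) (hS : ∀ x < I.A, I.θ.eval I.n I.tab (dig I.n x) (· ∈ S)) {P : ℕ → Prop}
    (hP : ∀ t < I.N, P t → t ∈ S) :
    ∃ sel : ℕ → ℕ → ℕ, (∀ m x, sel m x < I.q) ∧
      (∀ m, I.branch sel P m ∈ S ∨ I.branch sel P m = I.N) ∧ I.complete P (I.branch sel P) := by
  classical
  -- The selection depends on the assignment alone: an atom in `S` outside `P`, which exists by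
  -- `exists_atom_mem` if the assignment is violated.
  let pick (x : ℕ) : ℕ := if h : ∃ l < I.θ.atoms.length, I.atom l x ∈ S ∧ ¬ P (I.atom l x) then
    h.choose else 0
  have hpick : ∀ x < I.A, ¬ I.θ.eval I.n I.tab (dig I.n x) P → pick x < I.θ.atoms.length ∧
      I.atom (pick x) x ∈ S ∧ ¬ P (I.atom (pick x) x) := by
    intro x hx hbad
    have h := exists_atom_mem hθ hn hS hP hx hbad
    simp only [pick, dif_pos h]
    exact h.choose_spec
  set h := I.branch (fun _ x => pick x) P with hh
  have hstep : ∀ m, h m = I.step (fun _ x => pick x) P h m := fun m => branch_eq _ _ _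
  refine ⟨fun _ x => pick x, fun m x => ?_, fun m => ?_, fun x hx hun => ?_⟩
  · simp only [pick]
    split_ifs with hex
    · have := hex.choose_spec.1
      unfold q
      omega
    · exact q_pos
  · rw [← hh, hstep, step]
    split_ifs with hlt
    · exact .inl (hpick _ hlt ((RAM.first_spec _ _).2.2 hlt).1).2.1
    · exact .inr rfl
  · rw [← hh] at hun
    have hmono : ∀ m ≤ I.k, I.unhit P h m x := fun m hm =>
      ⟨hun.1, fun l hl m' hm' => hun.2 l hl m' (by omega)⟩
    -- If `x` were unhit after `k` levels, an atom of `x` would extend the branch to `k + 1` tuples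
    -- of `S`. Each differs from the earlier ones, because its assignment was unhit by them. This
    -- contradicts `S.card = k`.
    let v (m : ℕ) : ℕ := if m < I.k then h m else I.atom (pick x) x
    have hv : ∀ m ≤ I.k, ∃ y < I.A, I.unhit P h m y ∧ v m = I.atom (pick y) y := by
      intro m hm
      by_cases hmk : m < I.k
      · obtain ⟨-, h2, h3⟩ := RAM.first_spec I.A (I.unhit P h m)
        have hlt : RAM.first I.A (I.unhit P h m) < I.A := by
          by_contra hge
          exact h2 x (by omega) (hmono m hm)
        refine ⟨_, hlt, h3 hlt, ?_⟩
        simp only [v, if_pos hmk]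
        rw [hstep, step, if_pos hlt]
      · obtain rfl : m = I.k := by omega
        exact ⟨x, hx, hmono _ le_rfl, by simp only [v, if_neg hmk]⟩
    have hvS : ∀ m ≤ I.k, v m ∈ S := by
      intro m hm
      obtain ⟨y, hy, hyu, hye⟩ := hv m hm
      rw [hye]
      exact (hpick y hy hyu.1).2.1
    have hvne : ∀ m ≤ I.k, ∀ m' < m, v m' ≠ v m := by
      intro m hm m' hm' heq
      obtain ⟨y, hy, hyu, hye⟩ := hv m hm
      have hp := hpick y hy hyu.1
      refine hp.2.2 (hyu.2 _ hp.1 m' hm' ?_)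
      rw [← hye, ← heq]
      simp only [v, if_pos (show m' < I.k by omega)]
    have := Finset.card_le_card_of_injOn (s := Finset.range (I.k + 1)) (t := S) v
      (fun m hm => hvS m (by have := Finset.mem_range.1 (Finset.mem_coe.1 hm); omega))
      (fun m hm m' hm' heq => by
        have h1 := Finset.mem_range.1 (Finset.mem_coe.1 hm)
        have h2 := Finset.mem_range.1 (Finset.mem_coe.1 hm')
        rcases lt_trichotomy m m' with hlt | heq' | hlt
        · exact absurd heq (hvne m' (by omega) m hlt)
        · exact heq'
        · exact absurd heq.symm (hvne m (by omega) m' hlt))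
    rw [Finset.card_range, hcard] at this
    omega

/-- For each choice `c` of indices there is a label that records the tuples of the solution with
these indices and a complete branch of the search tree within the solution. -/
lemma exists_label (hθ : ∀ vs ∈ I.θ.atoms, vs.length = I.s) (hn : 0 < I.n) {S : Finset ℕ}
    (hcard : S.card = I.k) (hS : ∀ x < I.A, I.θ.eval I.n I.tab (dig I.n x) (· ∈ S)) {t : ℕ → ℕ}
    (ht : ∀ j < I.k, t j ∈ S) (htN : t I.k = I.N) (hSt : ∀ v ∈ S, ∃ j < I.k, t j = v)
    (hlt : ∀ v ∈ S, v < I.N) (c : ℕ) :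
    ∃ a < I.D, (∀ m < I.q, I.slot a m = t (dig I.K c m)) ∧
      (∀ m < I.k, I.leaf a m = t (I.wit a m)) ∧ I.complete (I.slots a) (I.leaf a) := by
  have htle : ∀ j < I.K, t j ≤ I.N := by
    intro j hj
    by_cases h : j < I.k
    · exact (hlt _ (ht j h)).le
    · rw [show j = I.k by unfold K at hj; omega, htN]
  -- The low part `p` of the label holds the slots; the search tree is taken for their set.
  obtain ⟨p, hp, hp'⟩ := exists_dig_eq (I.N + 1) I.q (fun m => t (dig I.K c m))
    fun m _ => Nat.lt_succ_of_le (htle _ (dig_lt K_pos _ _))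
  have hP : ∀ v < I.N, I.slots p v → v ∈ S := by
    rintro v hv ⟨i, hi, rfl⟩
    rw [slot, hp' i hi] at hv ⊢
    by_cases h : dig I.K c i < I.k
    · exact ht _ h
    · have := dig_lt K_pos c i (b := I.K)
      rw [show dig I.K c i = I.k by unfold K at *; omega, htN] at hv
      omega
  obtain ⟨sel, hsel, hmem, hcomp⟩ := exists_branch hθ hn hcard hS hP
  have hj : ∀ m, ∃ j < I.K, I.branch sel (I.slots p) m = t j := by
    intro m
    rcases hmem m with h | h
    · obtain ⟨j, hj, h'⟩ := hSt _ h
      exact ⟨j, by unfold K; omega, h'.symm⟩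
    · exact ⟨I.k, by unfold K; omega, by rw [h, htN]⟩
  choose w hw hw' using hj
  set h := I.branch sel (I.slots p) with hh
  let x (m : ℕ) : ℕ := RAM.first I.A (I.unhit (I.slots p) h m)
  -- The high part records, for each level, the selection at the first unhit assignment and the
  -- index of the tuple found.
  obtain ⟨u, hu, hu'⟩ := exists_dig_eq I.Z I.k (fun m => sel m (x m) + I.q * w m) fun m _ => by
    have h1 := hsel m (x m)
    have h2 : I.q * (w m + 1) ≤ I.q * I.K := Nat.mul_le_mul_left _ (hw m)
    rw [mul_add] at h2
    change _ < I.q * I.K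
    omega
  have hpow : 0 < (I.N + 1) ^ I.q := by positivity
  set a := p + (I.N + 1) ^ I.q * u with ha
  have hadiv : a / (I.N + 1) ^ I.q = u := by
    rw [ha, Nat.add_mul_div_left _ _ hpow, Nat.div_eq_of_lt hp, zero_add]
  have hslot : ∀ m < I.q, I.slot a m = I.slot p m := fun m hm => dig_add_pow_mul (by omega) hm _ _
  have hslots : I.slots a = I.slots p := by
    funext v
    refine propext (exists_congr fun i => and_congr_right fun hi => ?_)
    rw [hslot i hi]
  have hchoice : ∀ m < I.k, I.choice a m = sel m (x m) := by
    intro m hm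
    rw [choice, digit, hadiv, hu' m hm, Nat.add_mul_mod_self_left, Nat.mod_eq_of_lt (hsel _ _)]
  have hwit : ∀ m < I.k, I.wit a m = w m := by
    intro m hm
    rw [wit, digit, hadiv, hu' m hm, Nat.add_mul_div_left _ _ q_pos,
      Nat.div_eq_of_lt (hsel _ _), zero_add]
  -- Each level sees only the lower ones, so by induction the recorded selections reproduce the
  -- branch.
  have hleaf : ∀ m < I.k, I.leaf a m = h m := by
    intro m
    induction m using Nat.strong_induction_on with
    | _ m ih =>
      intro hm
      have h1 : I.leaf a m = I.step (fun m _ => I.choice a m) (I.slots p) h m := by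
        rw [leaf, branch_eq, hslots]
        refine step_congr fun m' hm' => ?_
        rw [← ih m' hm' (by omega), leaf, hslots]
      rw [h1, hh, branch_eq, ← hh, step, step, hchoice m hm]
  refine ⟨a, ?_, fun m hm => ?_, fun m hm => ?_, fun y hy hun => hcomp y hy ?_⟩
  · have : (I.N + 1) ^ I.q * (u + 1) ≤ (I.N + 1) ^ I.q * I.Z ^ I.k := Nat.mul_le_mul_left _ hu
    rw [mul_add] at this
    unfold D
    omega
  · rw [hslot m hm, slot, hp' m hm]
  · rw [hleaf m hm, hwit m hm, hw']
  · rw [hslots] at hun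
    exact (unhit_congr hleaf y).1 hun

/-- The right label of `j` is the tuple `t j` and the left label of `c` comes from `exists_label`.
All claims of the labels are then true, so on each path the two labels meet where `t j` dictates,
and the cut is made there. -/
lemma edgeSolvable_of_sat (hθ : ∀ vs ∈ I.θ.atoms, vs.length = I.s) (hn : 0 < I.n)
    {lf : ℕ → ℕ → ℕ} (hlf : ∀ a < I.D, ∀ m < I.k, lf a m = I.leaf a m)
    (h : QFSat I.θ I.s I.n I.tab I.k) : (I.paths lf).ulc.EdgeSolvable (I.paths lf).M := by
  obtain ⟨S, hlt, hcard, hS⟩ := h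
  let f := S.equivFinOfCardEq hcard
  -- The solution is enumerated by the indices below `k`; the index `k` gets the code `N` of the
  -- missing tuple.
  let t (j : ℕ) : ℕ := if h : j < I.k then (f.symm ⟨j, h⟩ : ℕ) else I.N
  have ht : ∀ j < I.k, t j ∈ S := fun j hj => by
    simp only [t, dif_pos hj]
    exact (f.symm ⟨j, hj⟩).2
  have htN : t I.k = I.N := by simp [t]
  have hSt : ∀ v ∈ S, ∃ j < I.k, t j = v := fun v hv =>
    ⟨f ⟨v, hv⟩, (f ⟨v, hv⟩).2, by simp [t]⟩
  have htle : ∀ j, t j ≤ I.N := by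
    intro j
    by_cases h : j < I.k
    · exact (hlt _ (ht j h)).le
    · simp [t, h]
  have hinj : ∀ i < I.K, ∀ j < I.K, i ≠ j → t i ≠ t j := by
    intro i hi j hj hij heq
    have hN : ∀ j < I.k, t j ≠ I.N := fun j hj => (hlt _ (ht j hj)).ne
    unfold K at hi hj
    by_cases h1 : i < I.k <;> by_cases h2 : j < I.k
    · simp only [t, dif_pos h1, dif_pos h2] at heq
      have := f.symm.injective (Subtype.ext heq)
      exact hij (Fin.ext_iff.1 this)
    · exact hN i h1 (by rw [heq, show j = I.k by omega, htN])
    · exact hN j h2 (by rw [← heq, show i = I.k by omega, htN])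
    · omega
  choose y hyD hyslot hyleaf hycomp using
    fun c => exists_label hθ hn hcard hS ht htN hSt (fun v hv => hlt v hv) c
  have hβ : ∀ e, (if e % 2 = 0 then t (e / 2 % I.K) else I.N - t (e / 2 % I.K)) ≤ I.N := by
    intro e
    have := htle (e / 2 % I.K)
    split_ifs <;> omega
  refine PathSystem.ulc_edgeSolvable y (fun j => I.D + t j)
    (fun e => 2 * (if e % 2 = 0 then t (e / 2 % I.K) else I.N - t (e / 2 % I.K)) + 1)
    (fun e _ => ?_) (fun e _ => ?_) (fun e _ => ?_) (fun e _ i hi => .inl ⟨hyD _, ?_⟩)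
    (fun e _ i _ hi => .inr ⟨Nat.le_add_right _ _, ?_⟩)
  · change _ < I.D + I.N + 1
    have := hyD ((I.paths lf).lv e)
    omega
  · change _ < I.D + I.N + 1
    have := htle ((I.paths lf).rv e)
    omega
  · change _ < 2 * I.N + 4
    have := hβ e
    omega
  · have hβe := hβ e
    change I.leftOk lf e i (y (e / 2 / I.K))
    refine ⟨?_, fun m hm m' hm' hne => ?_, by omega, fun m hm hidx => hi.trans (le_of_eq ?_)⟩
    · intro x hx hun
      exact hycomp _ x hx ((unhit_congr (fun m hm => hlf _ (hyD _) m hm) x).1 hun)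
    · rw [hyslot _ m hm, hyslot _ m' hm']
      exact hinj _ (dig_lt K_pos _ _) _ (dig_lt K_pos _ _) hne
    · have hval : I.val lf (y (e / 2 / I.K)) m = t (e / 2 % I.K) := by
        unfold val
        unfold idx at hidx
        split_ifs at hidx ⊢ with hmq
        · rw [hyslot _ m hmq, hidx]
        · rw [hlf _ (hyD _) _ (by omega), hyleaf _ _ (by omega), hidx]
      rw [hval]
  · change I.rightOk e i (I.D + t (e / 2 % I.K) - I.D)
    rw [Nat.add_sub_cancel_left]
    exact ⟨fun h => hlt _ (ht _ h), fun h => by rw [h, htN], by omega⟩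

/-- Given `x`, a suitable `c` makes the slots agree with the solution on all atoms of `x`. If `x`
violated the formula, the complete branch would contain an atom of `x` that is in the solution but
not in the slots. -/
lemma sat_of_nodeSolvable (hθ : ∀ vs ∈ I.θ.atoms, vs.length = I.s) (hn : 0 < I.n)
    {lf : ℕ → ℕ → ℕ} (hlf : ∀ a < I.D, ∀ m < I.k, lf a m = I.leaf a m)
    (h : (I.paths lf).ulc.NodeSolvable (I.paths lf).M) : QFSat I.θ I.s I.n I.tab I.k := by
  classical
  obtain ⟨y, z, hyz⟩ := PathSystem.exists_of_ulc_nodeSolvable (P := I.paths lf) (D := I.D)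
    (by change 4 ≤ 2 * I.N + 4; omega)
    (fun e i a hAl ha => by
      change i + 3 ≤ 2 * I.N + 4
      rcases hAl with ⟨-, -, -, h, -⟩ | ⟨h, -⟩ <;> omega)
    (fun e i a hAl ha => by
      rcases hAl with ⟨h, -⟩ | ⟨-, -, -, h⟩ <;> omega) h
  let t (j : ℕ) : ℕ := z j - I.D
  -- What the path for `c`, `j` and the direction `d` enforces. If `τ` is the value of the right
  -- label and `v` a claimed value, both reflected for `d = 1`, the cut at `p` gives `2 * τ + 1 ≤ p
  -- ≤ 2 * v + 2`, hence `τ ≤ v`.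
  have hfacts : ∀ c < I.K ^ I.q, ∀ j < I.K, ∀ d < 2, y c < I.D ∧
      I.complete (I.slots (y c)) (lf (y c)) ∧
      (∀ m < I.q, ∀ m' < I.q, dig I.K c m ≠ dig I.K c m' → I.slot (y c) m ≠ I.slot (y c) m') ∧
      t j ≤ I.N ∧ (j < I.k → t j < I.N) ∧ (j = I.k → t j = I.N) ∧
      ∀ m < I.q + I.k, I.idx c (y c) m = j → (if d = 0 then t j else I.N - t j) ≤
        (if d = 0 then I.val lf (y c) m else I.N - I.val lf (y c) m) := by
    intro c hc j hj d hd
    have hM : (c * I.K + j) * 2 + d < (I.paths lf).M := by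
      change _ < I.K ^ I.q * I.K * 2
      have : (c + 1) * I.K ≤ I.K ^ I.q * I.K := Nat.mul_le_mul_right _ hc
      rw [add_mul] at this
      omega
    have e1 : ((c * I.K + j) * 2 + d) / 2 = c * I.K + j := by omega
    have e2 : (c * I.K + j) / I.K = c := by
      rw [add_comm, Nat.add_mul_div_right _ _ K_pos, Nat.div_eq_of_lt hj, zero_add]
    have e3 : (c * I.K + j) % I.K = j := by
      rw [add_comm, Nat.add_mul_mod_self_right, Nat.mod_eq_of_lt hj]
    have e4 : ((c * I.K + j) * 2 + d) % 2 = d := by omega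
    have hlv : (I.paths lf).lv ((c * I.K + j) * 2 + d) = c := by
      change ((c * I.K + j) * 2 + d) / 2 / I.K = c
      rw [e1, e2]
    have hrv : (I.paths lf).rv ((c * I.K + j) * 2 + d) = j := by
      change ((c * I.K + j) * 2 + d) / 2 % I.K = j
      rw [e1, e3]
    obtain ⟨hyD, -, hzD, hzL, p, hp1, -, hl, hr⟩ := hyz _ hM
    rw [hlv] at hyD hl
    rw [hrv] at hzD hzL hr
    rcases hl with ⟨-, hl1, hl2, -, hl3⟩ | ⟨hl, -⟩
    swap
    · omega
    rcases hr with ⟨hr, -⟩ | ⟨-, hr1, hr2, hr3⟩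
    · omega
    rw [e1, e2] at hl2
    rw [e1, e2, e3, e4] at hl3
    rw [e1, e3] at hr1 hr2
    rw [e4] at hr3
    have hzL' : z j < I.D + I.N + 1 := hzL
    refine ⟨hyD, hl1, hl2, ?_, hr1, hr2, fun m hm hidx => ?_⟩
    · change z j - I.D ≤ I.N
      omega
    · have := hl3 m hm hidx
      simp only [t]
      omega
  have hfacts₀ := fun c hc j hj => hfacts c hc j hj 0 (by omega)
  have hKpos := K_pos (I := I)
  have htle : ∀ j < I.K, t j ≤ I.N := fun j hj => (hfacts₀ 0 (by positivity) j hj).2.2.2.1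
  have htlt : ∀ j < I.k, t j < I.N := fun j hj =>
    (hfacts₀ 0 (by positivity) j (by unfold K; omega)).2.2.2.2.1 hj
  have htN : t I.k = I.N :=
    (hfacts₀ 0 (by positivity) I.k (by unfold K; omega)).2.2.2.2.2.1 rfl
  -- The two directions give the two inequalities. Reflection at `N` loses nothing, because both
  -- values are at most `N`.
  have hval : ∀ c < I.K ^ I.q, ∀ m < I.q + I.k, I.idx c (y c) m < I.K →
      I.val lf (y c) m = t (I.idx c (y c) m) := by
    intro c hc m hm hlt
    have h0 := hfacts c hc _ hlt 0 (by omega)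
    have h1 := (hfacts c hc _ hlt 1 (by omega)).2.2.2.2.2.2 m hm rfl
    have h2 := h0.2.2.2.2.2.2 m hm rfl
    simp only [if_true, one_ne_zero, if_false] at h1 h2
    have hle : I.val lf (y c) m ≤ I.N := by
      unfold val
      split_ifs
      · exact Nat.le_of_lt_succ (dig_lt (by omega) _ _)
      · rw [hlf _ h0.1 _ (by omega)]
        exact leaf_le hθ hn _ _
    have := htle _ hlt
    omega
  have hslot : ∀ c < I.K ^ I.q, ∀ m < I.q, I.slot (y c) m = t (dig I.K c m) := by
    intro c hc m hm
    have := hval c hc m (by omega)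
    simp only [val, idx, if_pos hm] at this
    exact this (dig_lt K_pos _ _)
  have hleaf : ∀ c < I.K ^ I.q, ∀ m < I.k, ∃ j < I.K, lf (y c) m = t j := by
    intro c hc m hm
    have := hval c hc (I.q + m) (by omega)
    simp only [val, idx, if_neg (show ¬ I.q + m < I.q by omega), Nat.add_sub_cancel_left] at this
    exact ⟨_, wit_lt _ _, this (wit_lt _ _)⟩
  have hinj : ∀ i < I.k, ∀ j < I.k, i ≠ j → t i ≠ t j := by
    intro i hi j hj hij
    -- Slots `0` and `1` receive the indices `i` and `j` and must hold different tuples; this needs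
    -- `2 ≤ q`.
    obtain ⟨c, hc, hc'⟩ := exists_dig_eq I.K I.q (fun m => if m = 0 then i else j) fun m _ => by
      unfold K
      split_ifs <;> omega
    have hq : 2 ≤ I.q := Nat.le_add_left _ _
    have h0 := hc' 0 (by omega)
    have h1 := hc' 1 (by omega)
    simp only [if_true, one_ne_zero, if_false] at h0 h1
    have := (hfacts₀ c hc 0 K_pos).2.2.1 0 (by omega) 1 (by omega) (by rwa [h0, h1])
    rwa [hslot c hc 0 (by omega), hslot c hc 1 (by omega), h0, h1] at this
  refine ⟨(Finset.range I.k).image t, fun v hv => ?_, ?_, fun x hx => ?_⟩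
  · obtain ⟨j, hj, rfl⟩ := Finset.mem_image.1 hv
    exact htlt j (Finset.mem_range.1 hj)
  · rw [Finset.card_image_of_injOn, Finset.card_range]
    intro i hi j hj heq
    by_contra hij
    exact hinj i (by simpa using hi) j (by simpa using hj) hij heq
  · have hmem : ∀ v, v ∈ (Finset.range I.k).image t ↔ ∃ j < I.k, t j = v := by simp
    -- Atoms outside the solution are sent to the index `k`, whose value `N` is not the code of a
    -- tuple, so they add no tuple to the slots.
    have hidx : ∀ l, ∃ j < I.K, (∀ v, v < I.N → t j = v → v ∈ (Finset.range I.k).image t) ∧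
        (I.atom l x ∈ (Finset.range I.k).image t → t j = I.atom l x) := by
      intro l
      by_cases h : I.atom l x ∈ (Finset.range I.k).image t
      · obtain ⟨j, hj, h'⟩ := (hmem _).1 h
        exact ⟨j, by unfold K; omega, fun v _ hv => (hmem v).2 ⟨j, hj, hv⟩, fun _ => h'⟩
      · exact ⟨I.k, by unfold K; omega, fun v hv hv' => by omega, fun h' => absurd h' h⟩
    choose g hg hgS hgt using hidx
    obtain ⟨c, hc, hc'⟩ := exists_dig_eq I.K I.q g fun m _ => hg m
    have hiff : ∀ l < I.θ.atoms.length, I.slots (y c) (I.atom l x) ↔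
        I.atom l x ∈ (Finset.range I.k).image t := by
      intro l hl
      constructor
      · rintro ⟨i, hi, hi'⟩
        rw [hslot c hc i hi, hc' i hi] at hi'
        exact hgS i _ (atom_lt hθ hn hl x) hi'
      · intro h
        have hlq : l < I.q := by unfold q; omega
        exact ⟨l, hlq, by rw [hslot c hc l hlq, hc' l hlq, hgt l h]⟩
    by_contra hbad
    -- The assignment is unhit for the label of `c`: it violates the formula for the slots, and each
    -- atom of `x` on the branch lies in the solution, hence in the slots.
    refine (hfacts₀ c hc 0 K_pos).2.1 x hx ⟨fun hev => hbad ?_, fun l hl m hm heq => ?_⟩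
    · refine (I.θ.eval_congr_set fun vs hvs => ?_).1 hev
      obtain ⟨l, hl, h⟩ := exists_atomAt_eq (n := I.n) (x := dig I.n x) (d := I.N) hvs
      rw [← h]
      exact hiff l hl
    · obtain ⟨j, hj, h⟩ := hleaf c hc m hm
      have hltN := atom_lt hθ hn hl x
      rw [heq, h] at hltN
      refine (hiff l hl).2 ((hmem _).2 ⟨j, ?_, by rw [heq, h]⟩)
      by_contra hge
      rw [show j = I.k by unfold K at hj; omega, htN] at hltN
      omega

end SatInstance

/-! ### The system of paths is computable in polynomial time -/

namespace RAM

variable {α : Type} {Γ : Ctx α}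

/-- The states of the context `Γ` whose arrays satisfy `Q`. -/
def Ctx.withArr (Γ : Ctx α) (Q : α → (ℕ → ℕ → ℕ) → Prop) : Ctx α where
  rel a σ := Γ.rel a σ ∧ Q a σ.arr
  size := Γ.size
  bound := Γ.bound
  inv a σ σ' h hr ha := ⟨Γ.inv a σ σ' h.1 hr ha, ha ▸ h.2⟩

/-- The states of the context `Γ` whose data satisfy `P`. -/
def Ctx.restrict (Γ : Ctx α) (P : α → Prop) : Ctx α := Γ.withArr fun a _ => P a

lemma Cmp.withArr {f : α → ℕ} (hf : Cmp Γ f) (Q : α → (ℕ → ℕ → ℕ) → Prop) :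
    Cmp (Γ.withArr Q) f :=
  ⟨hf.1, fun d hd => by
    obtain ⟨p, T, hT, hp⟩ := hf.2 d hd
    exact ⟨p, T, hT, fun a σ hσ => hp a σ hσ.1⟩⟩

lemma Cmp.restrict {f : α → ℕ} (hf : Cmp Γ f) (P : α → Prop) : Cmp (Γ.restrict P) f :=
  hf.withArr _

/-- The program for `f` runs only after the test has succeeded, so it may rely on `P`; otherwise the
register already holds `0`. This guards reads outside the controlled memory. -/
lemma Cmp.of_restrict {P : α → Prop} {f : α → ℕ} (hP : CmpP Γ P) (hf : Cmp (Γ.restrict P) f)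
    (h0 : ∀ a, ¬ P a → f a = 0) : Cmp Γ f := by
  refine ⟨hf.1, fun d hd => ?_⟩
  obtain ⟨p, T, hT, hp⟩ := hf.2 d hd
  obtain ⟨p', T', hT', hp'⟩ := hP.2 d hd
  refine ⟨.seq p' (.ite (.reg d) p .skip), fun a => T' a + (T a + 1 + 1),
    hT'.add ((PolyBdd.add hT (.const _ _)).add (.const _ _)), fun a σ hσ => ?_⟩
  refine (hp' a σ hσ).seq fun σ₁ ⟨ha, hr, hv⟩ => Halts.ite (fun he => ?_) fun he => ?_
  · have hPa : P a := by
      by_contra hPa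
      simp [Expr.eval, hv, hPa] at he
    refine (hp a σ₁ ⟨Γ.inv a σ σ₁ hσ (fun i hi => hr i (by omega)) ha, hPa⟩).mono ?_ (by omega)
    rintro σ₂ ⟨ha', hr', hv'⟩
    exact ⟨ha'.trans ha, fun i hi => (hr' i hi).trans (hr i hi), hv'⟩
  · have hPa : ¬ P a := by
      intro hPa
      simp [Expr.eval, hv, hPa] at he
    exact ⟨σ₁, 1, Run.skip _, ⟨ha, hr, he.trans (h0 a hPa).symm⟩, by omega⟩

/-! ### Tables in arrays -/

/-- The array `A` holds the first `len a` entries of the table `T a`. -/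
structure TableIn (Γ : Ctx α) (A : ℕ) (T : α → ℕ → ℕ) (len : α → ℕ) : Prop where
  cmp_len : Cmp Γ len
  spec : ∀ a σ, Γ.rel a σ → ∀ j < len a, σ.arr A j = T a j
  bdd : ∃ H, PolyBdd Γ.bound H ∧ ∀ a, ∀ j < len a, T a j ≤ H a

lemma PolyBdd.weaken {f : α → ℕ} (hf : PolyBdd Γ.bound f) (d : ℕ) (hd : Γ.size ≤ d) :
    PolyBdd (Γ.ext d hd).bound fun p => f p.1 :=
  (PolyBdd.of_le (f := fun p : α × ℕ => Γ.bound p.1) fun _ => Nat.le_add_right _ _).trans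
    (hf.comp Prod.fst)

namespace TableIn

variable {A : ℕ} {T : α → ℕ → ℕ} {len : α → ℕ}

lemma weaken (h : TableIn Γ A T len) (d : ℕ) (hd : Γ.size ≤ d) :
    TableIn (Γ.ext d hd) A (fun p => T p.1) fun p => len p.1 where
  cmp_len := h.cmp_len.weaken d hd
  spec a σ hσ := h.spec a.1 σ hσ.1
  bdd := by
    obtain ⟨H, hH, hle⟩ := h.bdd
    exact ⟨fun p => H p.1, hH.weaken d hd, fun a => hle a.1⟩

lemma read (h : TableIn Γ A T len) {g : α → ℕ} (hg : Cmp Γ g) :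
    Cmp Γ fun a => if g a < len a then T a (g a) else 0 := by
  obtain ⟨H, hH, hle⟩ := h.bdd
  refine Cmp.of_restrict (CmpP.lt hg h.cmp_len)
    (Cmp.read A (hg.restrict _) (hH.mono fun a => ?_) fun a σ hσ => ?_) fun a ha => if_neg ha
  · split_ifs with hlt
    · exact hle a _ hlt
    · exact Nat.zero_le _
  · rw [if_pos hσ.2]
    exact h.spec a σ hσ.1 _ hσ.2

end TableIn

/-- Repeated division avoids the power `b ^ i`, which need not be polynomially bounded. -/
lemma Cmp.dig {b x i : α → ℕ} (hb : Cmp Γ b) (hx : Cmp Γ x) (hi : Cmp Γ i) :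
    Cmp Γ fun a => dig (b a) (x a) (i a) := by
  have key : ∀ a i, Nat.rec (motive := fun _ => ℕ) (x a) (fun _ v => v / b a) i =
      x a / b a ^ i := by
    intro a i
    induction i with
    | zero => simp
    | succ i ih => rw [pow_succ, ← Nat.div_div_eq_div_mul, ← ih]
  refine Cmp.mod ((natRec (step := fun a _ v => v / b a) hx hi
    (fun d hd d' hd' => (last _ _).div ((hb.weaken d hd).weaken d' hd')) hx.1
    fun a i _ => ?_).congr fun a => (key a _).symm) hb
  rw [key]
  exact Nat.div_le_self _ _

end RAM

/-! ### Computability of labels, positions and adjacency -/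

/-- A positive number `n`, a parameter `k` and a word. -/
structure WordData where
  n : ℕ
  k : ℕ
  word : ℕ → ℕ
  pos : 0 < n

/-- The number of bits in the tables of relations with the arities `ars`. -/
def tableLength (ars : List ℕ) (n : ℕ) : ℕ := (ars.map (n ^ ·)).sum

/-- The instance whose bit tables are in the word, behind `n` in unary. -/
def WordData.inst (θ : QF) (s : ℕ) (ars : List ℕ) (x : WordData) : SatInstance :=
  ⟨θ, s, x.n, x.k, fun j => j < tableLength ars x.n ∧ x.word (x.n + 1 + j) ≠ 0⟩

open RAM

lemma RAM.Cmp.tableLength {α : Type} {Γ : Ctx α} {f : α → ℕ} (hf : Cmp Γ f) (ars : List ℕ) :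
    Cmp Γ fun a => tableLength ars (f a) := by
  unfold _root_.tableLength
  induction ars with
  | nil => exact Cmp.const 0
  | cons r o ih => exact ((hf.pow_const r).add ih).congr fun a => by simp

/-- The context gives access to `n`, `k` and the word, and its bound suffices for the number of
branches of the search trees. -/
structure Ready {α : Type} (θ : QF) (s : ℕ) (ars : List ℕ) (Γ : Ctx α) (δ : α → WordData) :
    Prop where
  cmp_n : Cmp Γ fun a => (δ a).n
  cmp_k : Cmp Γ fun a => (δ a).k
  bdd : PolyBdd Γ.bound fun a => ((δ a).inst θ s ars).Z ^ (δ a).k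
  word : ∀ a σ, Γ.rel a σ → ∀ j < tableLength ars (δ a).n,
    σ.arr 0 ((δ a).n + 1 + j) = (δ a).word ((δ a).n + 1 + j)

namespace Ready

variable {α : Type} {θ : QF} {s : ℕ} {ars : List ℕ} {Γ : Ctx α} {δ : α → WordData}

lemma weaken (R : Ready θ s ars Γ δ) (d : ℕ) (hd : Γ.size ≤ d) :
    Ready θ s ars (Γ.ext d hd) fun p => δ p.1 where
  cmp_n := R.cmp_n.weaken d hd
  cmp_k := R.cmp_k.weaken d hd
  bdd := R.bdd.weaken d hd
  word a σ hσ := R.word a.1 σ hσ.1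

lemma withArr (R : Ready θ s ars Γ δ) (Q : α → (ℕ → ℕ → ℕ) → Prop) :
    Ready θ s ars (Γ.withArr Q) δ where
  cmp_n := R.cmp_n.withArr Q
  cmp_k := R.cmp_k.withArr Q
  bdd := R.bdd
  word a σ hσ := R.word a σ hσ.1

lemma cmp_N (R : Ready θ s ars Γ δ) : Cmp Γ fun a => ((δ a).inst θ s ars).N := R.cmp_n.pow_const s

lemma cmp_K (R : Ready θ s ars Γ δ) : Cmp Γ fun a => ((δ a).inst θ s ars).K := R.cmp_k.add (.const 1)

lemma cmp_q : Cmp Γ fun a => ((δ a).inst θ s ars).q := Cmp.const (θ.atoms.length + 2)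

lemma cmp_Z (R : Ready θ s ars Γ δ) : Cmp Γ fun a => ((δ a).inst θ s ars).Z := cmp_q.mul R.cmp_K

lemma cmp_A (R : Ready θ s ars Γ δ) : Cmp Γ fun a => ((δ a).inst θ s ars).A := R.cmp_n.pow_const θ.width

lemma cmp_powN (R : Ready θ s ars Γ δ) :
    Cmp Γ fun a => (((δ a).inst θ s ars).N + 1) ^ ((δ a).inst θ s ars).q :=
  (R.cmp_N.add (.const 1)).pow_const (θ.atoms.length + 2)

/-- The factor `Z ^ k` is not polynomial in `k`; `R.bdd` accounts for it. -/
lemma cmp_D (R : Ready θ s ars Γ δ) : Cmp Γ fun a => ((δ a).inst θ s ars).D :=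
  R.cmp_powN.mul (R.cmp_Z.pow R.cmp_k R.bdd)

variable {b c e g i l m t u v x : α → ℕ}

lemma cmp_slot (R : Ready θ s ars Γ δ) (hb : Cmp Γ b) (hi : Cmp Γ i) :
    Cmp Γ fun a => ((δ a).inst θ s ars).slot (b a) (i a) :=
  (R.cmp_N.add (.const 1)).dig hb hi

lemma cmp_digit (R : Ready θ s ars Γ δ) (hb : Cmp Γ b) (hm : Cmp Γ m) :
    Cmp Γ fun a => ((δ a).inst θ s ars).digit (b a) (m a) :=
  R.cmp_Z.dig (hb.div R.cmp_powN) hm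

lemma cmp_choice (R : Ready θ s ars Γ δ) (hb : Cmp Γ b) (hm : Cmp Γ m) :
    Cmp Γ fun a => ((δ a).inst θ s ars).choice (b a) (m a) :=
  (R.cmp_digit hb hm).mod cmp_q

lemma cmp_wit (R : Ready θ s ars Γ δ) (hb : Cmp Γ b) (hm : Cmp Γ m) :
    Cmp Γ fun a => ((δ a).inst θ s ars).wit (b a) (m a) :=
  (R.cmp_digit hb hm).div cmp_q

lemma cmp_tupleCode (R : Ready θ s ars Γ δ) (hx : Cmp Γ x) (vs : List ℕ) :
    Cmp Γ fun a => tupleCode (δ a).n (dig (δ a).n (x a)) vs := by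
  induction vs with
  | nil => exact Cmp.const 0
  | cons w vs ih => exact (R.cmp_n.dig hx (.const w)).add (R.cmp_n.mul ih)

lemma cmp_atom (R : Ready θ s ars Γ δ) (hl : Cmp Γ l) (hx : Cmp Γ x) :
    Cmp Γ fun a => ((δ a).inst θ s ars).atom (l a) (x a) := by
  have key : ∀ as : List (List ℕ), ∀ l, Cmp Γ l →
      Cmp Γ fun a => atomAt (δ a).n (dig (δ a).n (x a)) ((δ a).inst θ s ars).N as (l a) := by
    intro as
    induction as with
    | nil => exact fun l _ => R.cmp_N
    | cons vs as ih =>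
      exact fun l hl => Cmp.ite (CmpP.eq hl (.const 0)) (R.cmp_tupleCode hx vs)
        (ih (fun a => l a - 1) (hl.sub (.const 1)))
  exact key θ.atoms l hl

lemma cmp_slots (R : Ready θ s ars Γ δ) (hb : Cmp Γ b) (ht : Cmp Γ t) :
    CmpP Γ fun a => ((δ a).inst θ s ars).slots (b a) (t a) :=
  CmpP.bex (P := fun a i => ((δ a).inst θ s ars).slot (b a) i = t a) cmp_q fun d hd =>
    CmpP.eq ((R.weaken d hd).cmp_slot (hb.weaken d hd) (.last d hd)) (ht.weaken d hd)

lemma cmp_eval (R : Ready θ s ars Γ δ) (hx : Cmp Γ x) {X : α → ℕ → Prop}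
    (hX : ∀ t, Cmp Γ t → CmpP Γ fun a => X a (t a)) (η : QF) :
    CmpP Γ fun a => η.eval (δ a).n ((δ a).inst θ s ars).tab (dig (δ a).n (x a)) (X a) := by
  induction η with
  | fls => exact CmpP.const False
  | eq i j => exact CmpP.eq (R.cmp_n.dig hx (.const i)) (R.cmp_n.dig hx (.const j))
  | rel o vs =>
    set g : α → ℕ := fun a => (o.map ((δ a).n ^ ·)).sum +
      tupleCode (δ a).n (dig (δ a).n (x a)) vs with hg
    have hgc : Cmp Γ g := (R.cmp_n.tableLength o).add (R.cmp_tupleCode hx vs)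
    have hlt : CmpP Γ fun a => g a < tableLength ars (δ a).n := CmpP.lt hgc (R.cmp_n.tableLength ars)
    -- Cells behind the tables may contain anything, so the index is tested before the cell is read.
    refine Cmp.of_restrict hlt ?_ fun a ha => if_neg fun h => ha h.1
    refine CmpP.and (hlt.restrict _) (CmpP.read_ne_zero 0 (T := fun a => (δ a).word)
      (g := fun a => (δ a).n + 1 + g a) (((R.cmp_n.add (.const 1)).add hgc).restrict _)
      fun a σ hσ => R.word a σ hσ.1 _ hσ.2)
  | mem vs => exact hX _ (R.cmp_tupleCode hx vs)
  | imp η₁ η₂ ih₁ ih₂ => exact ih₁.imp ih₂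

/-- Look up the entry `(b, m)` in a table with `k` columns. -/
def _root_.lookup (T : ℕ → ℕ) (len k b m : ℕ) : ℕ :=
  if b * k + m < len then T (b * k + m) else 0

variable {A : ℕ} {T : α → ℕ → ℕ} {len : α → ℕ}

lemma cmp_lookup (R : Ready θ s ars Γ δ) (hT : TableIn Γ A T len) (hb : Cmp Γ b) (hm : Cmp Γ m) :
    Cmp Γ fun a => lookup (T a) (len a) (δ a).k (b a) (m a) :=
  hT.read ((hb.mul R.cmp_k).add hm)

lemma cmp_unhit (R : Ready θ s ars Γ δ) (hT : TableIn Γ A T len) (hb : Cmp Γ b) (hm : Cmp Γ m)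
    (hx : Cmp Γ x) :
    CmpP Γ fun a => ((δ a).inst θ s ars).unhit (((δ a).inst θ s ars).slots (b a))
      (lookup (T a) (len a) (δ a).k (b a)) (m a) (x a) := by
  refine CmpP.and (R.cmp_eval hx (fun t ht => R.cmp_slots hb ht) θ).not
    (CmpP.ball (P := fun a l => ∀ m' < m a, ((δ a).inst θ s ars).atom l (x a) =
      lookup (T a) (len a) (δ a).k (b a) m' →
      ((δ a).inst θ s ars).slots (b a) (((δ a).inst θ s ars).atom l (x a)))
      (.const θ.atoms.length) fun d hd => ?_)
  refine CmpP.ball (P := fun p m' => ((δ p.1).inst θ s ars).atom p.2 (x p.1) =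
      lookup (T p.1) (len p.1) (δ p.1).k (b p.1) m' →
      ((δ p.1).inst θ s ars).slots (b p.1) (((δ p.1).inst θ s ars).atom p.2 (x p.1)))
      (hm.weaken d hd) fun d' hd' => ?_
  have R' := (R.weaken d hd).weaken d' hd'
  have hat := R'.cmp_atom ((Cmp.last d hd).weaken d' hd') ((hx.weaken d hd).weaken d' hd')
  have hb' := (hb.weaken d hd).weaken d' hd'
  exact CmpP.imp (CmpP.eq hat (R'.cmp_lookup ((hT.weaken d hd).weaken d' hd') hb' (.last _ _)))
    (R'.cmp_slots hb' hat)

/-- With the lower levels in the table, one level of the search tree needs no recursion. -/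
lemma cmp_step (R : Ready θ s ars Γ δ) (hT : TableIn Γ A T len) (hb : Cmp Γ b) (hm : Cmp Γ m) :
    Cmp Γ fun a => ((δ a).inst θ s ars).step (fun m _ => ((δ a).inst θ s ars).choice (b a) m)
      (((δ a).inst θ s ars).slots (b a)) (lookup (T a) (len a) (δ a).k (b a)) (m a) := by
  have hf : Cmp Γ fun a => RAM.first ((δ a).inst θ s ars).A (((δ a).inst θ s ars).unhit
      (((δ a).inst θ s ars).slots (b a)) (lookup (T a) (len a) (δ a).k (b a)) (m a)) :=
    Cmp.first R.cmp_A fun d hd => (R.weaken d hd).cmp_unhit (hT.weaken d hd) (hb.weaken d hd)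
      (hm.weaken d hd) (.last d hd)
  exact Cmp.ite (CmpP.lt hf R.cmp_A) (R.cmp_atom (R.cmp_choice hb hm) hf) R.cmp_N

lemma cmp_complete (R : Ready θ s ars Γ δ) (hT : TableIn Γ A T len) (hb : Cmp Γ b) :
    CmpP Γ fun a => ((δ a).inst θ s ars).complete (((δ a).inst θ s ars).slots (b a))
      (lookup (T a) (len a) (δ a).k (b a)) :=
  CmpP.ball (P := fun a x => ¬ ((δ a).inst θ s ars).unhit (((δ a).inst θ s ars).slots (b a))
    (lookup (T a) (len a) (δ a).k (b a)) (δ a).k x) R.cmp_A fun d hd =>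
    ((R.weaken d hd).cmp_unhit (hT.weaken d hd) (hb.weaken d hd) (R.weaken d hd).cmp_k
      (.last d hd)).not

lemma cmp_val (R : Ready θ s ars Γ δ) (hT : TableIn Γ A T len) (hb : Cmp Γ b) (hm : Cmp Γ m) :
    Cmp Γ fun a => ((δ a).inst θ s ars).val (lookup (T a) (len a) (δ a).k) (b a) (m a) :=
  Cmp.ite (CmpP.lt hm cmp_q) (R.cmp_slot hb hm) (R.cmp_lookup hT hb (hm.sub cmp_q))

lemma cmp_idx (R : Ready θ s ars Γ δ) (hc : Cmp Γ c) (hb : Cmp Γ b) (hm : Cmp Γ m) :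
    Cmp Γ fun a => ((δ a).inst θ s ars).idx (c a) (b a) (m a) :=
  Cmp.ite (CmpP.lt hm cmp_q) (R.cmp_K.dig hc hm) (R.cmp_wit hb (hm.sub cmp_q))

lemma cmp_leftOk (R : Ready θ s ars Γ δ) (hT : TableIn Γ A T len) (he : Cmp Γ e) (hi : Cmp Γ i)
    (hb : Cmp Γ b) :
    CmpP Γ fun a => ((δ a).inst θ s ars).leftOk (lookup (T a) (len a) (δ a).k) (e a) (i a) (b a) := by
  have hc : Cmp Γ fun a => e a / 2 / ((δ a).inst θ s ars).K := (he.div (.const 2)).div R.cmp_K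
  have hj : Cmp Γ fun a => e a / 2 % ((δ a).inst θ s ars).K := (he.div (.const 2)).mod R.cmp_K
  refine (R.cmp_complete hT hb).and (CmpP.and ?_ (CmpP.and
    (CmpP.le hi (((Cmp.const 2).mul R.cmp_N).add (.const 1))) ?_))
  · refine CmpP.ball (P := fun a m => ∀ m' < ((δ a).inst θ s ars).q,
      dig ((δ a).inst θ s ars).K (e a / 2 / ((δ a).inst θ s ars).K) m ≠
      dig ((δ a).inst θ s ars).K (e a / 2 / ((δ a).inst θ s ars).K) m' →
      ((δ a).inst θ s ars).slot (b a) m ≠ ((δ a).inst θ s ars).slot (b a) m') cmp_q fun d hd => ?_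
    refine CmpP.ball (P := fun (p : α × ℕ) m' =>
      dig ((δ p.1).inst θ s ars).K (e p.1 / 2 / ((δ p.1).inst θ s ars).K) p.2 ≠
      dig ((δ p.1).inst θ s ars).K (e p.1 / 2 / ((δ p.1).inst θ s ars).K) m' →
      ((δ p.1).inst θ s ars).slot (b p.1) p.2 ≠ ((δ p.1).inst θ s ars).slot (b p.1) m') cmp_q
      fun d' hd' => ?_
    have R' := (R.weaken d hd).weaken d' hd'
    have hc' := (hc.weaken d hd).weaken d' hd'
    have hb' := (hb.weaken d hd).weaken d' hd'
    have hm := (Cmp.last d hd).weaken d' hd'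
    exact (CmpP.ne (R'.cmp_K.dig hc' hm) (R'.cmp_K.dig hc' (.last _ _))).imp
      (CmpP.ne (R'.cmp_slot hb' hm) (R'.cmp_slot hb' (.last _ _)))
  · refine CmpP.ball (P := fun a m =>
      ((δ a).inst θ s ars).idx (e a / 2 / ((δ a).inst θ s ars).K) (b a) m =
        e a / 2 % ((δ a).inst θ s ars).K →
      i a ≤ 2 * (if e a % 2 = 0 then ((δ a).inst θ s ars).val (lookup (T a) (len a) (δ a).k) (b a) m
        else ((δ a).inst θ s ars).N - ((δ a).inst θ s ars).val (lookup (T a) (len a) (δ a).k) (b a) m) + 1)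
      (cmp_q.add R.cmp_k) fun d hd => ?_
    have R' := R.weaken d hd
    have hv := R'.cmp_val (hT.weaken d hd) (hb.weaken d hd) (.last d hd)
    exact (CmpP.eq (R'.cmp_idx (hc.weaken d hd) (hb.weaken d hd) (.last d hd))
      (hj.weaken d hd)).imp (CmpP.le (hi.weaken d hd) (((Cmp.const 2).mul
      (Cmp.ite (CmpP.eq ((he.weaken d hd).mod (.const 2)) (.const 0)) hv
        (R'.cmp_N.sub hv))).add (.const 1)))

lemma cmp_rightOk (R : Ready θ s ars Γ δ) (he : Cmp Γ e) (hi : Cmp Γ i) (ht : Cmp Γ t) :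
    CmpP Γ fun a => ((δ a).inst θ s ars).rightOk (e a) (i a) (t a) := by
  have hj : Cmp Γ fun a => e a / 2 % ((δ a).inst θ s ars).K := (he.div (.const 2)).mod R.cmp_K
  exact ((CmpP.lt hj R.cmp_k).imp (CmpP.lt ht R.cmp_N)).and
    (((CmpP.eq hj R.cmp_k).imp (CmpP.eq ht R.cmp_N)).and (CmpP.le (((Cmp.const 2).mul
      (Cmp.ite (CmpP.eq (he.mod (.const 2)) (.const 0)) ht (R.cmp_N.sub ht))).add (.const 2)) hi))

lemma cmp_M (R : Ready θ s ars Γ δ) :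
    Cmp Γ fun a => (((δ a).inst θ s ars).paths (lookup (T a) (len a) (δ a).k)).M :=
  ((R.cmp_K.pow_const (θ.atoms.length + 2)).mul R.cmp_K).mul (.const 2)

lemma cmp_W (R : Ready θ s ars Γ δ) :
    Cmp Γ fun a => (((δ a).inst θ s ars).paths (lookup (T a) (len a) (δ a).k)).W :=
  ((Cmp.const 2).mul R.cmp_N).add (.const 4)

lemma cmp_L (R : Ready θ s ars Γ δ) :
    Cmp Γ fun a => (((δ a).inst θ s ars).paths (lookup (T a) (len a) (δ a).k)).L :=
  (R.cmp_D.add R.cmp_N).add (.const 1)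

lemma cmp_Al (R : Ready θ s ars Γ δ) (hT : TableIn Γ A T len) (he : Cmp Γ e) (hi : Cmp Γ i)
    (hb : Cmp Γ b) :
    CmpP Γ fun a => (((δ a).inst θ s ars).paths (lookup (T a) (len a) (δ a).k)).Al
      (e a) (i a) (b a) :=
  ((CmpP.lt hb R.cmp_D).and (R.cmp_leftOk hT he hi hb)).or
    ((CmpP.le R.cmp_D hb).and (R.cmp_rightOk he hi (hb.sub R.cmp_D)))

lemma cmp_adj (R : Ready θ s ars Γ δ) (hu : Cmp Γ u) (hv : Cmp Γ v) :
    CmpP Γ fun a => (((δ a).inst θ s ars).paths (lookup (T a) (len a) (δ a).k)).adj (u a) (v a) := by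
  have hW := R.cmp_W (T := T) (len := len)
  have hx := hu.div (.const 3)
  have hy := hv.div (.const 3)
  have hlv : ∀ {w : α → ℕ}, Cmp Γ w → Cmp Γ fun a =>
      (((δ a).inst θ s ars).paths (lookup (T a) (len a) (δ a).k)).lv (w a) := fun hw =>
    (hw.div (.const 2)).div R.cmp_K
  have hrv : ∀ {w : α → ℕ}, Cmp Γ w → Cmp Γ fun a =>
      (((δ a).inst θ s ars).paths (lookup (T a) (len a) (δ a).k)).rv (w a) := fun hw =>
    (hw.div (.const 2)).mod R.cmp_K
  refine ((CmpP.eq hx hy).and (CmpP.ne hu hv)).or ((CmpP.eq (hu.mod (.const 3)) (.const 0)).and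
    ((CmpP.eq (hv.mod (.const 3)) (.const 0)).and (CmpP.or ?_ (CmpP.or ?_ ?_))))
  · exact (CmpP.eq (hx.div hW) (hy.div hW)).and ((CmpP.eq (hx.add (.const 1)) hy).or
      (CmpP.eq (hy.add (.const 1)) hx))
  · exact (CmpP.ne hx hy).and ((CmpP.eq (hx.mod hW) (.const 0)).and
      ((CmpP.eq (hy.mod hW) (.const 0)).and (CmpP.eq (hlv (hx.div hW)) (hlv (hy.div hW)))))
  · exact (CmpP.ne hx hy).and ((CmpP.eq ((hx.mod hW).add (.const 1)) hW).and
      ((CmpP.eq ((hy.mod hW).add (.const 1)) hW).and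
      (CmpP.eq (hrv (hx.div hW)) (hrv (hy.div hW)))))

lemma cmp_next (R : Ready θ s ars Γ δ) (hT : TableIn Γ A T len) (hu : Cmp Γ u) (hv : Cmp Γ v)
    (hb : Cmp Γ b) :
    Cmp Γ fun a => (((δ a).inst θ s ars).paths (lookup (T a) (len a) (δ a).k)).next
      (u a) (v a) (b a) := by
  classical
  have hW := R.cmp_W (T := T) (len := len)
  have hx := hu.div (.const 3)
  have hy := hv.div (.const 3)
  refine Cmp.ite (CmpP.and (CmpP.eq hx hy) (CmpP.and (CmpP.eq ((hu.mod (.const 3)).add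
    (hv.mod (.const 3))) (.const 2)) (R.cmp_Al hT (hx.div hW) (hx.mod hW) (hb.div (.const 2))).not))
    (Cmp.ite (CmpP.eq (hb.mod (.const 2)) (.const 0)) (hb.add (.const 1)) (hb.sub (.const 1))) hb

end Ready

/-! ### Words that encode instances -/

namespace List

lemma map_range_append {β : Type} (a b : ℕ) (f g : ℕ → β) :
    (range a).map f ++ (range b).map g =
      (range (a + b)).map fun i => if i < a then f i else g (i - a) := by
  rw [range_add, map_append, map_map]
  congr 1
  · exact map_congr_left fun i hi => by rw [if_pos (mem_range.1 hi)]
  · exact map_congr_left fun i _ => by simp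

/-- Nested lists become one list addressed by quotients and remainders, which a single loop can
write. -/
lemma flatMap_range_map_range {β : Type} (n m : ℕ) (f : ℕ → ℕ → β) :
    ((range n).flatMap fun u => (range m).map (f u)) =
      (range (n * m)).map fun i => f (i / m) (i % m) := by
  rcases Nat.eq_zero_or_pos m with rfl | hm
  · simp
  induction n with
  | zero => simp
  | succ n ih =>
    rw [range_succ, flatMap_append, ih, flatMap_singleton, add_mul, one_mul, range_add, map_append,
      map_map]
    congr 1
    refine map_congr_left fun i hi => ?_
    have hi := mem_range.1 hi
    simp only [Function.comp]
    rw [mul_comm n m, Nat.mul_add_div hm, Nat.mul_add_mod, Nat.div_eq_of_lt hi,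
      Nat.mod_eq_of_lt hi, add_zero]

lemma flatMap_inj_of_length {ι β : Type} {f g : ι → List β} (hlen : ∀ u, (f u).length = (g u).length)
    {l : List ι} (h : l.flatMap f = l.flatMap g) : ∀ u ∈ l, f u = g u := by
  induction l with
  | nil => simp
  | cons u l ih =>
    rw [flatMap_cons, flatMap_cons] at h
    obtain ⟨h1, h2⟩ := append_inj h (hlen u)
    intro v hv
    rcases mem_cons.1 hv with rfl | hv
    · exact h1
    · exact ih h2 v hv

lemma replicate_append_cons_inj {n n' : ℕ} {l l' : List Bool}
    (h : replicate n true ++ false :: l = replicate n' true ++ false :: l') :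
    n = n' ∧ l = l' := by
  induction n generalizing n' with
  | zero =>
    cases n' with
    | zero => simpa using h
    | succ n' => simp [replicate_succ] at h
  | succ n ih =>
    cases n' with
    | zero => simp [replicate_succ] at h
    | succ n' =>
      simp only [replicate_succ, cons_append, cons.injEq, true_and] at h
      obtain ⟨h1, h2⟩ := ih h
      exact ⟨by rw [h1], h2⟩

lemma map_finRange {β : Type} {n : ℕ} {f : Fin n → β} (g : ℕ → β) (h : ∀ i, f i = g i) :
    (finRange n).map f = (range n).map g := by
  rw [← List.map_coe_finRange_eq_range, map_map]
  exact map_congr_left fun i _ => h i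

lemma flatMap_finRange {β : Type} {n : ℕ} {f : Fin n → List β} (g : ℕ → List β)
    (h : ∀ i, f i = g i) : (finRange n).flatMap f = (range n).flatMap g := by
  rw [← List.map_coe_finRange_eq_range, flatMap_map]
  exact congrArg (fun f => flatMap f (finRange n)) (funext h)

end List

namespace ULC

/-- The word of an instance determines its solvability. -/
lemma NodeSolvable.of_encode_eq {I I' : ULC} {k : ℕ} (h : I.NodeSolvable k)
    (he : I.encode = I'.encode) : I'.NodeSolvable k := by
  classical
  obtain ⟨n, s, G, φ, ψ, hp, hr⟩ := I
  obtain ⟨n', s', G', φ', ψ', hp', hr'⟩ := I'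
  obtain ⟨hn, he⟩ := List.replicate_append_cons_inj he
  obtain ⟨hs, he⟩ := List.replicate_append_cons_inj he
  simp only at hn hs he
  subst hn hs
  obtain ⟨he, hψ⟩ := List.append_inj he (by simp)
  obtain ⟨hG, hφ⟩ := List.append_inj he (by simp)
  have hG' : ∀ u v, G.Adj u v ↔ G'.Adj u v := fun u v => by
    have h1 := List.flatMap_inj_of_length (by simp) hG u (List.mem_finRange u)
    have h2 := List.map_inj_left.1 h1 v (List.mem_finRange v)
    simpa using h2
  have hφ' : ∀ v a, a ∈ φ v ↔ a ∈ φ' v := fun v a => by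
    have h1 := List.flatMap_inj_of_length (by simp) hφ v (List.mem_finRange v)
    have h2 := List.map_inj_left.1 h1 a (List.mem_finRange a)
    simpa using h2
  -- The word records constraints only on adjacent pairs; solvability consults no others.
  have hψ' : ∀ u v a b, G.Adj u v ∧ (a, b) ∈ ψ u v ↔ G'.Adj u v ∧ (a, b) ∈ ψ' u v :=
    fun u v a b => by
      have h1 := List.flatMap_inj_of_length (by simp) hψ u (List.mem_finRange u)
      have h2 := List.flatMap_inj_of_length (by simp) h1 v (List.mem_finRange v)
      have h3 := List.flatMap_inj_of_length (by simp) h2 a (List.mem_finRange a)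
      have h4 := List.map_inj_left.1 h3 b (List.mem_finRange b)
      exact decide_eq_decide.1 h4
  obtain ⟨X, lab, hX, hlab, hsat⟩ := h
  exact ⟨X, lab, hX, fun v => (hφ' v _).1 (hlab v), fun u v huv =>
    ((hψ' u v _ _).1 ⟨(hG' u v).2 huv, hsat u v ((hG' u v).2 huv)⟩).2⟩

/-- So the empty word, the output on malformed inputs, is a no-instance. -/
lemma encode_ne_nil (I : ULC) : I.encode ≠ [] := by simp [encode]

end ULC

/-- Words as a length and a predicate on the positions. -/
structure BitWord where
  len : ℕ
  bit : ℕ → Prop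

namespace BitWord

open Classical in
noncomputable def toList (w : BitWord) : List Bool := (List.range w.len).map fun i => decide (w.bit i)

def append (v w : BitWord) : BitWord where
  len := v.len + w.len
  bit i := (i < v.len ∧ v.bit i) ∨ (v.len ≤ i ∧ w.bit (i - v.len))

def ones (n : ℕ) : BitWord := ⟨n, fun _ => True⟩

def zero : BitWord := ⟨1, fun _ => False⟩

lemma toList_append (v w : BitWord) : (v.append w).toList = v.toList ++ w.toList := by
  classical
  unfold toList
  rw [List.map_range_append]
  refine List.map_congr_left fun i _ => ?_
  by_cases h : i < v.len
  · simp [append, h, not_le.2 h]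
  · simp [append, h, not_lt.1 h]

lemma toList_ones (n : ℕ) : (ones n).toList = List.replicate n true := by
  unfold toList ones
  simp only [decide_true, List.map_const', List.length_range]

lemma toList_zero : zero.toList = [false] := by
  unfold toList zero
  simp only [decide_false, List.map_const', List.length_range, List.replicate_one]

lemma length_toList (w : BitWord) : w.toList.length = w.len := by simp [toList]

lemma getD_toList {w : BitWord} {i : ℕ} (h : i < w.len) : w.toList.getD i false = true ↔ w.bit i := by
  rw [List.getD_eq_getElem _ _ (by rwa [length_toList])]
  simp [toList]

end BitWord

namespace PathSystem

variable (P : PathSystem)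

def adjWord : BitWord where
  len := P.M * P.W * 3 * (P.M * P.W * 3)
  bit i := P.adj (i / (P.M * P.W * 3)) (i % (P.M * P.W * 3))

/-- The position is split in mixed radix into two vertices and two labels. -/
def constraintWord : BitWord where
  len := P.M * P.W * 3 * (P.M * P.W * 3 * (2 * P.L * (2 * P.L)))
  bit i :=
    P.adj (i / (P.M * P.W * 3 * (2 * P.L * (2 * P.L))))
      (i % (P.M * P.W * 3 * (2 * P.L * (2 * P.L))) / (2 * P.L * (2 * P.L))) ∧
    P.next (i / (P.M * P.W * 3 * (2 * P.L * (2 * P.L))))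
      (i % (P.M * P.W * 3 * (2 * P.L * (2 * P.L))) / (2 * P.L * (2 * P.L)))
      (i % (P.M * P.W * 3 * (2 * P.L * (2 * P.L))) % (2 * P.L * (2 * P.L)) / (2 * P.L)) =
    i % (P.M * P.W * 3 * (2 * P.L * (2 * P.L))) % (2 * P.L * (2 * P.L)) % (2 * P.L)

/-- The word that encodes the instance. -/
def word : BitWord :=
  (BitWord.ones (P.M * P.W * 3)).append (BitWord.zero.append ((BitWord.ones (2 * P.L)).append
    (BitWord.zero.append ((P.adjWord.append (BitWord.ones (P.M * P.W * 3 * (2 * P.L)))).append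
      P.constraintWord))))

lemma toList_word : P.word.toList = P.ulc.encode := by
  classical
  have h1 : P.adjWord.toList = (List.finRange P.ulc.n).flatMap fun u =>
      (List.finRange P.ulc.n).map fun v => decide (P.ulc.G.Adj u v) := by
    refine Eq.trans ?_ (List.flatMap_finRange
      (fun u => (List.range P.ulc.n).map fun v => decide (P.adj u v))
      fun u => List.map_finRange (fun v => decide (P.adj u v)) fun v => rfl).symm
    rw [List.flatMap_range_map_range]
    exact List.map_congr_left fun i _ => decide_eq_decide.2 Iff.rfl
  have h2 : (BitWord.ones (P.M * P.W * 3 * (2 * P.L))).toList = (List.finRange P.ulc.n).flatMap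
      fun v => (List.finRange P.ulc.s).map fun a => decide (a ∈ P.ulc.φ v) := by
    symm
    refine Eq.trans (List.flatMap_finRange (fun _ => (List.range P.ulc.s).map fun _ => true) ?_) ?_
    · intro u
      refine List.map_finRange (fun _ => true) ?_
      exact fun v => decide_eq_true trivial
    rw [List.flatMap_range_map_range, BitWord.toList_ones]
    simp only [List.map_const', List.length_range]
    rfl
  have h3 : P.constraintWord.toList = (List.finRange P.ulc.n).flatMap fun u =>
      (List.finRange P.ulc.n).flatMap fun v => (List.finRange P.ulc.s).flatMap fun a =>
        (List.finRange P.ulc.s).map fun b =>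
          decide (P.ulc.G.Adj u v ∧ (a, b) ∈ P.ulc.ψ u v) := by
    symm
    refine Eq.trans (List.flatMap_finRange (fun u => (List.range P.ulc.n).flatMap fun v =>
      (List.range P.ulc.s).flatMap fun a => (List.range P.ulc.s).map fun b =>
        decide (P.adj u v ∧ P.next u v a = b)) fun u => ?_) ?_
    · refine List.flatMap_finRange _ fun v => List.flatMap_finRange _ fun a =>
        List.map_finRange (fun b => decide (P.adj u v ∧ P.next u v a = b)) ?_
      exact fun b => decide_eq_decide.2 Iff.rfl
    simp only [List.flatMap_range_map_range]
    exact List.map_congr_left fun i _ => decide_eq_decide.2 Iff.rfl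
  rw [word, BitWord.toList_append, BitWord.toList_append, BitWord.toList_append,
    BitWord.toList_append, BitWord.toList_append, BitWord.toList_append, h1, h2, h3,
    BitWord.toList_ones, BitWord.toList_ones, BitWord.toList_zero, ULC.encode]
  rfl

end PathSystem

/-! ### The program that computes the system of paths -/

namespace RAM

variable {α β : Type} {Γ : Ctx α}

lemma Cmp.comap {Γ' : Ctx β} {f : α → ℕ} (hf : Cmp Γ f) (φ : β → α)
    (hrel : ∀ b σ, Γ'.rel b σ → Γ.rel (φ b) σ) (hsize : Γ.size ≤ Γ'.size)
    (hbound : ∀ b, Γ.bound (φ b) ≤ Γ'.bound b) : Cmp Γ' fun b => f (φ b) := by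
  have hB : PolyBdd Γ'.bound fun b => Γ.bound (φ b) := .of_le hbound
  refine ⟨hB.trans (hf.1.comp φ), fun d hd => ?_⟩
  obtain ⟨p, T, hT, hp⟩ := hf.2 d (hsize.trans hd)
  exact ⟨p, fun b => T (φ b), hB.trans (hT.comp φ), fun b σ hσ => hp _ σ (hrel b σ hσ)⟩

/-- A local variable: the value of `g` stays in register `d` while `f` treats it as part of the
data. -/
lemma Cmp.bind {g : α → ℕ} {f : α → ℕ → ℕ} (hg : Cmp Γ g)
    (hf : ∀ d hd, Cmp (Γ.ext d hd) fun p => f p.1 p.2) : Cmp Γ fun a => f a (g a) := by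
  obtain ⟨H, hH, hle⟩ := PolyBdd.exists_le_of_le (hf Γ.size le_rfl).1 hg.1
  refine ⟨hH.mono fun a => hle a _ le_rfl, fun d hd => ?_⟩
  obtain ⟨p, T, hT, hp⟩ := hg.2 d hd
  obtain ⟨p', T', hT', hp'⟩ := (hf d hd).2 (d + 1) (le_refl (d + 1))
  obtain ⟨H', hH', hle'⟩ := PolyBdd.exists_le_of_le hT' hg.1
  refine ⟨.seq p (.seq p' (.assign d (.reg (d + 1)))), fun a => T a + (H' a + 1),
    hT.add (hH'.add (.const _ _)), fun a σ hσ => ?_⟩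
  refine (hp a σ hσ).seq fun σ₁ ⟨ha, hr, hv⟩ => ?_
  refine ((hp' (a, g a) σ₁ ⟨Γ.inv a σ σ₁ hσ (fun i hi => hr i (by omega)) ha, hv⟩).mono
    (fun _ h => h) (hle' a _ le_rfl)).seq fun σ₂ ⟨ha', hr', hv'⟩ =>
    Halts.assign ⟨ha'.trans ha, fun i hi => ?_, ?_⟩
  · rw [← hr i hi, ← hr' i (by omega)]
    exact Function.update_of_ne hi.ne _ _
  · simp [Expr.eval, hv']

/-- The length of the word and its bits are computable. -/
def CmpW (Γ : Ctx α) (w : α → BitWord) : Prop :=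
  Cmp Γ (fun a => (w a).len) ∧ ∀ d hd, CmpP (Γ.ext d hd) fun p => (w p.1).bit p.2

namespace CmpW

lemma ones {n : α → ℕ} (hn : Cmp Γ n) : CmpW Γ fun a => BitWord.ones (n a) :=
  ⟨hn, fun _ _ => CmpP.const True⟩

lemma zero : CmpW Γ fun _ => BitWord.zero := ⟨Cmp.const 1, fun _ _ => CmpP.const False⟩

lemma append {v w : α → BitWord} (hv : CmpW Γ v) (hw : CmpW Γ w) :
    CmpW Γ fun a => (v a).append (w a) := by
  classical
  refine ⟨hv.1.add hw.1, fun d hd => ?_⟩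
  have hlen := hv.1.weaken d hd
  refine ((CmpP.lt (.last d hd) hlen).and (hv.2 d hd)).or ((CmpP.le hlen (.last d hd)).and ?_)
  refine Cmp.bind (f := fun p j => if (w p.1).bit j then 1 else 0) ((Cmp.last d hd).sub hlen)
    fun d' hd' => ?_
  have hd'' : d + 1 ≤ d' := hd'
  exact (hw.2 d' (by omega)).comap (fun r : (α × ℕ) × ℕ => (r.1.1, r.2))
    (fun r σ h => ⟨h.1.1, h.2⟩) le_rfl
    fun r => Nat.add_le_add_right (Nat.le_add_right (Γ.bound r.1.1) r.1.2) r.2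

end CmpW

/-- Filling an array with a table whose entries are computable from the preceding ones. -/
lemma exists_fill (A : ℕ) {len : α → ℕ} {T : α → ℕ → ℕ}
    (hinv : ∀ a σ σ', Γ.rel a σ → (∀ i < Γ.size, σ'.reg i = σ.reg i) →
      (∀ B ≠ A, σ'.arr B = σ.arr B) → Γ.rel a σ')
    (hlen : Cmp Γ len)
    (hT : ∀ d hd, Cmp ((Γ.ext d hd).withArr fun p arr =>
      p.2 < len p.1 ∧ ∀ j < p.2, arr A j = T p.1 j) fun p => T p.1 p.2) :
    ∃ (p : Prog) (Tm : α → ℕ), PolyBdd Γ.bound Tm ∧ ∀ a σ, Γ.rel a σ → Halts p σ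
      (fun σ' => (∀ i < Γ.size, σ'.reg i = σ.reg i) ∧ (∀ B ≠ A, σ'.arr B = σ.arr B) ∧
        ∀ j < len a, σ'.arr A j = T a j) (Tm a) := by
  set s := Γ.size with hs
  obtain ⟨pl, Tl, hTl, hpl⟩ := hlen.2 (s + 1) (by omega)
  obtain ⟨pb, Tb, hTb, hpb⟩ := (hT s le_rfl).2 (s + 2) (Nat.le_succ (s + 1))
  obtain ⟨H, hH, hle⟩ := PolyBdd.exists_le_of_le hTb hlen.1
  -- Register `s` holds the index, `s + 1` the length and `s + 2` the entry to be written.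
  refine ⟨.seq pl (.seq (.assign s (.lit 0)) (.loop (.sub (.reg (s + 1)) (.reg s))
    (.seq pb (.seq (.write A (.reg s) (.reg (s + 2))) (.assign s (.add (.reg s) (.lit 1))))))),
    fun a => Tl a + (1 + (len a * (H a + 2 + 1) + 1)), hTl.add ((PolyBdd.const _ _).add
      ((hlen.1.mul ((hH.add (.const _ _)).add (.const _ _))).add (.const _ _))), fun a σ hσ => ?_⟩
  refine (hpl a σ hσ).seq fun σ₁ ⟨ha₁, hr₁, hv₁⟩ => ?_
  let Inv : ℕ → State → Prop := fun i τ => (∀ x < s, τ.reg x = σ.reg x) ∧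
    (∀ B ≠ A, τ.arr B = σ.arr B) ∧ τ.reg s = i ∧ τ.reg (s + 1) = len a ∧
    ∀ j < i, τ.arr A j = T a j
  refine Halts.seq (Q := Inv 0) (Halts.assign ⟨fun x hx => ?_, fun B _ => ?_, ?_, ?_,
    fun j hj => by omega⟩) fun σ₂ hσ₂ => ?_
  · rw [← hr₁ x (by omega)]
    exact Function.update_of_ne hx.ne _ _
  · rw [← ha₁]
  · simp [Expr.eval]
  · simp [hv₁]
  refine (Halts.loop Inv (len a) (H a + 2) ?_ ?_ hσ₂).mono
    (fun τ ⟨h1, h2, _, _, h5⟩ => ⟨h1, h2, h5⟩) le_rfl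
  · rintro i hi τ ⟨tr, ta, ti, tl, tT⟩
    refine ⟨by simp [Expr.eval, ti, tl]; omega, ?_⟩
    have hrel : ((Γ.ext s le_rfl).withArr fun p arr =>
        p.2 < len p.1 ∧ ∀ j < p.2, arr A j = T p.1 j).rel (a, i) τ :=
      ⟨⟨hinv a σ τ hσ tr ta, ti⟩, hi, tT⟩
    refine ((hpb (a, i) τ hrel).mono (fun _ h => h) (hle a i hi.le)).seq (T₂ := 2)
      fun τ₁ ⟨ua, ur, uv⟩ => ?_
    refine Halts.seq (T₁ := 1) (T₂ := 1) (Q := fun τ' => (∀ x < s, τ'.reg x = σ.reg x) ∧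
      (∀ B ≠ A, τ'.arr B = σ.arr B) ∧ τ'.reg s = i ∧ τ'.reg (s + 1) = len a ∧
      ∀ j < i + 1, τ'.arr A j = T a j) (Halts.write ⟨fun x hx => ?_, fun B hB => ?_, ?_, ?_,
      fun j hj => ?_⟩) fun τ₂ ⟨wr, wa, wi, wl, wT⟩ => Halts.assign ⟨fun x hx => ?_, wa, ?_, ?_, wT⟩
    · exact (ur x (by omega)).trans (tr x hx)
    · simp only [Function.update_of_ne hB]
      rw [ua, ta B hB]
    · exact (ur s (by omega)).trans ti
    · exact (ur (s + 1) (by omega)).trans tl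
    · have hi' : τ₁.reg s = i := (ur s (by omega)).trans ti
      simp only [Function.update_self, Expr.eval, hi', uv]
      rcases Nat.lt_succ_iff_lt_or_eq.1 hj with h | rfl
      · rw [Function.update_of_ne h.ne, ua, tT j h]
      · simp
    · rw [← wr x hx]
      exact Function.update_of_ne hx.ne _ _
    · simp [Expr.eval, wi]
    · rw [← wl]
      exact Function.update_of_ne (by omega) _ _
  · rintro τ ⟨tr, ta, ti, tl, tT⟩
    simp [Expr.eval, ti, tl]

end RAM

open RAM

namespace Ready

variable {α : Type} {θ : QF} {s : ℕ} {ars : List ℕ} {Γ : Ctx α} {δ : α → WordData} {A : ℕ}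
  {T : α → ℕ → ℕ} {len : α → ℕ}

lemma cmpW_word (R : Ready θ s ars Γ δ) (hT : TableIn Γ A T len) :
    CmpW Γ fun a => (((δ a).inst θ s ars).paths (lookup (T a) (len a) (δ a).k)).word := by
  have hn : Cmp Γ fun a => (((δ a).inst θ s ars).paths (lookup (T a) (len a) (δ a).k)).M *
      (((δ a).inst θ s ars).paths (lookup (T a) (len a) (δ a).k)).W * 3 :=
    (R.cmp_M.mul R.cmp_W).mul (.const 3)
  have hs : Cmp Γ fun a => 2 * (((δ a).inst θ s ars).paths (lookup (T a) (len a) (δ a).k)).L :=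
    (Cmp.const 2).mul R.cmp_L
  refine (CmpW.ones hn).append (CmpW.zero.append ((CmpW.ones hs).append (CmpW.zero.append
    (CmpW.append (CmpW.append ⟨hn.mul hn, fun d hd => ?_⟩ (CmpW.ones (hn.mul hs)))
      ⟨hn.mul (hn.mul (hs.mul hs)), fun d hd => ?_⟩))))
  · have hn' := hn.weaken d hd
    exact (R.weaken d hd).cmp_adj (T := fun p => T p.1) (len := fun p => len p.1)
      ((Cmp.last d hd).div hn') ((Cmp.last d hd).mod hn')
  · have hn' := hn.weaken d hd
    have hs' := hs.weaken d hd
    have hss := hs'.mul hs'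
    have hnss := hn'.mul hss
    have hu := (Cmp.last d hd).div hnss
    have hr := (Cmp.last d hd).mod hnss
    have hv := hr.div hss
    have hb := (hr.mod hss).div hs'
    exact ((R.weaken d hd).cmp_adj (T := fun p => T p.1) (len := fun p => len p.1) hu hv).and
      (CmpP.eq ((R.weaken d hd).cmp_next (hT.weaken d hd) hu hv hb) ((hr.mod hss).mod hs'))

end Ready

namespace WordData

variable (θ : QF) (s : ℕ) (ars : List ℕ)

/-- The branches of the search trees of all labels. -/
noncomputable def leafTable (x : WordData) (i : ℕ) : ℕ := (x.inst θ s ars).leaf (i / x.k) (i % x.k)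

noncomputable def leafLength (x : WordData) : ℕ := (x.inst θ s ars).D * x.k

noncomputable def paths (x : WordData) : PathSystem :=
  (x.inst θ s ars).paths (lookup (x.leafTable θ s ars) (x.leafLength θ s ars) x.k)

/-- The parameter is in register `1`, the number `n` in register `2` and the word in array `0`. -/
def ctx : Ctx WordData where
  rel x σ := σ.reg 1 = x.k ∧ σ.reg 2 = x.n ∧
    ∀ j < tableLength ars x.n, σ.arr 0 (x.n + 1 + j) = x.word (x.n + 1 + j)
  size := 3
  bound x := x.n + x.k + (x.inst θ s ars).Z ^ x.k
  inv x σ σ' h hr ha := by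
    rw [hr 1 (by omega), hr 2 (by omega), ha]
    exact h

lemma ready : Ready θ s ars (ctx θ s ars) id where
  cmp_n := .var 2 (.of_le fun x => by simp only [ctx, id]; omega) fun _ _ h => h.2.1
  cmp_k := .var 1 (.of_le fun x => by simp only [ctx, id]; omega) fun _ _ h => h.1
  bdd := .of_le fun _ => Nat.le_add_left _ _
  word _ _ h := h.2.2

/-- The context in which the table of the search trees is available, in array `1`. -/
noncomputable def tableCtx : Ctx WordData :=
  (ctx θ s ars).withArr fun x arr => ∀ j < x.leafLength θ s ars, arr 1 j = x.leafTable θ s ars j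

variable {θ s ars}

lemma leafTable_le (hθ : ∀ vs ∈ θ.atoms, vs.length = s) (x : WordData) (i : ℕ) :
    x.leafTable θ s ars i ≤ (x.inst θ s ars).N :=
  SatInstance.leaf_le (I := x.inst θ s ars) hθ x.pos _ _

lemma cmp_leafLength : Cmp (ctx θ s ars) (leafLength θ s ars) :=
  (ready θ s ars).cmp_D.mul (ready θ s ars).cmp_k

lemma tableIn (hθ : ∀ vs ∈ θ.atoms, vs.length = s) :
    TableIn (tableCtx θ s ars) 1 (leafTable θ s ars) (leafLength θ s ars) where
  cmp_len := cmp_leafLength.withArr _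
  spec _ _ h := h.2
  bdd := ⟨_, (ready θ s ars).cmp_N.1, fun x j _ => x.leafTable_le hθ j⟩

/-- Entry `i` is the level `i % k` for the label `i / k`; the lower levels for this label stand
directly before it, so filling in order makes them available. -/
lemma exists_fill_leafTable (hθ : ∀ vs ∈ θ.atoms, vs.length = s) :
    ∃ (p : Prog) (Tm : WordData → ℕ), PolyBdd (ctx θ s ars).bound Tm ∧
      ∀ x σ, (ctx θ s ars).rel x σ → Halts p σ (fun σ' => (tableCtx θ s ars).rel x σ') (Tm x) := by
  have hinv : ∀ A ≠ 0, ∀ x σ σ', (ctx θ s ars).rel x σ →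
      (∀ i < (ctx θ s ars).size, σ'.reg i = σ.reg i) →
      (∀ B ≠ A, σ'.arr B = σ.arr B) → (ctx θ s ars).rel x σ' := by
    intro A hA x σ σ' h hr ha
    change σ'.reg 1 = x.k ∧ σ'.reg 2 = x.n ∧ ∀ j < tableLength ars x.n, _
    rw [hr 1 (by change 1 < 3; omega), hr 2 (by change 2 < 3; omega), ha 0 hA.symm]
    exact h
  obtain ⟨p, Tm, hTm, hp⟩ := exists_fill (Γ := ctx θ s ars) 1 (T := leafTable θ s ars)
    (hinv 1 one_ne_zero) cmp_leafLength fun d hd => by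
    have R := ((ready θ s ars).weaken d hd).withArr fun p arr =>
      p.2 < p.1.leafLength θ s ars ∧ ∀ j < p.2, arr 1 j = p.1.leafTable θ s ars j
    have hi := (Cmp.last d hd).withArr fun p arr =>
      p.2 < p.1.leafLength θ s ars ∧ ∀ j < p.2, arr 1 j = p.1.leafTable θ s ars j
    -- While the entry `p.2` is computed, only the entries before it are known, so the table has the
    -- length `p.2`.
    have hT : TableIn ((Ctx.ext (ctx θ s ars) d hd).withArr fun p arr =>
        p.2 < p.1.leafLength θ s ars ∧ ∀ j < p.2, arr 1 j = p.1.leafTable θ s ars j) 1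
        (fun p => p.1.leafTable θ s ars) fun p => p.2 :=
      ⟨hi, fun _ _ h => h.2.2, ⟨_, R.cmp_N.1, fun p j _ => p.1.leafTable_le hθ j⟩⟩
    refine (R.cmp_step hT (hi.div R.cmp_k) (hi.mod R.cmp_k)).congr fun p => ?_
    rw [leafTable, SatInstance.leaf, SatInstance.branch_eq]
    refine SatInstance.step_congr fun m hm => ?_
    simp only [id] at *
    have hdm := Nat.div_add_mod' p.2 p.1.k
    rw [lookup, if_pos (by omega), leafTable, SatInstance.leaf]
    rcases Nat.eq_zero_or_pos p.1.k with h0 | h0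
    · simp [h0]
    · have hmk : m < p.1.k := hm.trans (Nat.mod_lt _ h0)
      rw [add_comm (p.2 / p.1.k * p.1.k), Nat.add_mul_div_right _ _ h0, Nat.div_eq_of_lt hmk,
        zero_add, Nat.add_mul_mod_self_right, Nat.mod_eq_of_lt hmk]
  refine ⟨p, Tm, hTm, fun x σ h => (hp x σ h).mono ?_ le_rfl⟩
  rintro σ' ⟨hr, ha, hT⟩
  exact ⟨hinv 1 one_ne_zero x σ σ' h hr ha, hT⟩

/-- The word, in array `2`, and its length, in register `3`. -/
def copyCtx : Ctx BitWord where
  rel w σ := σ.reg 3 = w.len ∧ ∀ j < w.len, (w.bit j → σ.arr 2 j = 1) ∧ (¬ w.bit j → σ.arr 2 j = 0)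
  size := 5
  bound w := w.len
  inv w σ σ' h hr ha := by
    rw [hr 3 (by omega), ha]
    exact h

lemma tableCtx_rel_of_eq {x : WordData} {σ σ' : State} (h : (tableCtx θ s ars).rel x σ)
    (hr : ∀ i < 3, σ'.reg i = σ.reg i) (ha : ∀ B ≠ 2, σ'.arr B = σ.arr B) :
    (tableCtx θ s ars).rel x σ' := by
  refine ⟨?_, fun j hj => ?_⟩
  · change σ'.reg 1 = x.k ∧ σ'.reg 2 = x.n ∧ ∀ j < tableLength ars x.n, _
    rw [hr 1 (by omega), hr 2 (by omega), ha 0 (by omega)]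
    exact h.1
  · rw [ha 1 (by omega)]
    exact h.2 j hj

lemma cmpW_word (hθ : ∀ vs ∈ θ.atoms, vs.length = s) :
    CmpW (tableCtx θ s ars) fun x => (x.paths θ s ars).word :=
  ((ready θ s ars).withArr _).cmpW_word (tableIn hθ)

lemma cmp_M : Cmp (tableCtx θ s ars) fun x => (x.paths θ s ars).M :=
  ((ready θ s ars).withArr _).cmp_M

/-- The program that writes the word of the instance into array `2`. -/
lemma exists_buffer (hθ : ∀ vs ∈ θ.atoms, vs.length = s) :
    ∃ (p : Prog) (Tm : WordData → ℕ), PolyBdd (ctx θ s ars).bound Tm ∧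
      ∀ x σ, (ctx θ s ars).rel x σ → Halts p σ (fun σ' =>
        copyCtx.rel (x.paths θ s ars).word σ' ∧ σ'.reg 4 = (x.paths θ s ars).M) (Tm x) := by
  classical
  have hword := cmpW_word (ars := ars) hθ
  obtain ⟨p₁, T₁, hT₁, hp₁⟩ := exists_fill_leafTable (ars := ars) hθ
  -- The word goes to array `2`, because its bits are computed from array `0`, which must not be
  -- overwritten yet.
  obtain ⟨p₂, T₂, hT₂, hp₂⟩ := exists_fill (Γ := tableCtx θ s ars) 2
    (T := fun x i => if (x.paths θ s ars).word.bit i then 1 else 0)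
    (fun x σ σ' h hr ha => tableCtx_rel_of_eq h hr ha) hword.1
    fun d hd => Cmp.withArr (hword.2 d hd) _
  obtain ⟨p₃, T₃, hT₃, hp₃⟩ := hword.1.2 3 (le_refl 3)
  obtain ⟨p₄, T₄, hT₄, hp₄⟩ := (cmp_M (θ := θ) (s := s) (ars := ars)).2 4 (Nat.le_succ 3)
  refine ⟨.seq p₁ (.seq p₂ (.seq p₃ p₄)), fun x => T₁ x + (T₂ x + (T₃ x + T₄ x)),
    hT₁.add (PolyBdd.add hT₂ (PolyBdd.add hT₃ hT₄)), fun x σ hσ => ?_⟩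
  refine (hp₁ x σ hσ).seq fun σ₁ h₁ => ?_
  refine (hp₂ x σ₁ h₁).seq fun σ₂ ⟨hr₂, ha₂, hv₂⟩ => ?_
  have h₂ : (tableCtx θ s ars).rel x σ₂ := tableCtx_rel_of_eq h₁ hr₂ ha₂
  refine (hp₃ x σ₂ h₂).seq fun σ₃ ⟨ha₃, hr₃, hv₃⟩ => ?_
  have h₃ := (tableCtx θ s ars).inv x σ₂ σ₃ h₂ hr₃ ha₃
  refine (hp₄ x σ₃ h₃).mono (fun σ₄ ⟨ha₄, hr₄, hv₄⟩ => ?_) le_rfl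
  refine ⟨⟨(hr₄ 3 (by omega)).trans hv₃, fun j hj => ?_⟩, hv₄⟩
  have := hv₂ j hj
  rw [ha₄, ha₃]
  exact ⟨fun hb => by rw [this, if_pos hb], fun hb => by rw [this, if_neg hb]⟩

/-- The program that turns the buffer into the output. -/
lemma exists_copy : ∃ (p : Prog) (Tm : BitWord → ℕ), PolyBdd BitWord.len Tm ∧
    ∀ (w : BitWord) (k : ℕ) σ, copyCtx.rel w σ → σ.reg 4 = k →
      Halts p σ (fun σ' => σ'.Outputs w.toList k) (Tm w) := by
  classical
  obtain ⟨p, T, hT, hp⟩ := exists_fill (Γ := copyCtx) 0 (len := BitWord.len)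
    (T := fun w i => if w.bit i then 1 else 0) (by
      intro w σ σ' h hr ha
      change σ'.reg 3 = w.len ∧ _
      rw [hr 3 (by change 3 < 5; omega), ha 2 (by omega)]
      exact h) (.var 3 (.self _) fun _ _ h => h.1) fun d hd => by
      refine Cmp.read 2 ((Cmp.last d hd).withArr _)
        ((PolyBdd.const _ 1).mono fun p => by split_ifs <;> simp) ?_
      rintro ⟨w, i⟩ σ ⟨⟨⟨-, h⟩, -⟩, hi, -⟩
      simp only
      split_ifs with hb
      · exact (h i hi).1 hb
      · exact (h i hi).2 hb
  refine ⟨.seq p (.seq (.assign 0 (.reg 3)) (.assign 1 (.reg 4))), fun w => T w + (1 + 1),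
    PolyBdd.add hT (.const _ _), fun w k σ hσ hk => ?_⟩
  refine (hp w σ hσ).seq fun σ₁ ⟨hr, ha, hv⟩ => ?_
  -- The context has size `5` so that register `4`, with the new parameter, survives the copying.
  have hr' : ∀ i < 5, σ₁.reg i = σ.reg i := hr
  refine Halts.seq (Q := fun σ' => σ'.reg 0 = w.len ∧ σ'.reg 4 = k ∧ σ'.arr = σ₁.arr)
    (Halts.assign ⟨?_, ?_, rfl⟩) fun σ₂ ⟨h0, h4, ha₂⟩ => Halts.assign ⟨?_, ?_, fun i hi => ?_⟩
  · simp [Expr.eval, hr' 3 (by omega), hσ.1]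
  · simp [hr' 4 (by omega), hk]
  · simp [h0, BitWord.length_toList]
  · simp [Expr.eval, h4]
  · rw [BitWord.length_toList] at hi
    have hb := BitWord.getD_toList hi
    simp only [ha₂]
    rw [hv i hi]
    split_ifs with h
    · rw [hb.2 h]
      rfl
    · rw [Bool.eq_false_iff.2 (mt hb.1 h)]
      rfl

/-- The program that writes the instance of Unique Label Cover. -/
lemma exists_output (hθ : ∀ vs ∈ θ.atoms, vs.length = s) :
    ∃ (p : Prog) (Tm : WordData → ℕ), PolyBdd (ctx θ s ars).bound Tm ∧
      ∀ x σ, (ctx θ s ars).rel x σ → Halts p σ (fun σ' =>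
        σ'.Outputs (x.paths θ s ars).ulc.encode (x.paths θ s ars).M) (Tm x) := by
  obtain ⟨p₁, T₁, hT₁, hp₁⟩ := exists_buffer (ars := ars) hθ
  obtain ⟨p₂, T₂, hT₂, hp₂⟩ := exists_copy
  have hlen : PolyBdd (ctx θ s ars).bound fun x => (x.paths θ s ars).word.len :=
    (cmpW_word hθ).1.1
  refine ⟨.seq p₁ p₂, fun x => T₁ x + T₂ (x.paths θ s ars).word,
    hT₁.add (hlen.trans (hT₂.comp fun x : WordData => (x.paths θ s ars).word)),
    fun x σ hσ => (hp₁ x σ hσ).seq fun σ₁ ⟨h, hk⟩ => ?_⟩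
  rw [← PathSystem.toList_word]
  exact hp₂ _ _ σ₁ h hk

end WordData

/-! ### The reduction -/

open RAM

namespace WeightedDef

/-- The word starts with `n` in unary and has the length of the code of a structure of size `n`. -/
def IsCode (ars : List ℕ) (w : List Bool) (n : ℕ) : Prop :=
  0 < n ∧ (∀ i < n, w.getD i false = true) ∧ w.getD n false = false ∧
    w.length = n + 1 + tableLength ars n

lemma IsCode.unique {ars : List ℕ} {w : List Bool} {n n' : ℕ} (h : IsCode ars w n)
    (h' : IsCode ars w n') : n = n' := by
  rcases lt_trichotomy n n' with hlt | heq | hlt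
  · exact absurd (h'.2.1 n hlt) (by rw [h.2.2.1]; simp)
  · exact heq
  · exact absurd (h.2.1 n' hlt) (by rw [h'.2.2.1]; simp)

variable {m : ℕ} {ar : Fin m → ℕ}

lemma isCode_encode {n : ℕ} (hn : 0 < n) (R : ∀ i, Set (Fin (ar i) → Fin n)) :
    IsCode (List.ofFn ar) (encode R) n := by
  classical
  refine ⟨hn, fun i hi => ?_, ?_, ?_⟩
  · rw [encode, List.getD_append _ _ _ _ (by simpa), List.getD_eq_getElem _ _ (by simpa)]
    simp
  · rw [encode, List.getD_append_right _ _ _ _ (by simp)]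
    simp
  · rw [encode, List.length_append, List.length_cons, List.length_flatMap, tableLength,
      List.ofFn_eq_map, List.map_map]
    simp only [List.length_replicate, List.length_ofFn, Function.comp_def]
    omega

lemma exists_blocks {n : ℕ} (l : List Bool) (h : l.length = tableLength (List.ofFn ar) n) :
    ∃ g : Fin m → List Bool, (∀ i, (g i).length = n ^ ar i) ∧ (List.finRange m).flatMap g = l := by
  induction m generalizing l with
  | zero =>
    refine ⟨fun i => i.elim0, fun i => i.elim0, ?_⟩
    have : l = [] := by simpa [tableLength] using h
    simp [this]
  | succ m ih =>
    have h' : l.length = n ^ ar 0 + tableLength (List.ofFn fun i : Fin m => ar i.succ) n := by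
      rw [h, tableLength, List.ofFn_succ]
      simp [tableLength]
    obtain ⟨g, hg, hg'⟩ := ih (ar := fun i => ar i.succ) (l.drop (n ^ ar 0)) (by
      rw [List.length_drop, h']; omega)
    refine ⟨Fin.cons (l.take (n ^ ar 0)) g, fun i => ?_, ?_⟩
    · refine Fin.cases ?_ (fun i => ?_) i
      · simp [h']
      · simpa using hg i
    · rw [List.finRange_succ, List.flatMap_cons, List.flatMap_map]
      simp only [Fin.cons_zero, Fin.cons_succ, hg']
      exact List.take_append_drop _ _

/-- Every word of the right shape is a code, so testing the unary block and the length recognizes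
the codes. -/
lemma exists_encode_eq {n : ℕ} {w : List Bool} (h : IsCode (List.ofFn ar) w n) :
    ∃ R : ∀ i, Set (Fin (ar i) → Fin n), encode R = w := by
  classical
  obtain ⟨-, h1, h2, h3⟩ := h
  obtain ⟨g, hg, hg'⟩ := exists_blocks (ar := ar) (n := n) (w.drop (n + 1)) (by
    rw [List.length_drop, h3]; omega)
  refine ⟨fun i => {f | (g i).getD (finFunctionFinEquiv f) false = true}, ?_⟩
  have hfirst : w.take (n + 1) = List.replicate n true ++ [false] := by
    refine List.ext_getElem (by simp [h3]) fun j hj hj' => ?_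
    have hjn : j < n + 1 := by simpa using hj'
    have hjw : j < w.length := by omega
    rw [List.getElem_take, ← List.getD_eq_getElem _ false hjw]
    rcases Nat.lt_succ_iff_lt_or_eq.1 hjn with hlt | rfl
    · rw [h1 j hlt, List.getElem_append_left (by simpa)]
      simp
    · rw [h2, List.getElem_append_right (by simp)]
      simp
  rw [← List.take_append_drop (n + 1) w, hfirst, ← hg', encode, List.append_assoc,
    List.singleton_append]
  congr 3
  funext i
  refine List.ext_getElem (by simp [hg]) fun j hj hj' => ?_
  simp only [List.getElem_ofFn, Set.mem_ofPred_eq, Equiv.apply_symm_apply, Bool.decide_eq_true]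
  exact List.getD_eq_getElem _ _ hj'

end WeightedDef

open WeightedDef

/-- The data in a word that is the code of a structure. -/
noncomputable def codeData (w : List Bool) (k : ℕ) {ars : List ℕ} (h : ∃ n, IsCode ars w n) :
    WordData := ⟨h.choose, k, fun i => (w.getD i false).toNat, h.choose_spec.1⟩

open Classical in
/-- The reduction from weighted definability to Unique Label Cover. -/
noncomputable def reduction (θ : QF) (s : ℕ) (ars : List ℕ) (J : List Bool × ℕ) : List Bool × ℕ :=
  if h : ∃ n, IsCode ars J.1 n then
    (((codeData J.1 J.2 h).paths θ s ars).ulc.encode, ((codeData J.1 J.2 h).paths θ s ars).M)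
  else ([], 0)

lemma edgeULC_subset_nodeULC : EdgeULC ⊆ NodeULC := fun _ ⟨I, h, h'⟩ => ⟨I, h, h'.nodeSolvable⟩

lemma edgeULCFull_subset_nodeULCFull : EdgeULCFull ⊆ NodeULCFull :=
  fun _ ⟨I, hI, h, h'⟩ => ⟨I, hI, h, h'.nodeSolvable⟩

lemma edgeULCFull_subset_edgeULC : EdgeULCFull ⊆ EdgeULC := fun _ ⟨I, _, h⟩ => ⟨I, h⟩

lemma nodeULCFull_subset_nodeULC : NodeULCFull ⊆ NodeULC := fun _ ⟨I, _, h⟩ => ⟨I, h⟩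

section

variable {m s : ℕ} {ar : Fin m → ℕ}

/-- The reduction is correct for all problems between the most restricted and the most general
version of Unique Label Cover. -/
lemma mem_problem_iff_reduction_mem {φ : (vocab (extArity ar s)).Sentence} {θ : QF}
    (hθ : ∀ vs ∈ θ.atoms, vs.length = s)
    (hφ : ∀ (n : ℕ) (R : ∀ i, Set (Fin (ar i) → Fin n)) (k : ℕ), 0 < n →
      ((∃ S : Finset (Fin s → Fin n), S.card = k ∧ Models R (S : Set (Fin s → Fin n)) φ) ↔
        QFSat θ s n (tableBit n (encode R)) k))
    {Q : ParamProblem} (hQ : EdgeULCFull ⊆ Q) (hQ' : Q ⊆ NodeULC) (J : List Bool × ℕ) :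
    J ∈ problem ar s φ ↔ reduction θ s (List.ofFn ar) J ∈ Q := by
  by_cases h : ∃ n, IsCode (List.ofFn ar) J.1 n
  · rw [reduction, dif_pos h]
    set x := codeData J.1 J.2 h with hx
    set I := x.inst θ s (List.ofFn ar) with hI
    have hcode : IsCode (List.ofFn ar) J.1 x.n := h.choose_spec
    have htab : I.tab = tableBit x.n J.1 := by
      funext j
      refine propext ?_
      change j < tableLength (List.ofFn ar) x.n ∧ (J.1.getD (x.n + 1 + j) false).toNat ≠ 0 ↔
        J.1.getD (x.n + 1 + j) false = true
      constructor
      · rintro ⟨-, hb⟩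
        cases hj : J.1.getD (x.n + 1 + j) false with
        | false => rw [hj] at hb; exact absurd rfl hb
        | true => rfl
      · intro hb
        refine ⟨?_, by rw [hb]; simp⟩
        by_contra hge
        rw [List.getD_eq_default _ _ (by rw [hcode.2.2.2]; omega)] at hb
        simp at hb
    have hlf : ∀ a < I.D, ∀ i < I.k, lookup (x.leafTable θ s (List.ofFn ar))
        (x.leafLength θ s (List.ofFn ar)) x.k a i = I.leaf a i := by
      intro a ha i hi
      have hik : i < x.k := hi
      have hlt : a * x.k + i < x.leafLength θ s (List.ofFn ar) := by
        have : (a + 1) * x.k ≤ I.D * x.k := Nat.mul_le_mul_right _ ha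
        rw [add_mul] at this
        change _ < I.D * x.k
        omega
      rw [lookup, if_pos hlt, WordData.leafTable, add_comm (a * x.k),
        Nat.add_mul_div_right _ _ (by omega), Nat.div_eq_of_lt hik, zero_add,
        Nat.add_mul_mod_self_right, Nat.mod_eq_of_lt hik]
    have hsat : J ∈ problem ar s φ ↔ QFSat I.θ I.s I.n I.tab I.k := by
      rw [htab]
      constructor
      · rintro ⟨n, R, hn, hJ, hS⟩
        have hc := isCode_encode hn R
        rw [← hJ] at hc
        obtain rfl := hc.unique hcode
        have := (hφ _ R J.2 hn).1 hS
        rwa [← hJ] at this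
      · intro hS
        obtain ⟨R, hR⟩ := exists_encode_eq hcode
        refine ⟨x.n, R, x.pos, hR.symm, (hφ x.n R J.2 x.pos).2 ?_⟩
        rw [hR]
        exact hS
    rw [hsat]
    constructor
    · intro hS
      exact hQ ⟨_, PathSystem.ulc_full _, rfl,
        SatInstance.edgeSolvable_of_sat (I := I) hθ x.pos hlf hS⟩
    · intro hmem
      obtain ⟨I', he, hI'⟩ := hQ' hmem
      exact SatInstance.sat_of_nodeSolvable (I := I) hθ x.pos hlf (hI'.of_encode_eq he.symm)
  · rw [reduction, dif_neg h]
    constructor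
    · rintro ⟨n, R, hn, hJ, -⟩
      exact absurd ⟨n, hJ ▸ isCode_encode hn R⟩ h
    · intro hmem
      obtain ⟨I', he, -⟩ := hQ' hmem
      exact absurd he.symm I'.encode_ne_nil

end

/-! ### The program of the reduction -/

/-- The number `n` as the content of register `2`. -/
def sizeCtx : Ctx ℕ where
  rel n σ := σ.reg 2 = n
  size := 3
  bound n := n
  inv n σ σ' h hr _ := (hr 2 (by omega)).trans h

/-- The quantity that bounds the running time of the reduction. -/
def timeBase (θ : QF) (N k : ℕ) : ℕ := N + k + ((θ.atoms.length + 2) * (k + 1)) ^ k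

/-- The program of the reduction. It can start in any state that shows the input, and its running
time depends on the length of the leading block of nonzero cells, not on the length of the word. -/
lemma exists_reduction_program {θ : QF} {s : ℕ} (hθ : ∀ vs ∈ θ.atoms, vs.length = s)
    (ars : List ℕ) :
    ∃ (p : Prog) (C c : ℕ), ∀ w k σ N, σ.Outputs w k → σ.arr 0 N = 0 →
      Halts p σ (fun σ' => σ'.Outputs (reduction θ s ars (w, k)).1 (reduction θ s ars (w, k)).2)
        (C * (timeBase θ N k + 1) ^ c) := by
  classical
  obtain ⟨p₁, T₁, ⟨C₁, c₁, hT₁⟩, hp₁⟩ := WordData.exists_output (ars := ars) hθ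
  have hn : Cmp sizeCtx fun n => n := .var 2 (.self _) fun _ _ h => h
  obtain ⟨p₀, T₀, ⟨C₀, c₀, hT₀⟩, hp₀⟩ :=
    ((hn.add (.const 1)).add (hn.tableLength ars)).2 3 (le_refl 3)
  have hid := PolyBdd.self fun b : ℕ => b
  have hmon : ∀ C c : ℕ, PolyBdd (fun b : ℕ => b) fun b => C * (b + 1) ^ c := fun C c =>
    ⟨C, c, fun _ => le_rfl⟩
  obtain ⟨C, c, hC⟩ := (PolyBdd.const _ 1).add (((hid.mul (.const _ 2)).add (.const _ 1)).add
    ((hmon C₀ c₀).add (((hmon C₁ c₁).add (.const _ 2)).add (.const _ 1))))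
  -- Register `2` counts the leading nonzero cells, and register `3` gets the length of a code with
  -- this `n`. The tested sum is `0` exactly if the length is right and `n` is positive.
  refine ⟨.seq (.assign 2 (.lit 0)) (.seq
    (.loop (.read 0 (.reg 2)) (.assign 2 (.add (.reg 2) (.lit 1)))) (.seq p₀
    (.ite (.add (.add (.sub (.reg 0) (.reg 3)) (.sub (.reg 3) (.reg 0))) (.sub (.lit 1) (.reg 2)))
      (.seq (.assign 0 (.lit 0)) (.assign 1 (.lit 0))) p₁))), C, c, fun w k σ N hσ hN => ?_⟩
  obtain ⟨h0, h1, hw⟩ := hσ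
  have hex : ∃ n, σ.arr 0 n = 0 := ⟨N, hN⟩
  -- The first zero cell may lie behind the word; then the length test fails.
  set n := Nat.find hex with hndef
  have hnN : n ≤ N := Nat.find_min' hex hN
  have hzero : σ.arr 0 n = 0 := Nat.find_spec hex
  have hmin : ∀ i < n, σ.arr 0 i ≠ 0 := fun i hi => Nat.find_min hex hi
  have hcode : ∀ n', IsCode ars w n' → n' = n := by
    rintro n' ⟨-, hc₁, hc₂, hc₃⟩
    rcases lt_trichotomy n' n with hlt | heq | hlt
    · refine absurd ?_ (hmin n' hlt)
      rw [hw n' (by omega), hc₂]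
      rfl
    · exact heq
    · rw [hw n (by omega), hc₁ n hlt] at hzero
      simp at hzero
  have hcode' : w.length = n + 1 + tableLength ars n → 0 < n → IsCode ars w n := by
    refine fun hlen hpos => ⟨hpos, fun i hi => ?_, ?_, hlen⟩
    · have := hmin i hi
      rw [hw i (by omega)] at this
      simpa using this
    · rw [hw n (by omega)] at hzero
      simpa using hzero
  let Inv : ℕ → State → Prop := fun i τ =>
    τ.reg 0 = w.length ∧ τ.reg 1 = k ∧ τ.reg 2 = i ∧ τ.arr = σ.arr
  have hb : n ≤ timeBase θ N k := by unfold timeBase; omega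
  refine Halts.mono (Halts.seq (Q := Inv 0) (Halts.assign ⟨?_, ?_, ?_, rfl⟩) fun σ₁ hσ₁ =>
    Halts.seq (Q := Inv n) (T₁ := n * (1 + 1) + 1)
      (T₂ := T₀ n + (C₁ * (timeBase θ N k + 1) ^ c₁ + 2 + 1))
      (Halts.loop Inv n 1 ?_ ?_ hσ₁) fun σ₂ hσ₂ =>
    (hp₀ n σ₂ hσ₂.2.2.1).seq fun σ₃ ⟨ha₃, hr₃, hv₃⟩ => Halts.ite (fun he => ?_) fun he => ?_)
    (fun _ h => h) (le_trans ?_ (hC (timeBase θ N k)))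
  · simpa using h0
  · simpa using h1
  · simp [Expr.eval]
  · rintro i hi τ ⟨t0, t1, t2, ta⟩
    refine ⟨by simpa [Expr.eval, t2, ta] using hmin i hi, Halts.assign ⟨?_, ?_, ?_, ta⟩⟩
    · simpa using t0
    · simpa using t1
    · simp [Expr.eval, t2]
  · rintro τ ⟨t0, t1, t2, ta⟩
    simpa [Expr.eval, t2, ta] using hzero
  · have hno : ¬ ∃ n', IsCode ars w n' := by
      rintro ⟨n', hn'⟩
      obtain rfl := hcode n' hn'
      refine he ?_
      simp only [Expr.eval, hr₃ 0 (by omega), hr₃ 2 (by omega), hv₃, hσ₂.1, hσ₂.2.2.1, hn'.2.2.2]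
      have := hn'.1
      omega
    rw [reduction, dif_neg hno]
    refine Halts.mono (T := 1 + 1) (Halts.seq (Q := fun τ => τ.reg 0 = 0) (Halts.assign ?_)
      fun τ hτ => Halts.assign ⟨?_, ?_, fun i hi => by simp at hi⟩) (fun _ h => h) (by omega)
    · simp [Expr.eval]
    · simpa using hτ
    · simp [Expr.eval]
  · simp only [Expr.eval, hr₃ 0 (by omega), hr₃ 2 (by omega), hv₃, hσ₂.1, hσ₂.2.2.1] at he
    have hyes : ∃ n', IsCode ars w n' := ⟨n, hcode' (by omega) (by omega)⟩
    have hxn : (codeData w k hyes).n = n := hcode _ hyes.choose_spec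
    have hlen : w.length = n + 1 + tableLength ars n := by omega
    rw [reduction, dif_pos hyes]
    refine (hp₁ (codeData w k hyes) σ₃ ⟨?_, ?_, fun j hj => ?_⟩).mono (fun _ h => h)
      (le_trans (hT₁ _) (le_trans ?_ (Nat.le_add_right _ 2)))
    · rw [hr₃ 1 (by omega), hσ₂.2.1]
      rfl
    · rw [hr₃ 2 (by omega), hσ₂.2.2.1, hxn]
    · rw [hxn] at hj
      rw [ha₃, hσ₂.2.2.2, hxn, hw _ (by omega)]
      rfl
    · refine Nat.mul_le_mul_left _ (Nat.pow_le_pow_left (Nat.add_le_add_right ?_ 1) _)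
      change (codeData w k hyes).n + k + _ ≤ N + k + _
      rw [hxn]
      exact Nat.add_le_add_right (by omega) _
  · have h₀ : T₀ n ≤ C₀ * (timeBase θ N k + 1) ^ c₀ := (hT₀ n).trans
      (Nat.mul_le_mul_left _ (Nat.pow_le_pow_left (Nat.add_le_add_right hb 1) _))
    simp only
    omega

/-- A run of `t` steps changes at most `t` cells of an array. -/
lemma RAM.Run.exists_support {p : Prog} {σ σ' : State} {t : ℕ} (h : Run p σ σ' t) (a : ℕ) :
    ∃ F : Finset ℕ, F.card ≤ t ∧ ∀ i ∉ F, σ'.arr a i = σ.arr a i := by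
  induction h with
  | skip σ => exact ⟨∅, by simp, fun _ _ => rfl⟩
  | assign σ x e => exact ⟨∅, by simp, fun _ _ => rfl⟩
  | write σ b i e =>
    refine ⟨{i.eval σ}, by simp, fun j hj => ?_⟩
    rw [Finset.mem_singleton] at hj
    by_cases hab : a = b
    · subst hab
      simp [Function.update_of_ne hj]
    · simp [Function.update_of_ne hab]
  | seq _ _ ih₁ ih₂ =>
    obtain ⟨F, hF, h⟩ := ih₁
    obtain ⟨F', hF', h'⟩ := ih₂
    refine ⟨F ∪ F', (Finset.card_union_le _ _).trans (by omega), fun i hi => ?_⟩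
    rw [Finset.notMem_union] at hi
    rw [h' i hi.2, h i hi.1]
  | ite_true _ _ ih =>
    obtain ⟨F, hF, h⟩ := ih
    exact ⟨F, by omega, h⟩
  | ite_false _ _ ih =>
    obtain ⟨F, hF, h⟩ := ih
    exact ⟨F, by omega, h⟩
  | loop_done _ => exact ⟨∅, by simp, fun _ _ => rfl⟩
  | loop_step _ _ _ ih₁ ih₂ =>
    obtain ⟨F, hF, h⟩ := ih₁
    obtain ⟨F', hF', h'⟩ := ih₂
    refine ⟨F ∪ F', (Finset.card_union_le _ _).trans (by omega), fun i hi => ?_⟩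
    rw [Finset.notMem_union] at hi
    rw [h' i hi.2, h i hi.1]

/-- After `t` steps on the input `x`, one of the first `|x| + t + 1` cells of the input array is
zero. -/
lemma RAM.Run.exists_arr_eq_zero {p : Prog} {x : List Bool} {k : ℕ} {σ : State} {t : ℕ}
    (h : Run p (State.init x k) σ t) : ∃ N ≤ x.length + t, σ.arr 0 N = 0 := by
  obtain ⟨F, hF, hσ⟩ := h.exists_support 0
  -- Of the `t + 1` cells directly behind the input, all initially zero, at most `t` have changed.
  obtain ⟨N, hN, hNF⟩ := Finset.exists_mem_notMem_of_card_lt_card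
    (s := F) (t := Finset.Ico x.length (x.length + t + 1)) (by simp; omega)
  rw [Finset.mem_Ico] at hN
  refine ⟨N, by omega, ?_⟩
  rw [hσ N hNF]
  simp [State.init, List.getElem?_eq_none hN.1]

/-! ### Hardness -/

lemma Computable.nat_add {f g : ℕ → ℕ} (hf : Computable f) (hg : Computable g) :
    Computable fun k => f k + g k := Primrec.nat_add.to_comp.comp hf hg

lemma Computable.nat_mul {f g : ℕ → ℕ} (hf : Computable f) (hg : Computable g) :
    Computable fun k => f k * g k := Primrec.nat_mul.to_comp.comp hf hg

lemma Computable.nat_pow {f g : ℕ → ℕ} (hf : Computable f) (hg : Computable g) :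
    Computable fun k => f k ^ g k := (Primrec₂.unpaired'.1 Nat.Primrec.pow).to_comp.comp hf hg

lemma reduction_snd_le (θ : QF) (s : ℕ) (ars : List ℕ) (J : List Bool × ℕ) :
    (reduction θ s ars J).2 ≤ (J.2 + 1) ^ (θ.atoms.length + 2) * (J.2 + 1) * 2 := by
  unfold reduction
  split_ifs with h
  · exact le_rfl
  · exact Nat.zero_le _

/-- The running time of a composition of reductions. -/
lemma composed_time_le {f t n N B C c d : ℕ} (ht : t ≤ f * (n + 1) ^ d) (hN : N ≤ n + t) :
    t + C * (N + B + 1) ^ c ≤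
      (f + C * (f + 1 + B) ^ c) * (n + 1) ^ (d + (d + 1) * c) := by
  have hpos : 0 < n + 1 := n.succ_pos
  have h₁ : (n + 1) ^ d ≤ (n + 1) ^ (d + 1) := Nat.pow_le_pow_right hpos (by omega)
  have h₂ : n + 1 ≤ (n + 1) ^ (d + 1) := Nat.le_self_pow (by omega) _
  have h₃ : N + B + 1 ≤ (f + 1 + B) * (n + 1) ^ (d + 1) := by
    have := Nat.mul_le_mul_left f h₁
    have := Nat.le_mul_of_pos_right B (show 0 < (n + 1) ^ (d + 1) by positivity)
    rw [add_mul, add_mul]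
    omega
  calc t + C * (N + B + 1) ^ c
      ≤ f * (n + 1) ^ d + C * ((f + 1 + B) * (n + 1) ^ (d + 1)) ^ c := by gcongr
    _ = f * (n + 1) ^ d + C * (f + 1 + B) ^ c * (n + 1) ^ ((d + 1) * c) := by
        rw [mul_pow, ← pow_mul, mul_assoc]
    _ ≤ f * (n + 1) ^ (d + (d + 1) * c) +
        C * (f + 1 + B) ^ c * (n + 1) ^ (d + (d + 1) * c) := by
        gcongr <;> omega
    _ = _ := (add_mul _ _ _).symm

/-- All problems between the most restricted and the most general version of Unique Label Cover are
hard. -/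
lemma w1Hard_of_subset {P : ParamProblem} (h : EdgeULCFull ⊆ P) (h' : P ⊆ NodeULC) : W1Hard P := by
  rintro Q ⟨m, s, ar, φ, hφ, red, p, f, g, d, hf, hg, hred, hk, hrun⟩
  obtain ⟨θ, hθ, hsat⟩ := exists_qf hφ
  obtain ⟨p', C, c, hp'⟩ := exists_reduction_program hθ (List.ofFn ar)
  set q := θ.atoms.length + 2 with hq
  set B : ℕ → ℕ := fun k => g k + (q * (g k + 1)) ^ g k with hB
  have hg' : Computable fun k => g k + 1 := hg.nat_add (.const 1)
  have hBc : Computable B := hg.nat_add (((Computable.const q).nat_mul hg').nat_pow hg)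
  refine ⟨fun J => reduction θ s (List.ofFn ar) (red J), .seq p p',
    fun k => f k + C * (f k + 1 + B k) ^ c, fun k => (g k + 1) ^ q * (g k + 1) * 2,
    d + (d + 1) * c,
    hf.nat_add ((Computable.const C).nat_mul (((hf.nat_add (.const 1)).nat_add hBc).nat_pow
      (.const c))),
    ((hg'.nat_pow (.const q)).nat_mul hg').nat_mul (.const 2), fun x k => ?_, fun x k => ?_,
    fun x k => ?_⟩
  · rw [hred]
    exact mem_problem_iff_reduction_mem hθ hsat h h' _
  · refine (reduction_snd_le θ s _ _).trans ?_
    have hle := hk x k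
    dsimp only
    gcongr
  · obtain ⟨σ, t, hr, ht, ho⟩ := hrun x k
    -- Repeated doubling of register `0` can announce a word far longer than `t`, so the length of
    -- the intermediate word gives no useful bound. A zero cell bounds the size of the structure
    -- instead.
    obtain ⟨N, hN, hN'⟩ := hr.exists_arr_eq_zero
    obtain ⟨σ', t', hr', ho', ht'⟩ := hp' _ _ σ N ho hN'
    refine ⟨σ', t + t', hr.seq hr', ?_, ho'⟩
    refine le_trans ?_ (composed_time_le ht hN)
    refine Nat.add_le_add_left (ht'.trans (Nat.mul_le_mul_left _ (Nat.pow_le_pow_left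
      (Nat.add_le_add_right ?_ 1) _))) _
    have hle := hk x k
    have hpow : (q * ((red (x, k)).2 + 1)) ^ (red (x, k)).2 ≤ (q * (g k + 1)) ^ g k :=
      (Nat.pow_le_pow_left (Nat.mul_le_mul_left _ (by omega)) _).trans
        (Nat.pow_le_pow_right (by positivity) hle)
    unfold timeBase
    simp only [hB, ← hq]
    omega

theorem theorem2 :
    W1Hard EdgeULC ∧ W1Hard NodeULC ∧ W1Hard EdgeULCFull ∧ W1Hard NodeULCFull := by
  exact ⟨w1Hard_of_subset edgeULCFull_subset_edgeULC edgeULC_subset_nodeULC,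
    w1Hard_of_subset (edgeULCFull_subset_edgeULC.trans edgeULC_subset_nodeULC) subset_rfl,
    w1Hard_of_subset subset_rfl (edgeULCFull_subset_edgeULC.trans edgeULC_subset_nodeULC),
    w1Hard_of_subset edgeULCFull_subset_nodeULCFull nodeULCFull_subset_nodeULC⟩
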